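/- **Setting.** Let $I=(0,1)$, $\alpha>0$, let $v_1,v_2\in\mathbb R^3$ be unit vectors and $0<R<\sqrt{(1-v_1\cdot v_2)/2}$. For $i=1,2$ let $S_i=\{w\in S^2: |\pi_{v_i^\perp}(w)|=R,\ w\cdot v_i>0\}$, where $\pi_{v_i^\perp}$ is the orthogonal projection onto $v_i^\perp$; these are two disjoint circles, and $co(S_1)$, $co(S_2)$ are disjoint discs ($co$ denotes the convex hull). Let $\lambda_n>0$ with $\lambda_n\to0$, and $k_n>0$ with $k_n\to+\infty$. Put $N_n=\lfloor 1/\lambda_n\rfloor$ and $\mathbb Z_n(I)=\{i\in\mathbb Z:\lambda_n i\in[0,1]\}=\{0,\dots,N_n\}$. $\mathcal{PC}_{\lambda_n}$ denotes the set of chains $(u^i)_{i\in\mathbb Z_n(I)}$ in $S_1\cup S_2$ with $u^0\cdot u^1=u^{N_n-1}\cdot u^{N_n}$, identified with the piecewise constant functions $u(t)=u^i$ for $t\in\lambda_n(i+[0,1))$ (for the finitely many $n$ with $\lambda_n>1$ the condition on scalar products is void). For $u$ with values in $co(S_1)\cup co(S_2)$ let $\mathcal A(u)(t)=v_1$ if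 $u(t)\in co(S_1)$ and $\mathcal A(u)(t)=v_2$ otherwise. On $\mathcal{PC}_{\lambda_n}$ let $$\mathcal E_n(u)=\lambda_n\sum_{i=0}^{N_n-2}\left[-\alpha\,u^i\cdot u^{i+1}+u^i\cdot u^{i+2}\right]+\lambda_nk_n|D\mathcal A(u)|(I),$$ and $\mathcal E_n=+\infty$ on $L^\infty(I;\mathbb R^3)\setminus\mathcal{PC}_{\lambda_n}$. (If $1/\lambda_n\in\mathbb Z$, the last spin $u^{N_n}$ is not determined by $u$ as an element of $L^\infty(I;\mathbb R^3)$; then $\mathcal E_n(u)$ is the minimum over its admissible values.) Let $\mathfrak D$ be the set of $u\in L^\infty(I;co(S_1)\cup co(S_2))$ for which $I$ has a finite partition, up to endpoints, into open intervals on each of which $u$ takes values a.e. in only one of $co(S_1)$, $co(S_2)$. For $u_n,u\in\mathfrak D$, $u_n$ $L$-converges to $u$ if $u_n\rightharpoonup^* u$ in $L^\infty(I;\mathbb R^3)$ and $\mathcal A(u_n)\to\mathcal A(u)$ weakly-* in $BV$, i.e. in $L^1(I;\mathbb R^3)$ with $D\mathcal A(u_n)\rightharpoonup^* D\mathcal A(u)$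 as measures on $I$. For $z\in co(S_1\cup S_2)$ let $$f_{hom}(z)=\lim_{\rho\to0^+}\lim_{k\to\infty}\frac1k\inf\Big\{\sum_{i=1}^{k-2}\left[-\alpha\,u^i\cdot u^{i+1}+u^i\cdot u^{i+2}\right]\;:\; u:\mathbb Z\to S_1\cup S_2,\ \Big|\frac1{k-1}\sum_{i=1}^{k-1}u^i-z\Big|\le\rho\Big\}.$$ **Theorem.** The limits defining $f_{hom}$ exist for every $z\in co(S_1\cup S_2)$, and $f_{hom}\circ u$ is integrable on $I$ for every $u\in L^\infty(I;co(S_1\cup S_2))$. Assume that $\lambda_nk_n\to\eta\in(0,+\infty]$. (i) If $\eta\in(0,+\infty)$, then $\mathcal E_n$ $\Gamma$-converges, with respect to $L$-convergence, to the functional $\mathcal E(u)=\int_I f_{hom}(u(t))\,dt+\eta|D\mathcal A(u)|(I)$ for $u\in\mathfrak D$, $\mathcal E(u)=+\infty$ otherwise. That is: if $u_n$ $L$-converges to $u\in\mathfrak D$ then $\mathcal E(u)\le\liminf_n\mathcal E_n(u_n)$; for each $u\in\mathfrak D$ there are $u_n\in\mathfrak D$ $L$-converging to $u$ with $\limsup_n\mathcal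 E_n(u_n)\le\mathcal E(u)$; and if $u_n\rightharpoonup^*u\notin\mathfrak D$ in $L^\infty(I;\mathbb R^3)$ then $\mathcal E_n(u_n)\to+\infty$. Moreover, if $u_n\in L^\infty(I;\mathbb R^3)$ and $\sup_n\mathcal E_n(u_n)<+\infty$, then a subsequence of $(u_n)$ $L$-converges to some $u\in\mathfrak D$. (ii) If $\eta=+\infty$, then $\mathcal E_n$ $\Gamma$-converges, with respect to weak-* convergence of sequences in $L^\infty(I;\mathbb R^3)$, to the functional $\mathcal E(u)=\int_I f_{hom}(u(t))\,dt$ if $u\in L^\infty(I;co(S_1))$ or $u\in L^\infty(I;co(S_2))$, $\mathcal E(u)=+\infty$ otherwise. Moreover, if $u_n\in L^\infty(I;\mathbb R^3)$ and $\sup_n\mathcal E_n(u_n)<+\infty$, then a subsequence of $(u_n)$ converges weakly-* to some $u$ in $L^\infty(I;co(S_1))$ or in $L^\infty(I;co(S_2))$. -/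

import Mathlib

open MeasureTheory Filter Set Topology
open scoped ENNReal ContDiff InnerProductSpace ZeroAtInfty

noncomputable section

namespace SpinChain

/-- Euclidean three-space. -/
abbrev R3 : Type := EuclideanSpace ℝ (Fin 3)

/-- The open interval `I = (0,1)`. -/
abbrev I : Set ℝ := Ioo 0 1

/-- Lebesgue measure on `I`. -/
abbrev volI : Measure ℝ := volume.restrict I

/-- The space `L^∞(I; ℝ³)` (classes of functions modulo a.e. equality). -/
abbrev Linf : Type := Lp R3 ∞ volI

/-- `u ∈ L^∞(I, K)`: the values of `u` lie in `K` almost everywhere. -/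
def ValuedIn (u : Linf) (K : Set R3) : Prop := ∀ᵐ t ∂volI, u t ∈ K

/-! ### The two circles and the anisotropy projection -/

/-- The circle `{w ∈ S² : |π_{v^⊥} w| = R, ⟨w, v⟩ > 0}`. -/
def circle (v : R3) (R : ℝ) : Set R3 :=
  {w | ‖w‖ = 1 ∧ ‖((Submodule.span ℝ {v})ᗮ).starProjection w‖ = R ∧ 0 < ⟪w, v⟫_ℝ}

/-- The convex hull `co(S)` of the circle with axis `v`. -/
def disc (v : R3) (R : ℝ) : Set R3 := convexHull ℝ (circle v R)

/-- The union of the two circles. -/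
def circles (v₁ v₂ : R3) (R : ℝ) : Set R3 := circle v₁ R ∪ circle v₂ R

open Classical in
/-- The projection `𝓐(u)`: it is `v₁` where `u` lies in `co(S₁)` and `v₂` elsewhere. On functions
with values in `S₁ ∪ S₂` the condition `u t ∈ co(S₁)` is the same as `u t ∈ S₁`. -/
def anis (v₁ v₂ : R3) (R : ℝ) (u : Linf) : ℝ → R3 :=
  fun t => if u t ∈ disc v₁ R then v₁ else v₂

/-! ### Functions of bounded variation on `I` -/

/-- The finite vector measure `μ` on `I` is the distributional derivative of `w`. -/
def IsDistribDeriv (w : ℝ → R3) (μ : VectorMeasure I R3) : Prop :=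
  μ.variation univ < ⊤ ∧
  ∀ φ : ℝ → ℝ, ContDiff ℝ ∞ φ → HasCompactSupport φ → tsupport φ ⊆ I →
    ∫ t in I, deriv φ t • w t = - ∫ᵛ t : I, φ (t : ℝ) ∂•μ

/-- `w ∈ BV(I; ℝ³)`. -/
def MemBV (w : ℝ → R3) : Prop :=
  IntegrableOn w I ∧ ∃ μ : VectorMeasure I R3, IsDistribDeriv w μ

open Classical in
/-- The measure `Dw` of a function `w ∈ BV(I; ℝ³)` (it is unique). -/
def distribDeriv (w : ℝ → R3) : VectorMeasure I R3 :=
  if h : MemBV w then h.2.choose else 0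

open Classical in
/-- The total variation `|Dw|(I)`; it is `∞` when `w` is not of bounded variation. -/
def totalVar (w : ℝ → R3) : ℝ≥0∞ :=
  if MemBV w then (distribDeriv w).variation univ else ∞

/-- Weak-star convergence in `BV(I; ℝ³)`: convergence in `L¹` of the functions, and weak-star
convergence of the derivatives as measures, that is against continuous functions on `I`
vanishing at the boundary. -/
def BVWeakStar (w : ℕ → ℝ → R3) (w' : ℝ → R3) : Prop :=
  (∀ n, MemBV (w n)) ∧ MemBV w' ∧
  Tendsto (fun n => ∫⁻ t in I, ‖w n t - w' t‖ₑ) atTop (𝓝 0) ∧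
  ∀ φ : C₀(I, ℝ), Tendsto (fun n => ∫ᵛ t : I, φ t ∂•(distribDeriv (w n))) atTop
    (𝓝 (∫ᵛ t : I, φ t ∂•(distribDeriv w')))

/-! ### Convergences on `L^∞` and the space `𝔇` -/

/-- Weak-star convergence in `L^∞(I; ℝ³)`, the dual of `L¹(I; ℝ³)`. -/
def WeakStar (u : ℕ → Linf) (u' : Linf) : Prop :=
  ∀ g : ℝ → R3, IntegrableOn g I →
    Tendsto (fun n => ∫ t in I, ⟪g t, u n t⟫_ℝ) atTop (𝓝 (∫ t in I, ⟪g t, u' t⟫_ℝ))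

/-- The space `𝔇`: functions with values in `co(S₁) ∪ co(S₂)` for which `I` can be cut, by
`0 = t₀ < ⋯ < t_M = 1`, into finitely many open intervals, on each of which the values lie in only
one of `co(S₁)`, `co(S₂)`. (Merging neighbours with the same disc gives the minimal partition.) -/
def domainD (v₁ v₂ : R3) (R : ℝ) : Set Linf :=
  {u | ValuedIn u (disc v₁ R ∪ disc v₂ R) ∧
    ∃ (M : ℕ) (t : Fin (M + 1) → ℝ), StrictMono t ∧ t 0 = 0 ∧ t (Fin.last M) = 1 ∧
      ∀ j : Fin M,
        (∀ᵐ x ∂volume.restrict (Ioo (t j.castSucc) (t j.succ)), u x ∈ disc v₁ R) ∨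
        (∀ᵐ x ∂volume.restrict (Ioo (t j.castSucc) (t j.succ)), u x ∈ disc v₂ R)}

/-- The `L`-convergence of a sequence in `𝔇` to an element of `𝔇`. -/
def LConv (v₁ v₂ : R3) (R : ℝ) (u : ℕ → Linf) (u' : Linf) : Prop :=
  (∀ n, u n ∈ domainD v₁ v₂ R) ∧ u' ∈ domainD v₁ v₂ R ∧ WeakStar u u' ∧
    BVWeakStar (fun n => anis v₁ v₂ R (u n)) (anis v₁ v₂ R u')

/-- Sequential `Γ`-convergence of `F n` to `F'` with respect to a notion of convergence. -/
structure IsGammaLimit {X : Type*} (conv : (ℕ → X) → X → Prop)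
    (F : ℕ → X → EReal) (F' : X → EReal) : Prop where
  liminf_le : ∀ (x : X) (u : ℕ → X), conv u x → F' x ≤ liminf (fun n => F n (u n)) atTop
  recovery : ∀ x : X, ∃ u : ℕ → X, conv u x ∧ limsup (fun n => F n (u n)) atTop ≤ F' x

/-! ### Spin chains and their energy -/

/-- The lattice `ℤ_n(I) = {i ∈ ℤ : l i ∈ [0,1]}` for the spacing `l > 0`. -/
def lattice (l : ℝ) : Finset ℤ := Finset.Icc 0 ⌊1 / l⌋

theorem mem_lattice {l : ℝ} (hl : 0 < l) (i : ℤ) : i ∈ lattice l ↔ l * i ∈ Icc (0 : ℝ) 1 := by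
  rw [lattice, Finset.mem_Icc, Int.le_floor, mem_Icc, le_div_iff₀ hl, mul_comm l,
    mul_nonneg_iff_of_pos_right hl, Int.cast_nonneg_iff]

/-- The index set `𝓘ⁿ(I)`: the lattice without its last two points. -/
def bulkLattice (l : ℝ) : Finset ℤ := lattice l \ {⌊1 / l⌋ - 1, ⌊1 / l⌋}

/-- The interaction `-α ⟨sⁱ, sⁱ⁺¹⟩ + ⟨sⁱ, sⁱ⁺²⟩`. -/
def bond (α : ℝ) (s : ℤ → R3) (i : ℤ) : ℝ :=
  -α * ⟪s i, s (i + 1)⟫_ℝ + ⟪s i, s (i + 2)⟫_ℝ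

/-- Spin chains `(sⁱ)`, `i ∈ ℤ_n(I)`, with values in `S₁ ∪ S₂` and the joint boundary condition
`⟨s⁰, s¹⟩ = ⟨s^{N-1}, s^N⟩`, `N = ⌊1/l⌋`. The values off the lattice play no role. -/
def IsChain (v₁ v₂ : R3) (R l : ℝ) (s : ℤ → R3) : Prop :=
  (∀ i ∈ lattice l, s i ∈ circles v₁ v₂ R) ∧
    ⟪s 0, s 1⟫_ℝ = ⟪s (⌊1 / l⌋ - 1), s ⌊1 / l⌋⟫_ℝ

/-- The piecewise constant function `t ↦ sⁱ` for `t ∈ l (i + [0,1))`. -/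
def stepFun (l : ℝ) (s : ℤ → R3) : ℝ → R3 := fun t => s ⌊t / l⌋

/-- The chain `s` represents the class `u`, which is then an element of `𝓟𝓒_l`. -/
def Represents (v₁ v₂ : R3) (R l : ℝ) (s : ℤ → R3) (u : Linf) : Prop :=
  IsChain v₁ v₂ R l s ∧ u =ᵐ[volI] stepFun l s

/-- The bulk energy `E_n`. -/
def bulkEnergy (α l : ℝ) (s : ℤ → R3) : ℝ := l * ∑ i ∈ bulkLattice l, bond α s i

/-- The energy `𝓔_n = E_n + P_n` on `L^∞(I; ℝ³)`, with `P_n(u) = l k |D𝓐(u)|(I)`; it is `+∞` on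
functions that are not represented by a chain. The chain of `u` is unique unless `1/l` is an
integer; in that case its last spin (at the point `1 ∉ I`) is not determined by the class `u`, and
the infimum is taken over the admissible values of that spin. -/
def energy (α : ℝ) (v₁ v₂ : R3) (R l k : ℝ) (u : Linf) : EReal :=
  ⨅ (s : ℤ → R3) (_ : Represents v₁ v₂ R l s u),
    ((bulkEnergy α l s : ℝ) : EReal) +
      ((ENNReal.ofReal (l * k) * totalVar (anis v₁ v₂ R u) : ℝ≥0∞) : EReal)

/-! ### The homogenized density -/

/-- The average of `s` over `ℤ ∩ (0,k)`. -/
def average (s : ℤ → R3) (k : ℕ) : R3 :=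
  ((Finset.Ioo (0 : ℤ) k).card : ℝ)⁻¹ • ∑ i ∈ Finset.Ioo (0 : ℤ) k, s i

/-- The minimal energy per site among chains of length `k` whose average lies in the closed ball
`B(z, ρ)`. (For `z ∈ co(S₁ ∪ S₂)` and `ρ > 0` there are such chains for all large `k`.) -/
def cellMin (α : ℝ) (v₁ v₂ : R3) (R : ℝ) (z : R3) (ρ : ℝ) (k : ℕ) : ℝ :=
  1 / (k : ℝ) * sInf {e : ℝ | ∃ s : ℤ → R3, (∀ i, s i ∈ circles v₁ v₂ R) ∧
    average s k ∈ Metric.closedBall z ρ ∧ e = ∑ i ∈ Finset.Icc (1 : ℤ) (k - 2), bond α s i}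

/-- The limit of `cellMin` as `k → ∞`. -/
def cellLim (α : ℝ) (v₁ v₂ : R3) (R : ℝ) (z : R3) (ρ : ℝ) : ℝ :=
  limUnder atTop (fun k : ℕ => cellMin α v₁ v₂ R z ρ k)

/-- The homogenized density `f_hom`. -/
def fHom (α : ℝ) (v₁ v₂ : R3) (R : ℝ) (z : R3) : ℝ :=
  limUnder (𝓝[>] (0 : ℝ)) (fun ρ => cellLim α v₁ v₂ R z ρ)

/-- The bulk term `∫_I f_hom(u(t)) dt`. -/
def homEnergy (α : ℝ) (v₁ v₂ : R3) (R : ℝ) (u : Linf) : ℝ :=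
  ∫ t in I, fHom α v₁ v₂ R (u t)

open Classical in
/-- The limit functional for `η ∈ (0,∞)`. -/
def limitFinite (α : ℝ) (v₁ v₂ : R3) (R η : ℝ) (u : Linf) : EReal :=
  if u ∈ domainD v₁ v₂ R then
    ((homEnergy α v₁ v₂ R u : ℝ) : EReal) +
      ((ENNReal.ofReal η * totalVar (anis v₁ v₂ R u) : ℝ≥0∞) : EReal)
  else ⊤

open Classical in
/-- The limit functional for `η = ∞`. -/
def limitInfinite (α : ℝ) (v₁ v₂ : R3) (R : ℝ) (u : Linf) : EReal :=
  if ValuedIn u (disc v₁ R) ∨ ValuedIn u (disc v₂ R) then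
    ((homEnergy α v₁ v₂ R u : ℝ) : EReal)
  else ⊤

end SpinChain

end

open SpinChain

/-!
The key is a description of the homogenized density by periodic chains. The pairs (mean spin, mean
energy per site) of periodic chains form a set `cellPairs`, whose closure `energySet` is compact
and, because chains can be concatenated at a cost independent of their lengths, convex. Every finite
block of a chain gives such a pair up to a bounded error (`exists_cellPair_of_block`), and every
such pair is realized by a chain over all blocks up to a bounded error
(`exists_chain_of_cellPair`). Hence the limits that define `fHom` exist, and `fHom` is the lower
boundary of `energySet` (`mk_fHom_mem`, `fHom_le`). Its epigraph is closed and convex, which gives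
lower semicontinuity and Jensen's inequality.

The second ingredient is geometric: the plane of each circle supports `co(S₁ ∪ S₂)` and meets it
exactly in the disc (`Admissible.mem_disc_of_inner_eq`), so the discs are disjoint exposed faces.
Over a disc, `fHom` is therefore already determined by the chains with values in the corresponding
circle (`mem_energySet_circle`).

*Bulk lower bound* (`WeakStar.eventually_homEnergy_le`). The interval is cut into cells of equal
length. The energy of a chain on a cell is at least the length times `fHom` at nearly the mean of
the chain, these means converge by weak-star convergence, and by Lebesgue differentiation and
Fatou's lemma the resulting sums recover the bulk term as the cells shrink (`exists_grid_sum_ge`).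

*Surface term.* On `𝔇` the map `𝓐(u)` is a step function; its distributional derivative is a sum of
Dirac masses, and the total variation is the number of jumps times `‖v₂ - v₁‖` (`totalVar_step`,
`HasLabel.totalVar_eq`). Step functions with convergent jump positions converge weakly-star in `BV`
(`bvWeakStar_step`), and the total variation is lower semicontinuous
(`BVWeakStar.eventually_lt_totalVar`).

*Compactness* (`exists_subseq_lConv`). A bound on the energy bounds the number of jumps, so along a
subsequence the jumps have fixed signs and convergent positions, and `u n` converges weakly-star.
The limit follows the limiting step function because the discs are exposed faces: the integral of
`⟪𝓐(u n), u n⟫` is maximal and converges (`HasLabel.of_weakStar`).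

*Recovery sequences* (`exists_recovery`). On a fine partition adapted to the jumps, `u` is replaced
by its means, which only lowers the bulk term by Jensen's inequality. On each interval of the
partition an almost optimal chain in the right circle is used (`exists_pattern`). Repeating the
first and the last spin makes both scalar products in the boundary condition equal to one
(`exists_glued_chain`). A diagonal argument lets the partition become finer.

If `l k → ∞`, bounded energy excludes jumps altogether, and the same lemmas apply on a single disc.
-/

namespace SpinChain

/-! ### Geometry of the two circles -/

/-- The standing assumptions on the two axes and the common radius. -/
structure Admissible (v₁ v₂ : R3) (R : ℝ) : Prop where
  norm_left : ‖v₁‖ = 1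
  norm_right : ‖v₂‖ = 1
  pos : 0 < R
  lt_sqrt : R < Real.sqrt ((1 - ⟪v₁, v₂⟫_ℝ) / 2)

/-- The axis with a given label: `v₁` for `false`, `v₂` for `true`. -/
def axis (v₁ v₂ : R3) (b : Bool) : R3 := bif b then v₂ else v₁

/-- The height `√(1 - R²)` of the plane of the circle over the origin. -/
noncomputable def height (R : ℝ) : ℝ := Real.sqrt (1 - R ^ 2)

/-- The distance, measured along `v_b`, between the disc with axis `v_b` and the other disc is
at least this number. -/
noncomputable def gap (v₁ v₂ : R3) (R : ℝ) : ℝ := 2 * height R - ‖v₁ + v₂‖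

variable {v₁ v₂ v : R3} {R : ℝ}

theorem mem_circle_iff (hv : ‖v‖ = 1) (hR : 0 < R) (hR1 : R < 1) (w : R3) :
    w ∈ circle v R ↔ ‖w‖ = 1 ∧ ⟪w, v⟫_ℝ = height R := by
  have hpyth : ‖w‖ ^ 2 = ⟪w, v⟫_ℝ ^ 2 + ‖((Submodule.span ℝ {v})ᗮ).starProjection w‖ ^ 2 := by
    rw [Submodule.norm_sq_eq_add_norm_sq_starProjection w (Submodule.span ℝ {v}),
      Submodule.starProjection_unit_singleton ℝ hv, norm_smul, hv, mul_one, Real.norm_eq_abs,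
      sq_abs, real_inner_comm]
  have h1 : 0 < 1 - R ^ 2 := by nlinarith
  have hh : 0 < height R := Real.sqrt_pos.2 h1
  have hh2 : height R ^ 2 = 1 - R ^ 2 := Real.sq_sqrt h1.le
  simp only [circle, mem_ofPred_eq]
  constructor
  · rintro ⟨h, h', h''⟩
    refine ⟨h, ?_⟩
    rw [h, h'] at hpyth
    nlinarith
  · rintro ⟨h, h'⟩
    refine ⟨h, ?_, h' ▸ hh⟩
    rw [h, h', hh2] at hpyth
    have := norm_nonneg (((Submodule.span ℝ {v})ᗮ).starProjection w)
    nlinarith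

theorem height_pos (hR : 0 < R) (hR1 : R < 1) : 0 < height R :=
  Real.sqrt_pos.2 (by nlinarith)

theorem isCompact_circle (hv : ‖v‖ = 1) (hR : 0 < R) (hR1 : R < 1) : IsCompact (circle v R) := by
  have : circle v R = Metric.sphere 0 1 ∩ {w | ⟪w, v⟫_ℝ = height R} := by
    ext w
    rw [mem_circle_iff hv hR hR1]
    simp
  rw [this]
  exact (isCompact_sphere 0 1).inter_right (isClosed_eq (by fun_prop) continuous_const)

theorem norm_le_one_of_mem_convexHull {S : Set R3} (hS : S ⊆ Metric.sphere 0 1) {x : R3}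
    (hx : x ∈ convexHull ℝ S) : ‖x‖ ≤ 1 := by
  have := convexHull_min (hS.trans Metric.sphere_subset_closedBall) (convex_closedBall 0 1) hx
  simpa using this

/-- In finite dimension the convex hull of a compact set is compact: by Carathéodory's theorem it
is a finite union of iterated joins of the set with itself. -/
theorem _root_.IsCompact.convexHull_of_finiteDimensional {E : Type*} [NormedAddCommGroup E]
    [NormedSpace ℝ E] [FiniteDimensional ℝ E] {s : Set E} (hs : IsCompact s) :
    IsCompact (convexHull ℝ s) := by
  classical
  let C : ℕ → Set E := fun n => Nat.rec s (fun _ A => convexJoin ℝ s A) n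
  have hC : ∀ n, IsCompact (C n) ∧ C n ⊆ convexHull ℝ s := by
    intro n
    induction n with
    | zero => exact ⟨hs, subset_convexHull ℝ s⟩
    | succ n ih =>
      refine ⟨?_, convexJoin_subset (subset_convexHull ℝ s) ih.2 (convex_convexHull ℝ s)⟩
      have hcont : Continuous fun p : ℝ × E × E => AffineMap.lineMap p.2.1 p.2.2 p.1 := by
        simp only [AffineMap.lineMap_apply_module]
        fun_prop
      convert ((isCompact_Icc (a := (0 : ℝ)) (b := 1)).prod (hs.prod ih.1)).image hcont using 1
      ext x
      change x ∈ convexJoin ℝ s (C n) ↔ _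
      simp only [mem_convexJoin, segment_eq_image_lineMap, mem_image, mem_prod, Prod.exists]
      tauto
  have hcov : convexHull ℝ s = ⋃ n ∈ Finset.range (Module.finrank ℝ E + 1), C n := by
    refine Subset.antisymm ?_ (iUnion₂_subset fun n _ => (hC n).2)
    rw [convexHull_eq_union]
    refine iUnion_subset fun t => iUnion_subset fun hts => iUnion_subset fun hind => ?_
    have hsub : ∀ (n : ℕ) (t : Finset E), t.card = n + 1 → (t : Set E) ⊆ s →
        convexHull ℝ (t : Set E) ⊆ C n := by
      intro n
      induction n with
      | zero =>
        intro t ht hts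
        obtain ⟨a, rfl⟩ := Finset.card_eq_one.1 ht
        rw [Finset.coe_singleton, singleton_subset_iff] at hts
        rw [Finset.coe_singleton, convexHull_singleton, singleton_subset_iff]
        exact hts
      | succ n ih =>
        intro t ht hts
        obtain ⟨a, t', ha, rfl, ht'⟩ := Finset.card_eq_succ.1 ht
        rw [Finset.coe_insert] at hts ⊢
        rw [convexHull_insert (by rw [Finset.coe_nonempty, ← Finset.card_pos]; omega)]
        exact convexJoin_mono (singleton_subset_iff.2 (hts (mem_insert a _)))
          (ih t' ht' ((subset_insert a _).trans hts))
    rcases t.eq_empty_or_nonempty with rfl | hne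
    · simp
    · have h1 := hind.card_le_finrank_succ
      rw [Fintype.card_coe] at h1
      have h2 := hne.card_pos
      have h3 := (vectorSpan ℝ (range ((↑) : t → E))).finrank_le
      exact (hsub (t.card - 1) t (by omega) hts).trans
        (subset_biUnion_of_mem (u := C) (by simp; omega))
  rw [hcov]
  exact (Finset.range _).isCompact_biUnion fun n _ => (hC n).1

namespace Admissible

theorem lt_one (h : Admissible v₁ v₂ R) : R < 1 := by
  have h1 := abs_le.1 (abs_real_inner_le_norm v₁ v₂)
  rw [h.norm_left, h.norm_right] at h1
  refine h.lt_sqrt.trans_le (Real.sqrt_le_one.2 ?_)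
  linarith [h1.1]

theorem norm_axis (h : Admissible v₁ v₂ R) (b : Bool) : ‖axis v₁ v₂ b‖ = 1 := by
  cases b
  · exact h.norm_left
  · exact h.norm_right

theorem gap_pos (h : Admissible v₁ v₂ R) : 0 < gap v₁ v₂ R := by
  have h1 : ‖v₁ + v₂‖ ^ 2 = 2 + 2 * ⟪v₁, v₂⟫_ℝ := by
    rw [norm_add_sq_real, h.norm_left, h.norm_right]; ring
  have h2 : R ^ 2 < (1 - ⟪v₁, v₂⟫_ℝ) / 2 := (Real.lt_sqrt h.pos.le).1 h.lt_sqrt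
  have h3 : height R ^ 2 = 1 - R ^ 2 := Real.sq_sqrt (by nlinarith [h.pos, h.lt_one])
  have h4 := height_pos h.pos h.lt_one
  have h5 : ‖v₁ + v₂‖ < 2 * height R := by
    refine lt_of_pow_lt_pow_left₀ 2 (by positivity) ?_
    rw [h1, mul_pow, h3]; linarith
  simpa [gap] using h5

theorem ne (h : Admissible v₁ v₂ R) : v₂ - v₁ ≠ 0 := by
  intro h0
  have h1 : v₁ = v₂ := (sub_eq_zero.1 h0).symm
  have h2 := h.lt_sqrt
  rw [← h1, real_inner_self_eq_norm_sq, h.norm_left] at h2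
  norm_num at h2
  exact absurd h.pos (not_lt.2 h2.le)

theorem mem_circle (h : Admissible v₁ v₂ R) (b : Bool) (w : R3) :
    w ∈ circle (axis v₁ v₂ b) R ↔ ‖w‖ = 1 ∧ ⟪w, axis v₁ v₂ b⟫_ℝ = height R :=
  mem_circle_iff (h.norm_axis b) h.pos h.lt_one w

theorem circles_subset_sphere (h : Admissible v₁ v₂ R) :
    circles v₁ v₂ R ⊆ Metric.sphere 0 1 := by
  rintro w (hw | hw)
  · simpa using ((h.mem_circle false w).1 hw).1
  · simpa using ((h.mem_circle true w).1 hw).1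

theorem circle_subset_circles (b : Bool) : circle (axis v₁ v₂ b) R ⊆ circles v₁ v₂ R := by
  cases b
  · exact subset_union_left
  · exact subset_union_right

theorem circle_subset_sphere (h : Admissible v₁ v₂ R) (b : Bool) :
    circle (axis v₁ v₂ b) R ⊆ Metric.sphere 0 1 :=
  (circle_subset_circles b).trans h.circles_subset_sphere

theorem mem_circles_iff (v₁ v₂ : R3) (R : ℝ) (w : R3) :
    w ∈ circles v₁ v₂ R ↔ ∃ b, w ∈ circle (axis v₁ v₂ b) R := by
  simp [circles, axis]

theorem inner_eq_of_mem_disc (h : Admissible v₁ v₂ R) (b : Bool) {x : R3}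
    (hx : x ∈ disc (axis v₁ v₂ b) R) : ⟪x, axis v₁ v₂ b⟫_ℝ = height R := by
  have hc : Convex ℝ {w : R3 | ⟪w, axis v₁ v₂ b⟫_ℝ = height R} :=
    convex_hyperplane (f := fun w : R3 => ⟪w, axis v₁ v₂ b⟫_ℝ)
      ⟨fun x y => inner_add_left x y _, fun c x => real_inner_smul_left x _ c⟩ _
  exact convexHull_min (fun w hw => ((h.mem_circle b w).1 hw).2) hc hx

theorem inner_le_of_mem_circle_not (h : Admissible v₁ v₂ R) (b : Bool) {x : R3}
    (hx : x ∈ circle (axis v₁ v₂ !b) R) :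
    ⟪x, axis v₁ v₂ b⟫_ℝ ≤ height R - gap v₁ v₂ R := by
  obtain ⟨h1, h2⟩ := (h.mem_circle _ x).1 hx
  have h3 : ⟪x, axis v₁ v₂ b⟫_ℝ + ⟪x, axis v₁ v₂ !b⟫_ℝ = ⟪x, v₁ + v₂⟫_ℝ := by
    rw [inner_add_right]
    cases b
    · rfl
    · exact add_comm _ _
  have h4 := real_inner_le_norm x (v₁ + v₂)
  rw [h1, one_mul] at h4
  rw [gap]
  linarith

theorem inner_le_of_mem_disc_not (h : Admissible v₁ v₂ R) (b : Bool) {x : R3}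
    (hx : x ∈ disc (axis v₁ v₂ !b) R) :
    ⟪x, axis v₁ v₂ b⟫_ℝ ≤ height R - gap v₁ v₂ R := by
  have hc : Convex ℝ {w : R3 | ⟪w, axis v₁ v₂ b⟫_ℝ ≤ height R - gap v₁ v₂ R} :=
    convex_halfSpace_le (f := fun w : R3 => ⟪w, axis v₁ v₂ b⟫_ℝ)
      ⟨fun x y => inner_add_left x y _, fun c x => real_inner_smul_left x _ c⟩ _
  exact convexHull_min (fun w hw => h.inner_le_of_mem_circle_not b hw) hc hx

theorem not_mem_disc_not (h : Admissible v₁ v₂ R) (b : Bool) {x : R3}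
    (hx : x ∈ disc (axis v₁ v₂ b) R) : x ∉ disc (axis v₁ v₂ !b) R := fun hx' => by
  have h1 := h.inner_le_of_mem_disc_not b hx'
  rw [h.inner_eq_of_mem_disc b hx] at h1
  linarith [h.gap_pos]

theorem disc_subset_hull (b : Bool) :
    disc (axis v₁ v₂ b) R ⊆ convexHull ℝ (circles v₁ v₂ R) :=
  convexHull_mono (circle_subset_circles b)

theorem isCompact_disc (h : Admissible v₁ v₂ R) (b : Bool) :
    IsCompact (disc (axis v₁ v₂ b) R) :=
  (isCompact_circle (h.norm_axis b) h.pos h.lt_one).convexHull_of_finiteDimensional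

theorem isCompact_hull (h : Admissible v₁ v₂ R) :
    IsCompact (convexHull ℝ (circles v₁ v₂ R)) :=
  ((isCompact_circle (h.norm_axis false) h.pos h.lt_one).union
    (isCompact_circle (h.norm_axis true) h.pos h.lt_one)).convexHull_of_finiteDimensional

theorem norm_le_one_of_mem_hull (h : Admissible v₁ v₂ R) {x : R3}
    (hx : x ∈ convexHull ℝ (circles v₁ v₂ R)) : ‖x‖ ≤ 1 :=
  norm_le_one_of_mem_convexHull h.circles_subset_sphere hx

theorem inner_le_of_mem_hull (h : Admissible v₁ v₂ R) (b : Bool) {x : R3}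
    (hx : x ∈ convexHull ℝ (circles v₁ v₂ R)) : ⟪x, axis v₁ v₂ b⟫_ℝ ≤ height R := by
  have hc : Convex ℝ {w : R3 | ⟪w, axis v₁ v₂ b⟫_ℝ ≤ height R} :=
    convex_halfSpace_le (f := fun w : R3 => ⟪w, axis v₁ v₂ b⟫_ℝ)
      ⟨fun x y => inner_add_left x y _, fun c x => real_inner_smul_left x _ c⟩ _
  refine convexHull_min (fun w hw => ?_) hc hx
  obtain ⟨b', hb'⟩ := (mem_circles_iff _ _ _ w).1 hw
  rcases Bool.eq_or_eq_not b' b with rfl | rfl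
  · exact ((h.mem_circle _ w).1 hb').2.le
  · exact (h.inner_le_of_mem_circle_not b hb').trans (by linarith [h.gap_pos])

/-- Each disc is an exposed face of `co(S₁ ∪ S₂)`. -/
theorem mem_disc_of_inner_eq (h : Admissible v₁ v₂ R) (b : Bool) {x : R3}
    (hx : x ∈ convexHull ℝ (circles v₁ v₂ R)) (hxe : ⟪x, axis v₁ v₂ b⟫_ℝ = height R) :
    x ∈ disc (axis v₁ v₂ b) R := by
  have hU : circles v₁ v₂ R = circle (axis v₁ v₂ b) R ∪ circle (axis v₁ v₂ !b) R := by
    cases b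
    · rfl
    · exact union_comm _ _
  rcases (circle (axis v₁ v₂ b) R).eq_empty_or_nonempty with h1 | h1
  · rw [hU, h1, empty_union] at hx
    have := h.inner_le_of_mem_disc_not b hx
    linarith [h.gap_pos]
  rcases (circle (axis v₁ v₂ !b) R).eq_empty_or_nonempty with h2 | h2
  · rwa [hU, h2, union_empty] at hx
  rw [hU, convexHull_union h1 h2, mem_convexJoin] at hx
  obtain ⟨y, hy, z, hz, s, t, hs, ht, hst, rfl⟩ := hx
  have hy' := h.inner_eq_of_mem_disc b hy
  have hz' := h.inner_le_of_mem_disc_not b hz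
  rw [inner_add_left, real_inner_smul_left, real_inner_smul_left, hy'] at hxe
  have ht0 : t = 0 := by
    by_contra hne
    have htp : 0 < t := lt_of_le_of_ne ht (Ne.symm hne)
    have := mul_le_mul_of_nonneg_left hz' ht
    have h3 := mul_pos htp h.gap_pos
    have : s = 1 - t := by linarith
    subst this
    nlinarith
  have hs1 : s = 1 := by linarith
  rw [ht0, hs1, one_smul, zero_smul, add_zero]
  exact hy

end Admissible
end SpinChain

namespace SpinChain

/-! ### Sums over blocks of a chain -/

variable {α : ℝ} {S : Set R3} {s s' : ℤ → R3}

theorem sum_Ico_consecutive_int {E : Type*} [AddCommMonoid E] (f : ℤ → E) {a b c : ℤ}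
    (hab : a ≤ b) (hbc : b ≤ c) :
    ∑ i ∈ Finset.Ico a b, f i + ∑ i ∈ Finset.Ico b c, f i = ∑ i ∈ Finset.Ico a c, f i := by
  rw [← Finset.sum_union (Finset.Ico_disjoint_Ico_consecutive a b c),
    Finset.Ico_union_Ico_eq_Ico hab hbc]

theorem sum_range_sum_Ico {E : Type*} [AddCommMonoid E] (f : ℤ → E) (n : ℕ → ℤ) (P : ℕ)
    (hn : ∀ j < P, n j ≤ n (j + 1)) :
    ∑ j ∈ Finset.range P, ∑ i ∈ Finset.Ico (n j) (n (j + 1)), f i =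
      ∑ i ∈ Finset.Ico (n 0) (n P), f i := by
  have key : n 0 ≤ n P ∧ ∑ j ∈ Finset.range P, ∑ i ∈ Finset.Ico (n j) (n (j + 1)), f i =
      ∑ i ∈ Finset.Ico (n 0) (n P), f i := by
    induction P with
    | zero => simp
    | succ P ih =>
      obtain ⟨h1, h2⟩ := ih fun j hj => hn j (by omega)
      refine ⟨h1.trans (hn P (by omega)), ?_⟩
      rw [Finset.sum_range_succ, h2, sum_Ico_consecutive_int f h1 (hn P (by omega))]
  exact key.2

theorem sum_Ico_period {E : Type*} [AddCommGroup E] {f : ℤ → E} {m : ℕ}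
    (hf : Function.Periodic f (m : ℤ)) (a : ℤ) :
    ∑ i ∈ Finset.Ico a (a + m), f i = ∑ i ∈ Finset.Ico (0 : ℤ) m, f i := by
  have step : ∀ a : ℤ, ∑ i ∈ Finset.Ico (a + 1) (a + 1 + m), f i =
      ∑ i ∈ Finset.Ico a (a + m), f i := by
    intro a
    have h1 := sum_Ico_consecutive_int f (a := a) (b := a + 1) (c := a + 1 + m)
      (by omega) (by omega)
    have h2 := sum_Ico_consecutive_int f (a := a) (b := a + m) (c := a + 1 + m)
      (by omega) (by omega)
    have h3 : Finset.Ico a (a + 1) = {a} := by ext; simp; omega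
    have h4 : Finset.Ico (a + m) (a + 1 + m) = {a + m} := by ext; simp; omega
    rw [h3, Finset.sum_singleton] at h1
    rw [h4, Finset.sum_singleton, hf a] at h2
    rw [← h2, add_comm] at h1
    exact add_right_cancel h1
  induction a using Int.induction_on with
  | zero => simp
  | succ i ih => rw [step, ih]
  | pred i ih =>
    rw [← ih, ← step (-(i : ℤ) - 1), sub_add_cancel]

/-- Over an arbitrary block of integers, the sum of a periodic function differs from the length of
the block times the mean value by a quantity independent of the block. -/
theorem norm_sum_Ico_sub_le {E : Type*} [NormedAddCommGroup E] [NormedSpace ℝ E] {f : ℤ → E}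
    {m : ℕ} (hm : 0 < m) (hf : Function.Periodic f (m : ℤ)) {C : ℝ} (hC : ∀ i, ‖f i‖ ≤ C)
    {z : E} (hz : (m : ℝ) • z = ∑ i ∈ Finset.Ico (0 : ℤ) m, f i) {a b : ℤ} (hab : a ≤ b) :
    ‖∑ i ∈ Finset.Ico a b, f i - ((b - a : ℤ) : ℝ) • z‖ ≤ 2 * m * C := by
  have hC0 : 0 ≤ C := (norm_nonneg _).trans (hC 0)
  have hm' : (0 : ℝ) < m := by exact_mod_cast hm
  have hsum : ∀ a b : ℤ, a ≤ b → ‖∑ i ∈ Finset.Ico a b, f i‖ ≤ ((b - a : ℤ) : ℝ) * C := by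
    intro a b hab
    refine (norm_sum_le_of_le _ fun i _ => hC i).trans_eq ?_
    rw [Finset.sum_const, Int.card_Ico, nsmul_eq_mul]
    congr 1
    have : ((b - a).toNat : ℤ) = b - a := Int.toNat_of_nonneg (by omega)
    exact_mod_cast this
  have hzC : ‖z‖ ≤ C := by
    have h1 := hsum 0 m (by omega)
    rw [← hz, norm_smul, Real.norm_of_nonneg hm'.le] at h1
    push_cast at h1
    rw [sub_zero] at h1
    exact le_of_mul_le_mul_left h1 hm'
  obtain ⟨n, rfl⟩ : ∃ n : ℕ, b = a + n := ⟨(b - a).toNat, by omega⟩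
  clear hab
  induction n using Nat.strong_induction_on generalizing a with
  | _ n ih =>
    by_cases hn : n < m
    · have h1 := hsum a (a + n) (by omega)
      have h2 : ‖((a + n - a : ℤ) : ℝ) • z‖ ≤ n * C := by
        rw [norm_smul, add_sub_cancel_left, Int.cast_natCast, Real.norm_of_nonneg (by positivity)]
        gcongr
      refine (norm_sub_le _ _).trans ?_
      rw [add_sub_cancel_left, Int.cast_natCast] at h1 h2 ⊢
      have h3 : (n : ℝ) * C ≤ m * C := by gcongr
      linarith
    · have h1 := ih (n - m) (by omega) (a := a + m)
      have h2 := sum_Ico_consecutive_int f (a := a) (b := a + m) (c := a + n)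
        (by omega) (by omega)
      rw [sum_Ico_period hf, ← hz] at h2
      have h3 : a + m + ((n - m : ℕ) : ℤ) = a + n := by omega
      rw [h3] at h1
      rw [← h2]
      convert h1 using 2
      have h4 : a + n - a = (m : ℤ) + (a + n - (a + m)) := by ring
      rw [h4, Int.cast_add, add_smul, Int.cast_natCast]
      abel

theorem abs_inner_sub_inner_le {a a' b b' : R3} (hb : ‖b‖ ≤ 1) (ha' : ‖a'‖ ≤ 1) :
    |⟪a, b⟫_ℝ - ⟪a', b'⟫_ℝ| ≤ ‖a - a'‖ + ‖b - b'‖ := by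
  have h : ⟪a, b⟫_ℝ - ⟪a', b'⟫_ℝ = ⟪a - a', b⟫_ℝ + ⟪a', b - b'⟫_ℝ := by
    rw [inner_sub_left, inner_sub_right]; ring
  rw [h]
  refine (abs_add_le _ _).trans (add_le_add ?_ ?_)
  · exact (abs_real_inner_le_norm _ _).trans (mul_le_of_le_one_right (norm_nonneg _) hb)
  · exact (abs_real_inner_le_norm _ _).trans (mul_le_of_le_one_left (norm_nonneg _) ha')

theorem abs_bond_le (hα : 0 < α) (hs : ∀ i, ‖s i‖ ≤ 1) (i : ℤ) : |bond α s i| ≤ 1 + α := by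
  have h : ∀ i j, |⟪s i, s j⟫_ℝ| ≤ 1 := fun i j =>
    (abs_real_inner_le_norm _ _).trans (mul_le_one₀ (hs i) (norm_nonneg _) (hs j))
  have h1 := abs_le.1 (h i (i + 1))
  have h2 := abs_le.1 (h i (i + 2))
  rw [bond, abs_le]
  constructor <;> nlinarith

theorem abs_bond_sub_le (hα : 0 < α) (hs : ∀ i, ‖s i‖ ≤ 1) (hs' : ∀ i, ‖s' i‖ ≤ 1) (i : ℤ) :
    |bond α s i - bond α s' i| ≤
      (1 + α) * (‖s i - s' i‖ + ‖s (i + 1) - s' (i + 1)‖ + ‖s (i + 2) - s' (i + 2)‖) := by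
  have h1 := abs_le.1 (abs_inner_sub_inner_le (a := s i) (b' := s' (i + 1)) (hs (i + 1)) (hs' i))
  have h2 := abs_le.1 (abs_inner_sub_inner_le (a := s i) (b' := s' (i + 2)) (hs (i + 2)) (hs' i))
  have h3 := norm_nonneg (s (i + 1) - s' (i + 1))
  have h4 := norm_nonneg (s (i + 2) - s' (i + 2))
  rw [bond, bond, abs_le]
  constructor <;> nlinarith

/-- If two chains agree on the interaction range of every site outside `B`, their energies differ
by at most `2 (1 + α)` per site of `B`. -/
theorem abs_sum_bond_sub_le (hα : 0 < α) (hs : ∀ i, ‖s i‖ ≤ 1) (hs' : ∀ i, ‖s' i‖ ≤ 1)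
    (F B : Finset ℤ)
    (hB : ∀ i ∈ F, i ∉ B → s i = s' i ∧ s (i + 1) = s' (i + 1) ∧ s (i + 2) = s' (i + 2)) :
    |∑ i ∈ F, bond α s i - ∑ i ∈ F, bond α s' i| ≤ 2 * (1 + α) * B.card := by
  rw [← Finset.sum_sub_distrib]
  have h1 : ∀ i ∈ F, |bond α s i - bond α s' i| ≤ if i ∈ B then 2 * (1 + α) else 0 := by
    intro i hi
    split_ifs with hiB
    · have h2 := abs_le.1 (abs_bond_le hα hs i)
      have h3 := abs_le.1 (abs_bond_le hα hs' i)
      rw [abs_le]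
      constructor <;> linarith
    · obtain ⟨e1, e2, e3⟩ := hB i hi hiB
      simp [bond, e1, e2, e3]
  refine (Finset.abs_sum_le_sum_abs _ _).trans ((Finset.sum_le_sum h1).trans ?_)
  rw [← Finset.sum_filter, Finset.sum_const, nsmul_eq_mul, mul_comm]
  have : ((F.filter (· ∈ B)).card : ℝ) ≤ B.card := by
    exact_mod_cast Finset.card_le_card fun i hi => (Finset.mem_filter.1 hi).2
  gcongr

/-! ### The set of mean spins and energies of periodic chains -/

/-- The pairs (mean spin, mean energy per site) of the periodic chains with values in `S`. -/
def cellPairs (α : ℝ) (S : Set R3) : Set (R3 × ℝ) :=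
  {x | ∃ (m : ℕ) (s : ℤ → R3), 0 < m ∧ (∀ i, s i ∈ S) ∧ Function.Periodic s (m : ℤ) ∧
    (m : ℝ) • x.1 = ∑ i ∈ Finset.Ico (0 : ℤ) m, s i ∧
    (m : ℝ) * x.2 = ∑ i ∈ Finset.Ico (0 : ℤ) m, bond α s i}

/-- The closure of `cellPairs`; the density `f_hom` is its lower boundary. -/
def energySet (α : ℝ) (S : Set R3) : Set (R3 × ℝ) := closure (cellPairs α S)

theorem norm_le_of_subset_sphere (hS : S ⊆ Metric.sphere 0 1) {x : R3} (hx : x ∈ S) : ‖x‖ ≤ 1 := by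
  have := hS hx
  simp only [mem_sphere_iff_norm, sub_zero] at this
  exact this.le

theorem periodic_bond {m : ℕ} (hs : Function.Periodic s (m : ℤ)) :
    Function.Periodic (bond α s) (m : ℤ) := fun i => by
  have h1 : i + m + 1 = i + 1 + m := by ring
  have h2 : i + m + 2 = i + 2 + m := by ring
  rw [bond, bond, h1, h2, hs, hs, hs]

/-- A finite block of a chain, repeated periodically, gives a point of `cellPairs`; only the
interactions across the junctions change. -/
theorem exists_cellPair_of_block (hα : 0 < α) (hS : S ⊆ Metric.sphere 0 1) (hs : ∀ i, s i ∈ S)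
    {a b : ℤ} (hab : a < b) :
    ∃ x ∈ cellPairs α S, ((b - a : ℤ) : ℝ) • x.1 = ∑ i ∈ Finset.Ico a b, s i ∧
      |∑ i ∈ Finset.Ico a b, bond α s i - ((b - a : ℤ) : ℝ) * x.2| ≤ 4 * (1 + α) := by
  obtain ⟨m, rfl⟩ : ∃ m : ℕ, b = a + m := ⟨(b - a).toNat, by omega⟩
  have hm : 0 < m := by omega
  have hm' : (m : ℝ) ≠ 0 := by exact_mod_cast hm.ne'
  let s' : ℤ → R3 := fun i => s (a + (i - a) % m)
  have hper : Function.Periodic s' (m : ℤ) := fun i => by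
    simp only [s']
    rw [add_sub_right_comm, Int.add_emod_right]
  have heq : ∀ i, a ≤ i → i < a + m → s' i = s i := fun i h1 h2 => by
    simp only [s']
    rw [Int.emod_eq_of_lt (by omega) (by omega), add_sub_cancel]
  have hcast : ((a + m - a : ℤ) : ℝ) = m := by push_cast; ring
  rw [hcast]
  refine ⟨((m : ℝ)⁻¹ • ∑ i ∈ Finset.Ico (0 : ℤ) m, s' i,
    (m : ℝ)⁻¹ * ∑ i ∈ Finset.Ico (0 : ℤ) m, bond α s' i),
    ⟨m, s', hm, fun i => hs _, hper, smul_inv_smul₀ hm' _, mul_inv_cancel_left₀ hm' _⟩, ?_, ?_⟩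
  · rw [smul_inv_smul₀ hm', ← sum_Ico_period hper a]
    exact Finset.sum_congr rfl fun i hi => heq i (Finset.mem_Ico.1 hi).1 (Finset.mem_Ico.1 hi).2
  · rw [mul_inv_cancel_left₀ hm', ← sum_Ico_period (periodic_bond hper) a]
    have h := abs_sum_bond_sub_le hα (s := s) (s' := s')
      (fun i => norm_le_of_subset_sphere hS (hs i))
      (fun i => norm_le_of_subset_sphere hS (hs _)) (Finset.Ico a (a + m))
      {a + m - 1, a + m - 2} (by
        intro i hi hi'
        simp only [Finset.mem_Ico, Finset.mem_insert, Finset.mem_singleton] at hi hi'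
        refine ⟨(heq _ ?_ ?_).symm, (heq _ ?_ ?_).symm, (heq _ ?_ ?_).symm⟩ <;> omega)
    refine h.trans ?_
    have : (Finset.card {a + m - 1, a + m - 2} : ℝ) ≤ 2 := by exact_mod_cast Finset.card_le_two
    nlinarith

/-- A point of `cellPairs` describes the sums over all blocks of some chain, up to a bounded
error. -/
theorem exists_chain_of_cellPair (hα : 0 < α) (hS : S ⊆ Metric.sphere 0 1) {x : R3 × ℝ}
    (hx : x ∈ cellPairs α S) : ∃ (C : ℝ) (s : ℤ → R3), 0 ≤ C ∧ (∀ i, s i ∈ S) ∧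
      ∀ a b : ℤ, a ≤ b → ‖∑ i ∈ Finset.Ico a b, s i - ((b - a : ℤ) : ℝ) • x.1‖ ≤ C ∧
        |∑ i ∈ Finset.Ico a b, bond α s i - ((b - a : ℤ) : ℝ) * x.2| ≤ C := by
  obtain ⟨m, s, hm, hs, hper, h1, h2⟩ := hx
  have hs1 : ∀ i, ‖s i‖ ≤ 1 := fun i => norm_le_of_subset_sphere hS (hs i)
  refine ⟨2 * m * (1 + α), s, by positivity, hs, fun a b hab => ⟨?_, ?_⟩⟩
  · exact norm_sum_Ico_sub_le hm hper (fun i => (hs1 i).trans (by linarith)) h1 hab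
  · exact norm_sum_Ico_sub_le hm (periodic_bond hper) (fun i => abs_bond_le hα hs1 i) h2 hab

theorem cellPairs_subset (hα : 0 < α) (hS : S ⊆ Metric.sphere 0 1) :
    cellPairs α S ⊆ Metric.closedBall 0 1 ×ˢ Icc (-(1 + α)) (1 + α) := by
  rintro ⟨z, e⟩ ⟨m, s, hm, hs, -, h1, h2⟩
  have hm' : (0 : ℝ) < m := by exact_mod_cast hm
  have hs1 : ∀ i, ‖s i‖ ≤ 1 := fun i => norm_le_of_subset_sphere hS (hs i)
  have h3 : ‖(m : ℝ) • z‖ ≤ m * 1 := by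
    rw [h1]
    refine (norm_sum_le_of_le _ fun i _ => hs1 i).trans_eq ?_
    simp
  have h4 : |(m : ℝ) * e| ≤ m * (1 + α) := by
    rw [h2]
    refine (norm_sum_le_of_le (f := bond α s) _ fun i _ => abs_bond_le hα hs1 i).trans_eq ?_
    simp only [Finset.sum_const, Int.card_Ico, sub_zero, Int.toNat_natCast, nsmul_eq_mul]
  rw [norm_smul, Real.norm_of_nonneg hm'.le] at h3
  rw [abs_mul, abs_of_pos hm'] at h4
  refine ⟨by simpa using le_of_mul_le_mul_left h3 hm', ?_⟩
  exact abs_le.1 (le_of_mul_le_mul_left h4 hm')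

theorem isCompact_energySet (hα : 0 < α) (hS : S ⊆ Metric.sphere 0 1) :
    IsCompact (energySet α S) :=
  ((isCompact_closedBall 0 1).prod isCompact_Icc).closure_of_subset (cellPairs_subset hα hS)

theorem abs_le_of_mem_energySet (hα : 0 < α) (hS : S ⊆ Metric.sphere 0 1) {x : R3 × ℝ}
    (hx : x ∈ energySet α S) : |x.2| ≤ 1 + α :=
  abs_le.2 (closure_minimal (cellPairs_subset hα hS)
    (Metric.isClosed_closedBall.prod isClosed_Icc) hx).2

/-- Concatenating `≈ t n` sites of one chain with `≈ (1 - t) n` sites of another gives convexity. -/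
theorem convex_energySet (hα : 0 < α) (hS : S ⊆ Metric.sphere 0 1) :
    Convex ℝ (energySet α S) := by
  have key : ∀ x ∈ cellPairs α S, ∀ y ∈ cellPairs α S, ∀ t r : ℝ, 0 ≤ t → 0 ≤ r → t + r = 1 →
      t • x + r • y ∈ energySet α S := by
    intro x hx y hy t r ht hr htr
    have hxb := cellPairs_subset hα hS hx
    have hyb := cellPairs_subset hα hS hy
    obtain ⟨C, s, hC, hs, hsum⟩ := exists_chain_of_cellPair hα hS hx
    obtain ⟨C', s', hC', hs', hsum'⟩ := exists_chain_of_cellPair hα hS hy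
    have hs1 : ∀ i, ‖s i‖ ≤ 1 := fun i => norm_le_of_subset_sphere hS (hs i)
    have hs1' : ∀ i, ‖s' i‖ ≤ 1 := fun i => norm_le_of_subset_sphere hS (hs' i)
    have main : ∀ n : ℕ, 0 < n → ∃ w ∈ cellPairs α S,
        ‖(n : ℝ) • (w - (t • x + r • y))‖ ≤ C + C' + 10 * (1 + α) := by
      intro n hn
      have hn' : (0 : ℝ) < n := by exact_mod_cast hn
      set p : ℤ := ⌊t * n⌋ with hp
      have hp0 : 0 ≤ p := Int.floor_nonneg.2 (by positivity)
      have hpn : p ≤ n := by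
        have h1 : (p : ℝ) ≤ t * n := Int.floor_le _
        have h2 : t * n ≤ n := mul_le_of_le_one_left hn'.le (by linarith)
        exact_mod_cast h1.trans h2
      have hpt : |(p : ℝ) - t * n| ≤ 1 := by
        rw [abs_le]
        constructor <;> linarith [Int.floor_le (t * n), Int.lt_floor_add_one (t * n)]
      let c : ℤ → R3 := fun i => if i < p then s i else s' i
      have hc : ∀ i, c i ∈ S := fun i => by
        simp only [c]; split_ifs
        exacts [hs i, hs' i]
      have hc1 : ∀ i, ‖c i‖ ≤ 1 := fun i => norm_le_of_subset_sphere hS (hc i)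
      obtain ⟨w, hw, hw1, hw2⟩ := exists_cellPair_of_block hα hS hc (a := 0) (b := n) (by omega)
      have e1 : ∑ i ∈ Finset.Ico (0 : ℤ) p, c i = ∑ i ∈ Finset.Ico (0 : ℤ) p, s i :=
        Finset.sum_congr rfl fun i hi => if_pos (Finset.mem_Ico.1 hi).2
      have e2 : ∑ i ∈ Finset.Ico p n, c i = ∑ i ∈ Finset.Ico p n, s' i :=
        Finset.sum_congr rfl fun i hi => if_neg (not_lt.2 (Finset.mem_Ico.1 hi).1)
      have e3 : ∑ i ∈ Finset.Ico p n, bond α c i = ∑ i ∈ Finset.Ico p n, bond α s' i := by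
        refine Finset.sum_congr rfl fun i hi => ?_
        have h1 := (Finset.mem_Ico.1 hi).1
        simp only [bond, c]
        rw [if_neg (by omega), if_neg (by omega), if_neg (by omega)]
      have e4 : |∑ i ∈ Finset.Ico (0 : ℤ) p, bond α c i - ∑ i ∈ Finset.Ico (0 : ℤ) p, bond α s i|
          ≤ 4 * (1 + α) := by
        have h := abs_sum_bond_sub_le hα hc1 hs1 (Finset.Ico (0 : ℤ) p) {p - 1, p - 2} (by
          intro i hi hi'
          simp only [Finset.mem_Ico, Finset.mem_insert, Finset.mem_singleton] at hi hi'
          simp only [c]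
          rw [if_pos (by omega), if_pos (by omega), if_pos (by omega)]
          exact ⟨rfl, rfl, rfl⟩)
        refine h.trans ?_
        have : (Finset.card {p - 1, p - 2} : ℝ) ≤ 2 := by exact_mod_cast Finset.card_le_two
        nlinarith
      have f1 := hsum 0 p hp0
      have f2 := hsum' p n hpn
      rw [← sum_Ico_consecutive_int c hp0 hpn, e1, e2] at hw1
      rw [← sum_Ico_consecutive_int _ hp0 hpn, e3] at hw2
      simp only [sub_zero, Int.cast_natCast, Int.cast_sub] at hw1 hw2 f1 f2
      refine ⟨w, hw, ?_⟩
      have hr' : r = 1 - t := by linarith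
      rw [Prod.norm_def, max_le_iff]
      constructor
      · have hx1 : ‖x.1‖ ≤ 1 := by simpa using hxb.1
        have hy1 : ‖y.1‖ ≤ 1 := by simpa using hyb.1
        have hid : ((n : ℝ) • (w - (t • x + r • y))).1 =
            (∑ i ∈ Finset.Ico (0 : ℤ) p, s i - (p : ℝ) • x.1) +
            (∑ i ∈ Finset.Ico p n, s' i - ((n : ℝ) - p) • y.1) +
            ((p : ℝ) - t * n) • (x.1 - y.1) := by
          simp only [Prod.smul_fst, Prod.fst_sub, Prod.fst_add, smul_sub, hw1, hr']
          module
        rw [hid]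
        have f3 : ‖((p : ℝ) - t * n) • (x.1 - y.1)‖ ≤ 1 * 2 := by
          rw [norm_smul]
          refine mul_le_mul hpt ((norm_sub_le _ _).trans (by linarith)) (norm_nonneg _) zero_le_one
        refine (norm_add₃_le).trans ?_
        linarith [f1.1, f2.1]
      · have hx2 := abs_le.2 hxb.2
        have hy2 := abs_le.2 hyb.2
        have f3 : |((p : ℝ) - t * n) * (x.2 - y.2)| ≤ 1 * (2 * (1 + α)) := by
          rw [abs_mul]
          refine mul_le_mul hpt ((abs_sub _ _).trans (by linarith)) (abs_nonneg _) zero_le_one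
        have g1 := abs_le.1 f1.2
        have g2 := abs_le.1 f2.2
        have g3 := abs_le.1 f3
        have g4 := abs_le.1 e4
        have g5 := abs_le.1 hw2
        have hid : ((n : ℝ) • (w - (t • x + r • y))).2 = (n : ℝ) * w.2 - p * x.2 -
            ((n : ℝ) - p) * y.2 + ((p : ℝ) - t * n) * (x.2 - y.2) := by
          simp only [Prod.smul_snd, Prod.snd_sub, Prod.snd_add, smul_eq_mul, hr']
          ring
        rw [hid, Real.norm_eq_abs, abs_le]
        constructor <;> linarith
    rw [energySet, Metric.mem_closure_iff]
    intro ε hε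
    obtain ⟨n, hn⟩ := exists_nat_gt ((C + C' + 10 * (1 + α)) / ε)
    have hn0 : (0 : ℝ) < n := lt_of_le_of_lt (by positivity) hn
    obtain ⟨w, hw, hw'⟩ := main n (by exact_mod_cast hn0)
    refine ⟨w, hw, ?_⟩
    rw [norm_smul, Real.norm_of_nonneg hn0.le] at hw'
    rw [dist_comm, dist_eq_norm]
    rw [div_lt_iff₀ hε] at hn
    by_contra hcon
    push Not at hcon
    nlinarith
  intro x hx y hy t r ht hr htr
  have h := map_mem_closure₂ (f := fun x y : R3 × ℝ => t • x + r • y) (u := energySet α S)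
    (by fun_prop) hx hy fun a ha b hb => key a ha b hb t r ht hr htr
  rwa [energySet, closure_closure] at h

theorem exists_mem_energySet (hα : 0 < α) (hS : S ⊆ Metric.sphere 0 1) {z : R3}
    (hz : z ∈ convexHull ℝ S) : ∃ e, (z, e) ∈ energySet α S := by
  have h : convexHull ℝ S ⊆ Prod.fst '' energySet α S := by
    refine convexHull_min (fun w hw => ?_)
      ((convex_energySet hα hS).linear_image (LinearMap.fst ℝ R3 ℝ))
    refine ⟨(w, bond α (fun _ => w) 0), subset_closure ⟨1, fun _ => w, one_pos, fun _ => hw,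
      fun _ => rfl, ?_, ?_⟩, rfl⟩
    · simp
    · have : Finset.Ico (0 : ℤ) ((1 : ℕ) : ℤ) = {0} := by ext; simp; omega
      rw [this]
      simp
  obtain ⟨x, hx, rfl⟩ := h hz
  exact ⟨x.2, hx⟩

end SpinChain

namespace SpinChain

/-! ### The homogenized density -/

variable {α : ℝ} {S : Set R3} {v₁ v₂ : R3} {R : ℝ}

/-- The least energy in `energySet` among the pairs whose mean spin is within `ρ` of `z`. -/
noncomputable def relaxed (α : ℝ) (S : Set R3) (z : R3) (ρ : ℝ) : ℝ :=
  sInf (Prod.snd '' (energySet α S ∩ Prod.fst ⁻¹' Metric.closedBall z ρ))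

theorem isLeast_relaxed (hα : 0 < α) (hS : S ⊆ Metric.sphere 0 1) {z : R3}
    (hz : z ∈ convexHull ℝ S) {ρ : ℝ} (hρ : 0 ≤ ρ) :
    IsLeast (Prod.snd '' (energySet α S ∩ Prod.fst ⁻¹' Metric.closedBall z ρ))
      (relaxed α S z ρ) := by
  refine IsCompact.isLeast_sInf (((isCompact_energySet hα hS).inter_right
    (Metric.isClosed_closedBall.preimage continuous_fst)).image continuous_snd) ?_
  obtain ⟨e, he⟩ := exists_mem_energySet hα hS hz
  exact ⟨e, (z, e), ⟨he, Metric.mem_closedBall_self hρ⟩, rfl⟩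

theorem eventually_cellMin_lt (hα : 0 < α) (h : Admissible v₁ v₂ R) {z : R3}
    (hz : z ∈ convexHull ℝ (circles v₁ v₂ R)) {ρ : ℝ} (hρ : 0 < ρ) {c : ℝ}
    (hc : relaxed α (circles v₁ v₂ R) z ρ < c) :
    ∀ᶠ k : ℕ in atTop, cellMin α v₁ v₂ R z ρ k < c ∧
      ∃ s : ℤ → R3, (∀ i, s i ∈ circles v₁ v₂ R) ∧ average s k ∈ Metric.closedBall z ρ := by
  have hS := h.circles_subset_sphere
  obtain ⟨⟨⟨z', e⟩, ⟨he, hz'⟩, hee⟩, -⟩ := isLeast_relaxed hα hS hz hρ.le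
  obtain ⟨e₀, he₀⟩ := exists_mem_energySet hα hS hz
  simp only at hee
  -- Mixing in a little of `(z, e₀)` moves the mean spin to the interior of the ball.
  obtain ⟨x, hx, hxz, hxe⟩ : ∃ x ∈ cellPairs α (circles v₁ v₂ R), dist x.1 z < ρ ∧ x.2 < c := by
    have hcont : Tendsto (fun t : ℝ => (1 - t) * e + t * e₀) (𝓝[>] 0) (𝓝 e) := by
      have : Continuous fun t : ℝ => (1 - t) * e + t * e₀ := by fun_prop
      simpa using (this.tendsto 0).mono_left nhdsWithin_le_nhds
    obtain ⟨t, ht1, ht2⟩ := ((hcont.eventually_lt_const (hee ▸ hc)).and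
      (Ioo_mem_nhdsGT (zero_lt_one' ℝ))).exists
    have hmem := convex_energySet hα hS he he₀ (a := 1 - t) (b := t) (by linarith [ht2.2])
      ht2.1.le (by ring)
    have hopen : IsOpen {x : R3 × ℝ | dist x.1 z < ρ ∧ x.2 < c} := by
      have h1 : IsOpen {x : R3 × ℝ | dist x.1 z < ρ} := isOpen_lt (by fun_prop) (by fun_prop)
      exact h1.inter (isOpen_lt continuous_snd continuous_const)
    have hin : (1 - t) • (z', e) + t • (z, e₀) ∈ {x : R3 × ℝ | dist x.1 z < ρ ∧ x.2 < c} := by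
      refine ⟨?_, ht1⟩
      have h1 : (1 - t) • z' + t • z - z = (1 - t) • (z' - z) := by module
      change dist ((1 - t) • z' + t • z) z < ρ
      have h2 : dist z' z ≤ ρ := hz'
      rw [dist_eq_norm] at h2 ⊢
      rw [h1, norm_smul, Real.norm_of_nonneg (by linarith [ht2.2])]
      have h3 : (1 - t) * ‖z' - z‖ ≤ (1 - t) * ρ :=
        mul_le_mul_of_nonneg_left h2 (by linarith [ht2.2])
      nlinarith [ht2.1]
    obtain ⟨x, hx1, hx2⟩ := mem_closure_iff.1 hmem _ hopen hin
    exact ⟨x, hx2, hx1⟩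
  obtain ⟨C, s, hC, hs, hsum⟩ := exists_chain_of_cellPair hα hS hx
  have hs1 : ∀ i, ‖s i‖ ≤ 1 := fun i => norm_le_of_subset_sphere hS (hs i)
  have hinv : Tendsto (fun k : ℕ => (k : ℝ)⁻¹) atTop (𝓝 0) := tendsto_inv_atTop_nhds_zero_nat
  have hinv1 : Tendsto (fun k : ℕ => C * ((k : ℝ) - 1)⁻¹) atTop (𝓝 0) := by
    have := (tendsto_inv_atTop_zero.comp
      (tendsto_atTop_add_const_right _ (-1) (tendsto_natCast_atTop_atTop (R := ℝ)))).const_mul C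
    rw [mul_zero] at this
    exact this
  have hlim : Tendsto (fun k : ℕ => x.2 + (C - 2 * x.2) * (k : ℝ)⁻¹) atTop (𝓝 x.2) := by
    simpa using (hinv.const_mul (C - 2 * x.2)).const_add x.2
  filter_upwards [hinv1.eventually_lt_const (sub_pos.2 hxz), hlim.eventually_lt_const hxe,
    eventually_ge_atTop 2] with k hk1 hk2 hk3
  have hk0 : (0 : ℝ) < k := by positivity
  have hk0' : (0 : ℝ) < (k : ℝ) - 1 := by
    have : (2 : ℝ) ≤ k := by exact_mod_cast hk3
    linarith
  have hIoo : Finset.Ioo (0 : ℤ) k = Finset.Ico (1 : ℤ) k := by ext; simp; omega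
  have hIcc : Finset.Icc (1 : ℤ) (k - 2) = Finset.Ico 1 ((k : ℤ) - 1) := by ext; simp; omega
  have hav : average s k ∈ Metric.closedBall z ρ := by
    have h1 := (hsum 1 k (by omega)).1
    have hcard : ((Finset.Ioo (0 : ℤ) k).card : ℝ) = (k : ℝ) - 1 := by
      rw [hIoo, Int.card_Ico, ← Int.cast_natCast, Int.toNat_of_nonneg (by omega)]
      push_cast; ring
    have h2 : ‖average s k - x.1‖ ≤ C * ((k : ℝ) - 1)⁻¹ := by
      have h3 : average s k - x.1 = ((k : ℝ) - 1)⁻¹ •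
          (∑ i ∈ Finset.Ico (1 : ℤ) k, s i - (((k : ℤ) - 1 : ℤ) : ℝ) • x.1) := by
        rw [average, hcard, hIoo, smul_sub, smul_smul]
        push_cast
        rw [inv_mul_cancel₀ hk0'.ne', one_smul]
      rw [h3, norm_smul, Real.norm_of_nonneg (by positivity), mul_comm]
      gcongr
    rw [Metric.mem_closedBall]
    have h4 := dist_triangle (average s k) x.1 z
    rw [dist_eq_norm (average s k) x.1] at h4
    linarith
  refine ⟨lt_of_le_of_lt ?_ hk2, s, hs, hav⟩
  have h5 : sInf {e : ℝ | ∃ s : ℤ → R3, (∀ i, s i ∈ circles v₁ v₂ R) ∧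
      average s k ∈ Metric.closedBall z ρ ∧ e = ∑ i ∈ Finset.Icc (1 : ℤ) (k - 2), bond α s i} ≤
      ∑ i ∈ Finset.Icc (1 : ℤ) (k - 2), bond α s i := by
    refine csInf_le ⟨-(Finset.Icc (1 : ℤ) (k - 2)).card * (1 + α), ?_⟩ ⟨s, hs, hav, rfl⟩
    rintro _ ⟨s', hs', -, rfl⟩
    have h6 : ∀ i ∈ Finset.Icc (1 : ℤ) (k - 2), -(1 + α) ≤ bond α s' i := fun i _ =>
      (abs_le.1 (abs_bond_le hα (fun i => norm_le_of_subset_sphere hS (hs' i)) i)).1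
    have h7 := Finset.card_nsmul_le_sum _ _ _ h6
    rw [nsmul_eq_mul] at h7
    linarith
  have h8 := (abs_le.1 (hsum 1 (k - 1) (by omega)).2).2
  rw [← hIcc] at h8
  push_cast at h8
  rw [cellMin, one_div]
  have h9 : ∑ i ∈ Finset.Icc (1 : ℤ) (k - 2), bond α s i ≤ k * x.2 + (C - 2 * x.2) := by
    linarith
  calc (k : ℝ)⁻¹ * _ ≤ (k : ℝ)⁻¹ * (k * x.2 + (C - 2 * x.2)) := by
        gcongr
        exact h5.trans h9
    _ = x.2 + (C - 2 * x.2) * (k : ℝ)⁻¹ := by field_simp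

theorem eventually_lt_cellMin (hα : 0 < α) (h : Admissible v₁ v₂ R) {z : R3}
    (hz : z ∈ convexHull ℝ (circles v₁ v₂ R)) {ρ : ℝ} (hρ : 0 < ρ) {c : ℝ}
    (hc : c < relaxed α (circles v₁ v₂ R) z ρ) :
    ∀ᶠ k : ℕ in atTop, c < cellMin α v₁ v₂ R z ρ k := by
  have hS := h.circles_subset_sphere
  set g := relaxed α (circles v₁ v₂ R) z ρ with hg
  have hinv : Tendsto (fun k : ℕ => (k : ℝ)⁻¹) atTop (𝓝 0) := tendsto_inv_atTop_nhds_zero_nat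
  have hlim : Tendsto (fun k : ℕ => g - (g + 5 * (1 + α)) * (k : ℝ)⁻¹) atTop (𝓝 g) := by
    simpa using (hinv.const_mul (g + 5 * (1 + α))).const_sub g
  filter_upwards [eventually_cellMin_lt hα h hz hρ (lt_add_one _), hlim.eventually_const_lt hc,
    eventually_ge_atTop 2] with k hk1 hk2 hk3
  obtain ⟨-, s₀, hs₀, hav₀⟩ := hk1
  have hk0 : (0 : ℝ) < k := by positivity
  have hk0' : (0 : ℝ) < (k : ℝ) - 1 := by
    have : (2 : ℝ) ≤ k := by exact_mod_cast hk3
    linarith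
  have hIoo : Finset.Ioo (0 : ℤ) k = Finset.Ico (1 : ℤ) k := by ext; simp; omega
  have hIcc : Finset.Icc (1 : ℤ) (k - 2) = Finset.Ico 1 ((k : ℤ) - 1) := by ext; simp; omega
  have h1 : ((k : ℝ) - 1) * g - 5 * (1 + α) ≤
      sInf {e : ℝ | ∃ s : ℤ → R3, (∀ i, s i ∈ circles v₁ v₂ R) ∧
      average s k ∈ Metric.closedBall z ρ ∧ e = ∑ i ∈ Finset.Icc (1 : ℤ) (k - 2), bond α s i} := by
    refine le_csInf ⟨_, s₀, hs₀, hav₀, rfl⟩ ?_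
    rintro _ ⟨s, hs, hav, rfl⟩
    obtain ⟨x, hx, hx1, hx2⟩ := exists_cellPair_of_block hα hS hs (a := 1) (b := k) (by omega)
    have hcard : ((Finset.Ioo (0 : ℤ) k).card : ℝ) = (k : ℝ) - 1 := by
      rw [hIoo, Int.card_Ico, ← Int.cast_natCast, Int.toNat_of_nonneg (by omega)]
      push_cast; ring
    push_cast at hx1 hx2
    rw [average, hcard, hIoo, ← hx1, smul_smul, inv_mul_cancel₀ hk0'.ne', one_smul] at hav
    have h2 : g ≤ x.2 := (isLeast_relaxed hα hS hz hρ.le).2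
      (mem_image_of_mem _ ⟨subset_closure hx, hav⟩)
    have h3 := sum_Ico_consecutive_int (bond α s) (a := 1) (b := (k : ℤ) - 1) (c := k)
      (by omega) (by omega)
    have h4 : Finset.Ico ((k : ℤ) - 1) k = {(k : ℤ) - 1} := by ext; simp; omega
    have h5 := abs_le.1 (abs_bond_le hα (fun i => norm_le_of_subset_sphere hS (hs i)) ((k : ℤ) - 1))
    rw [h4, Finset.sum_singleton] at h3
    rw [hIcc]
    have h6 := abs_le.1 hx2
    nlinarith
  refine hk2.trans_le ?_
  rw [cellMin, one_div]
  calc g - (g + 5 * (1 + α)) * (k : ℝ)⁻¹ = (k : ℝ)⁻¹ * (((k : ℝ) - 1) * g - 5 * (1 + α)) := by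
        field_simp; ring
    _ ≤ _ := by gcongr

theorem tendsto_cellMin (hα : 0 < α) (h : Admissible v₁ v₂ R) {z : R3}
    (hz : z ∈ convexHull ℝ (circles v₁ v₂ R)) {ρ : ℝ} (hρ : 0 < ρ) :
    Tendsto (fun k : ℕ => cellMin α v₁ v₂ R z ρ k) atTop
      (𝓝 (relaxed α (circles v₁ v₂ R) z ρ)) :=
  tendsto_order.2 ⟨fun _ hc => eventually_lt_cellMin hα h hz hρ hc,
    fun _ hc => (eventually_cellMin_lt hα h hz hρ hc).mono fun _ hk => hk.1⟩

theorem cellLim_eq (hα : 0 < α) (h : Admissible v₁ v₂ R) {z : R3}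
    (hz : z ∈ convexHull ℝ (circles v₁ v₂ R)) {ρ : ℝ} (hρ : 0 < ρ) :
    cellLim α v₁ v₂ R z ρ = relaxed α (circles v₁ v₂ R) z ρ :=
  (tendsto_cellMin hα h hz hρ).limUnder_eq

theorem tendsto_relaxed (hα : 0 < α) (hS : S ⊆ Metric.sphere 0 1) {z : R3}
    (hz : z ∈ convexHull ℝ S) :
    Tendsto (fun ρ => relaxed α S z ρ) (𝓝[>] 0) (𝓝 (relaxed α S z 0)) := by
  refine tendsto_order.2 ⟨fun c hc => ?_, fun c hc => ?_⟩
  · have hcpt : IsCompact (Prod.fst '' (energySet α S ∩ {x | x.2 ≤ c})) :=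
      ((isCompact_energySet hα hS).inter_right
        (isClosed_le continuous_snd continuous_const)).image continuous_fst
    have hnot : z ∉ Prod.fst '' (energySet α S ∩ {x | x.2 ≤ c}) := by
      rintro ⟨x, ⟨hx, hxc⟩, rfl⟩
      have := (isLeast_relaxed hα hS hz le_rfl).2 (mem_image_of_mem _
        (show x ∈ _ ∩ _ from ⟨hx, Metric.mem_closedBall_self le_rfl⟩))
      exact absurd (this.trans hxc) (not_le.2 hc)
    obtain ⟨ρ₀, hρ₀, hball⟩ :=
      Metric.nhds_basis_closedBall.mem_iff.1 (hcpt.isClosed.isOpen_compl.mem_nhds hnot)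
    filter_upwards [Ioc_mem_nhdsGT hρ₀] with ρ hρ
    obtain ⟨⟨x, ⟨hx, hxz⟩, hxe⟩, -⟩ := isLeast_relaxed hα hS hz hρ.1.le
    rw [← hxe]
    by_contra hcon
    exact hball (Metric.closedBall_subset_closedBall hρ.2 hxz) ⟨x, ⟨hx, not_lt.1 hcon⟩, rfl⟩
  · filter_upwards [self_mem_nhdsWithin] with ρ hρ
    refine lt_of_le_of_lt ((isLeast_relaxed hα hS hz (le_of_lt hρ)).2 ?_) hc
    obtain ⟨⟨x, ⟨hx, hxz⟩, hxe⟩, -⟩ := isLeast_relaxed hα hS hz le_rfl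
    exact ⟨x, ⟨hx, Metric.closedBall_subset_closedBall (le_of_lt hρ) hxz⟩, hxe⟩

theorem tendsto_cellLim_relaxed (hα : 0 < α) (h : Admissible v₁ v₂ R) {z : R3}
    (hz : z ∈ convexHull ℝ (circles v₁ v₂ R)) :
    Tendsto (fun ρ => cellLim α v₁ v₂ R z ρ) (𝓝[>] 0)
      (𝓝 (relaxed α (circles v₁ v₂ R) z 0)) := by
  refine (tendsto_relaxed hα h.circles_subset_sphere hz).congr' ?_
  filter_upwards [self_mem_nhdsWithin] with ρ hρ
  exact (cellLim_eq hα h hz hρ).symm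

theorem fHom_eq (hα : 0 < α) (h : Admissible v₁ v₂ R) {z : R3}
    (hz : z ∈ convexHull ℝ (circles v₁ v₂ R)) :
    fHom α v₁ v₂ R z = relaxed α (circles v₁ v₂ R) z 0 :=
  (tendsto_cellLim_relaxed hα h hz).limUnder_eq

/-- On `co(S₁ ∪ S₂)` the density `f_hom` is the lower boundary of `energySet`: the pair
`(z, f_hom z)` belongs to it. -/
theorem mk_fHom_mem (hα : 0 < α) (h : Admissible v₁ v₂ R) {z : R3}
    (hz : z ∈ convexHull ℝ (circles v₁ v₂ R)) :
    (z, fHom α v₁ v₂ R z) ∈ energySet α (circles v₁ v₂ R) := by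
  obtain ⟨⟨x, ⟨hx, hxz⟩, hxe⟩, -⟩ := isLeast_relaxed hα h.circles_subset_sphere hz le_rfl
  rw [mem_preimage, Metric.closedBall_zero, mem_singleton_iff] at hxz
  rw [fHom_eq hα h hz, ← hxe, ← hxz]
  exact hx

theorem fHom_le (hα : 0 < α) (h : Admissible v₁ v₂ R) {z : R3} {e : ℝ}
    (hz : z ∈ convexHull ℝ (circles v₁ v₂ R)) (he : (z, e) ∈ energySet α (circles v₁ v₂ R)) :
    fHom α v₁ v₂ R z ≤ e := by
  rw [fHom_eq hα h hz]
  exact (isLeast_relaxed hα h.circles_subset_sphere hz le_rfl).2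
    ⟨(z, e), ⟨he, Metric.mem_closedBall_self le_rfl⟩, rfl⟩

theorem abs_fHom_le (hα : 0 < α) (h : Admissible v₁ v₂ R) {z : R3}
    (hz : z ∈ convexHull ℝ (circles v₁ v₂ R)) : |fHom α v₁ v₂ R z| ≤ 1 + α :=
  abs_le_of_mem_energySet hα h.circles_subset_sphere (mk_fHom_mem hα h hz)

/-- The epigraph of `f_hom` over `co(S₁ ∪ S₂)`. -/
def epigraph (α : ℝ) (v₁ v₂ : R3) (R : ℝ) : Set (R3 × ℝ) :=
  {x | x.1 ∈ convexHull ℝ (circles v₁ v₂ R) ∧ fHom α v₁ v₂ R x.1 ≤ x.2}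

open scoped Pointwise in
theorem epigraph_eq (hα : 0 < α) (h : Admissible v₁ v₂ R) :
    epigraph α v₁ v₂ R = Prod.fst ⁻¹' convexHull ℝ (circles v₁ v₂ R) ∩
      (energySet α (circles v₁ v₂ R) + ({0} ×ˢ Ici 0 : Set (R3 × ℝ))) := by
  ext ⟨z, y⟩
  simp only [epigraph, mem_inter_iff, mem_preimage, mem_ofPred_eq, Set.mem_add]
  refine and_congr_right fun hz => ⟨fun hy => ?_, ?_⟩
  · exact ⟨_, mk_fHom_mem hα h hz, (0, y - fHom α v₁ v₂ R z),
      ⟨rfl, sub_nonneg.2 hy⟩, by simp⟩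
  · rintro ⟨⟨z', e⟩, he, ⟨z'', e'⟩, ⟨hz'', he'⟩, heq⟩
    simp only [mem_singleton_iff, mem_Ici] at hz'' he'
    simp only [Prod.mk_add_mk, Prod.mk.injEq, hz'', add_zero] at heq
    obtain ⟨rfl, rfl⟩ := heq
    exact (fHom_le hα h hz he).trans (by linarith)

open scoped Pointwise in
theorem isClosed_epigraph (hα : 0 < α) (h : Admissible v₁ v₂ R) :
    IsClosed (epigraph α v₁ v₂ R) := by
  rw [epigraph_eq hα h]
  refine (h.isCompact_hull.isClosed.preimage continuous_fst).inter ?_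
  exact IsClosed.add_left_of_isCompact (isClosed_singleton.prod isClosed_Ici)
    (isCompact_energySet hα h.circles_subset_sphere)

open scoped Pointwise in
theorem convex_epigraph (hα : 0 < α) (h : Admissible v₁ v₂ R) :
    Convex ℝ (epigraph α v₁ v₂ R) := by
  rw [epigraph_eq hα h]
  refine ((convex_convexHull ℝ _).linear_preimage (LinearMap.fst ℝ R3 ℝ)).inter ?_
  exact (convex_energySet hα h.circles_subset_sphere).add
    ((convex_singleton 0).prod (convex_Ici 0))

theorem lowerSemicontinuousOn_fHom (hα : 0 < α) (h : Admissible v₁ v₂ R) :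
    LowerSemicontinuousOn (fHom α v₁ v₂ R) (convexHull ℝ (circles v₁ v₂ R)) :=
  (lowerSemicontinuousOn_iff_isClosed_epigraph h.isCompact_hull.isClosed).2
    (isClosed_epigraph hα h)

/-- Over one of the discs, which is an exposed face of `co(S₁ ∪ S₂)`, only chains with values in
the corresponding circle matter: in a chain whose mean spin is close to the disc few spins lie on
the other circle, and these can be replaced. -/
theorem mem_energySet_circle (hα : 0 < α) (h : Admissible v₁ v₂ R) (b : Bool) {z : R3} {e : ℝ}
    (hz : z ∈ disc (axis v₁ v₂ b) R) (he : (z, e) ∈ energySet α (circles v₁ v₂ R)) :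
    (z, e) ∈ energySet α (circle (axis v₁ v₂ b) R) := by
  classical
  have hS := h.circles_subset_sphere
  obtain ⟨w₀, hw₀⟩ : (circle (axis v₁ v₂ b) R).Nonempty := by
    rw [← convexHull_nonempty_iff (𝕜 := ℝ)]
    exact ⟨z, hz⟩
  have hzi := h.inner_eq_of_mem_disc b hz
  have hg := h.gap_pos
  set γ := gap v₁ v₂ R with hγ
  rw [energySet, Metric.mem_closure_iff]
  intro ε hε
  -- a pair whose mean spin has height at least `height R - η γ` has at most a fraction `η` of its
  -- spins on the other circle
  obtain ⟨η, hη, hηε⟩ : ∃ η : ℝ, 0 < η ∧ 6 * (1 + α) * η < ε / 2 := by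
    refine ⟨ε / (24 * (1 + α)), by positivity, ?_⟩
    rw [← mul_div_assoc, div_lt_iff₀ (by positivity)]
    nlinarith
  obtain ⟨⟨z', e'⟩, ⟨m, s, hm, hs, hper, hz', he'⟩, hd⟩ :=
    Metric.mem_closure_iff.1 he (min (ε / 2) (η * γ)) (by positivity)
  simp only at hz' he'
  have hm' : (0 : ℝ) < m := by exact_mod_cast hm
  rw [Prod.dist_eq, max_lt_iff, lt_min_iff, lt_min_iff] at hd
  obtain ⟨⟨hd1, hd2⟩, hd3, -⟩ := hd
  simp only at hd1 hd2 hd3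
  let s' : ℤ → R3 := fun i => if s i ∈ circle (axis v₁ v₂ b) R then s i else w₀
  have hs' : ∀ i, s' i ∈ circle (axis v₁ v₂ b) R := fun i => by
    simp only [s']; split_ifs with hi
    exacts [hi, hw₀]
  have hper' : Function.Periodic s' (m : ℤ) := fun i => by simp only [s', hper i]
  have hs1 : ∀ i, ‖s i‖ ≤ 1 := fun i => norm_le_of_subset_sphere hS (hs i)
  have hs1' : ∀ i, ‖s' i‖ ≤ 1 := fun i =>
    norm_le_of_subset_sphere (h.circle_subset_sphere b) (hs' i)
  have hdiff : ∀ i, ‖s i - s' i‖ * γ ≤ 2 * (height R - ⟪s i, axis v₁ v₂ b⟫_ℝ) := by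
    intro i
    simp only [s']
    split_ifs with hi
    · rw [((h.mem_circle b _).1 hi).2]; simp
    · obtain ⟨b', hb'⟩ := (Admissible.mem_circles_iff _ _ _ _).1 (hs i)
      have hbb : b' = !b := by
        rcases Bool.eq_or_eq_not b' b with rfl | hh
        · exact absurd hb' hi
        · exact hh
      rw [hbb] at hb'
      have h1 := h.inner_le_of_mem_circle_not b hb'
      have h2 : ‖s i - w₀‖ ≤ 2 := (norm_sub_le _ _).trans (by
        linarith [hs1 i, norm_le_of_subset_sphere (h.circle_subset_sphere b) hw₀])
      nlinarith
  have hsum : ∑ i ∈ Finset.Ico (0 : ℤ) m, ‖s i - s' i‖ ≤ 2 * m * η := by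
    have h1 : (∑ i ∈ Finset.Ico (0 : ℤ) m, ‖s i - s' i‖) * γ ≤
        2 * (m * (height R - ⟪z', axis v₁ v₂ b⟫_ℝ)) := by
      rw [Finset.sum_mul]
      refine (Finset.sum_le_sum fun i _ => hdiff i).trans_eq ?_
      rw [← Finset.mul_sum, Finset.sum_sub_distrib, ← sum_inner, ← hz', real_inner_smul_left]
      simp only [Finset.sum_const, Int.card_Ico, sub_zero, Int.toNat_natCast, nsmul_eq_mul]
      ring
    have h2 : height R - ⟪z', axis v₁ v₂ b⟫_ℝ ≤ η * γ := by
      rw [← hzi, ← inner_sub_left]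
      refine (real_inner_le_norm _ _).trans ?_
      rw [h.norm_axis, mul_one, ← dist_eq_norm]
      exact hd2.le
    have h3 : (∑ i ∈ Finset.Ico (0 : ℤ) m, ‖s i - s' i‖) * γ ≤ 2 * m * η * γ := by
      refine h1.trans ?_
      have := mul_le_mul_of_nonneg_left h2 hm'.le
      nlinarith
    exact le_of_mul_le_mul_right h3 hg
  have hshift : ∀ j : ℤ, ∑ i ∈ Finset.Ico (0 : ℤ) m, ‖s (i + j) - s' (i + j)‖ =
      ∑ i ∈ Finset.Ico (0 : ℤ) m, ‖s i - s' i‖ := by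
    intro j
    have hp : Function.Periodic (fun i => ‖s i - s' i‖) (m : ℤ) := fun i => by
      simp only [hper i, hper' i]
    rw [← sum_Ico_period hp j]
    have hmap := Finset.map_add_right_Ico (0 : ℤ) m j
    rw [zero_add, add_comm (m : ℤ)] at hmap
    rw [← hmap, Finset.sum_map]
    rfl
  refine ⟨((m : ℝ)⁻¹ • ∑ i ∈ Finset.Ico (0 : ℤ) m, s' i,
    (m : ℝ)⁻¹ * ∑ i ∈ Finset.Ico (0 : ℤ) m, bond α s' i),
    ⟨m, s', hm, hs', hper', smul_inv_smul₀ hm'.ne' _, mul_inv_cancel_left₀ hm'.ne' _⟩, ?_⟩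
  have hαη : 2 * η ≤ 6 * (1 + α) * η := by nlinarith
  rw [Prod.dist_eq, max_lt_iff]
  constructor
  · refine (dist_triangle _ z' _).trans_lt ?_
    have h1 : ‖z' - (m : ℝ)⁻¹ • ∑ i ∈ Finset.Ico (0 : ℤ) m, s' i‖ ≤ 2 * η := by
      have h2 : z' - (m : ℝ)⁻¹ • ∑ i ∈ Finset.Ico (0 : ℤ) m, s' i =
          (m : ℝ)⁻¹ • ∑ i ∈ Finset.Ico (0 : ℤ) m, (s i - s' i) := by
        rw [Finset.sum_sub_distrib, ← hz', smul_sub, inv_smul_smul₀ hm'.ne']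
      rw [h2, norm_smul, Real.norm_of_nonneg (by positivity), inv_mul_le_iff₀ hm']
      refine (norm_sum_le _ _).trans (hsum.trans_eq (by ring))
    rw [← dist_eq_norm] at h1
    simp only
    linarith
  · refine (dist_triangle _ e' _).trans_lt ?_
    have h1 : |e' - (m : ℝ)⁻¹ * ∑ i ∈ Finset.Ico (0 : ℤ) m, bond α s' i| ≤
        6 * (1 + α) * η := by
      have h2 : e' - (m : ℝ)⁻¹ * ∑ i ∈ Finset.Ico (0 : ℤ) m, bond α s' i =
          (m : ℝ)⁻¹ * ∑ i ∈ Finset.Ico (0 : ℤ) m, (bond α s i - bond α s' i) := by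
        rw [Finset.sum_sub_distrib, ← he', mul_sub, inv_mul_cancel_left₀ hm'.ne']
      rw [h2, abs_mul, abs_of_pos (by positivity), inv_mul_le_iff₀ hm']
      refine (Finset.abs_sum_le_sum_abs _ _).trans
        ((Finset.sum_le_sum fun i _ => abs_bond_sub_le hα hs1 hs1' i).trans ?_)
      rw [← Finset.mul_sum, Finset.sum_add_distrib, Finset.sum_add_distrib, hshift 1, hshift 2]
      have := mul_le_mul_of_nonneg_left hsum (show 0 ≤ 3 * (1 + α) by positivity)
      linarith
    rw [← Real.dist_eq] at h1
    simp only
    linarith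

end SpinChain

namespace SpinChain

/-! ### Distributional derivatives of step functions -/

/-- Smooth functions which increase to the indicator function of `(a, b)` as `n → ∞` and have
compact support in it. -/
noncomputable def plateau (a b : ℝ) (n : ℕ) (x : ℝ) : ℝ :=
  Real.smoothTransition ((n + 1) * (x - a) - 1) * Real.smoothTransition ((n + 1) * (b - x) - 1)

theorem contDiff_plateau (a b : ℝ) (n : ℕ) : ContDiff ℝ ∞ (plateau a b n) :=
  (Real.smoothTransition.contDiff.comp (by fun_prop)).mul
    (Real.smoothTransition.contDiff.comp (by fun_prop))

theorem tsupport_plateau_subset (a b : ℝ) (n : ℕ) :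
    tsupport (plateau a b n) ⊆ Icc (a + 1 / ((n : ℝ) + 1)) (b - 1 / ((n : ℝ) + 1)) := by
  have hn : (0 : ℝ) < (n : ℝ) + 1 := by positivity
  refine closure_minimal (fun x hx => ?_) isClosed_Icc
  rw [Function.mem_support, plateau] at hx
  have h1 := left_ne_zero_of_mul hx
  have h2 := right_ne_zero_of_mul hx
  rw [Ne, Real.smoothTransition.zero_iff_nonpos, not_le] at h1 h2
  have h3 : 1 / ((n : ℝ) + 1) ≤ x - a := by rw [div_le_iff₀ hn]; linarith
  have h4 : 1 / ((n : ℝ) + 1) ≤ b - x := by rw [div_le_iff₀ hn]; linarith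
  constructor <;> linarith

theorem tendsto_plateau (a b x : ℝ) :
    Tendsto (fun n => plateau a b n x) atTop (𝓝 ((Ioo a b).indicator (fun _ => (1 : ℝ)) x)) := by
  have hlim : ∀ c : ℝ, 0 < c → ∀ᶠ n : ℕ in atTop, 1 ≤ ((n : ℝ) + 1) * c - 1 := by
    intro c hc
    obtain ⟨N, hN⟩ := exists_nat_gt (2 / c)
    filter_upwards [eventually_ge_atTop N] with n hn
    have : (N : ℝ) ≤ n := by exact_mod_cast hn
    rw [div_lt_iff₀ hc] at hN
    nlinarith
  by_cases hx : x ∈ Ioo a b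
  · rw [indicator_of_mem hx]
    refine tendsto_const_nhds.congr' ?_
    filter_upwards [hlim (x - a) (by linarith [hx.1]), hlim (b - x) (by linarith [hx.2])]
      with n h1 h2
    rw [plateau, Real.smoothTransition.one_of_one_le h1, Real.smoothTransition.one_of_one_le h2,
      one_mul]
  · rw [indicator_of_notMem hx]
    refine tendsto_const_nhds.congr fun n => ?_
    have hn : (0 : ℝ) < (n : ℝ) + 1 := by positivity
    rw [mem_Ioo, not_and_or, not_lt, not_lt] at hx
    rw [plateau]
    rcases hx with hx | hx
    · rw [Real.smoothTransition.zero_of_nonpos (by nlinarith), zero_mul]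
    · rw [Real.smoothTransition.zero_of_nonpos (x := (n + 1) * (b - x) - 1) (by nlinarith),
        mul_zero]

theorem abs_plateau_le (a b : ℝ) (n : ℕ) (x : ℝ) : |plateau a b n x| ≤ 1 := by
  rw [plateau, abs_of_nonneg
    (mul_nonneg (Real.smoothTransition.nonneg _) (Real.smoothTransition.nonneg _))]
  exact mul_le_one₀ (Real.smoothTransition.le_one _) (Real.smoothTransition.nonneg _)
    (Real.smoothTransition.le_one _)

variable {w : ℝ → R3}

theorem tendsto_integral_plateau {μ : VectorMeasure I R3} (hμ : μ.variation univ < ⊤) (a b : ℝ) :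
    Tendsto (fun n => ∫ᵛ t : I, plateau a b n (t : ℝ) ∂•μ) atTop
      (𝓝 (μ ((↑) ⁻¹' Ioo a b))) := by
  have : IsFiniteMeasure μ.variation := ⟨hμ⟩
  have hmeas : MeasurableSet ((↑) ⁻¹' Ioo a b : Set I) := measurable_subtype_coe measurableSet_Ioo
  have h1 : ∫ᵛ t : I, ((↑) ⁻¹' Ioo a b : Set I).indicator (fun _ => (1 : ℝ)) t ∂•μ =
      μ ((↑) ⁻¹' Ioo a b) := by
    rw [VectorMeasure.integral_indicator_const _ hmeas]
    simp
  rw [← h1]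
  refine VectorMeasure.tendsto_integral_filter_of_norm_le_const (Eventually.of_forall fun n => ?_)
    ⟨1, Eventually.of_forall fun n => Eventually.of_forall fun x => abs_plateau_le a b n x⟩
    (Eventually.of_forall fun x => ?_)
  · exact ((contDiff_plateau a b n).continuous.comp
      continuous_subtype_val).aestronglyMeasurable
  · exact tendsto_plateau a b x

/-- The distributional derivative is unique. -/
theorem IsDistribDeriv.unique {μ ν : VectorMeasure I R3} (hμ : IsDistribDeriv w μ)
    (hν : IsDistribDeriv w ν) : μ = ν := by
  have key : ∀ a b : ℝ, μ ((↑) ⁻¹' Ioo a b) = ν ((↑) ⁻¹' Ioo a b) := by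
    intro a b
    have hset : ((↑) ⁻¹' Ioo a b : Set I) = (↑) ⁻¹' Ioo (max a 0) (min b 1) := by
      ext ⟨x, hx⟩
      simp only [mem_preimage, mem_Ioo, max_lt_iff, lt_min_iff]
      exact ⟨fun h => ⟨⟨h.1, hx.1⟩, h.2, hx.2⟩, fun h => ⟨h.1.1, h.2.1⟩⟩
    rw [hset]
    refine tendsto_nhds_unique (tendsto_integral_plateau hμ.1 _ _)
      ((tendsto_integral_plateau hν.1 _ _).congr fun n => ?_)
    have hn : (0 : ℝ) < 1 / ((n : ℝ) + 1) := by positivity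
    have hsub := tsupport_plateau_subset (max a 0) (min b 1) n
    have hcs : HasCompactSupport (plateau (max a 0) (min b 1) n) :=
      isCompact_Icc.of_isClosed_subset (isClosed_tsupport _) hsub
    have hI : tsupport (plateau (max a 0) (min b 1) n) ⊆ I := hsub.trans fun x hx =>
      ⟨by linarith [hx.1, le_max_right a 0], by linarith [hx.2, min_le_right b 1]⟩
    have h1 := hμ.2 _ (contDiff_plateau _ _ n) hcs hI
    have h2 := hν.2 _ (contDiff_plateau _ _ n) hcs hI
    exact (neg_injective (h1.symm.trans h2)).symm
  refine VectorMeasure.ext_of_generateFrom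
    {s : Set I | ∃ t ∈ ⋃ (a : ℚ) (b : ℚ) (_ : a < b), {Ioo (a : ℝ) (b : ℝ)}, (↑) ⁻¹' t = s}
    ?_ ?_ (Real.isPiSystem_Ioo_rat.comap _) ?_
  · rintro _ ⟨t, ht, rfl⟩
    simp only [mem_iUnion, mem_singleton_iff] at ht
    obtain ⟨a, b, -, rfl⟩ := ht
    exact key a b
  · have h1 : (inferInstance : MeasurableSpace I) = (borel ℝ).comap ((↑) : I → ℝ) := by
      rw [← BorelSpace.measurable_eq (α := ℝ)]; rfl
    rw [Real.borel_eq_generateFrom_Ioo_rat, MeasurableSpace.comap_generateFrom] at h1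
    exact h1
  · have h1 : (univ : Set I) = (↑) ⁻¹' Ioo (0 : ℝ) 1 := by
      ext x; simp
    rw [h1, key]

theorem distribDeriv_eq {μ : VectorMeasure I R3} (hw : IntegrableOn w I)
    (hμ : IsDistribDeriv w μ) : distribDeriv w = μ := by
  have hBV : MemBV w := ⟨hw, μ, hμ⟩
  rw [distribDeriv, dif_pos hBV]
  exact hBV.2.choose_spec.unique hμ

variable {ι : Type*} [Fintype ι] {σ t : ι → ℝ} {c₀ : ℝ} {v e : R3}

/-- The scalar step function with value `c₀` at `-∞` which jumps by `σ j` at `t j`. The positions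
`t j` need be neither ordered nor distinct. -/
noncomputable def stepLabel (c₀ : ℝ) (σ t : ι → ℝ) (x : ℝ) : ℝ :=
  c₀ + ∑ j, if t j ≤ x then σ j else 0

theorem measurable_stepLabel : Measurable (stepLabel c₀ σ t) :=
  (Finset.measurable_sum _ fun _ _ =>
    Measurable.ite measurableSet_Ici measurable_const measurable_const).const_add c₀

theorem abs_stepLabel_le (x : ℝ) : |stepLabel c₀ σ t x| ≤ |c₀| + ∑ j, |σ j| := by
  refine (abs_add_le _ _).trans (add_le_add le_rfl ((Finset.abs_sum_le_sum_abs _ _).trans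
    (Finset.sum_le_sum fun j _ => ?_)))
  split_ifs
  · exact le_rfl
  · simp

open Classical in
/-- The jumps `σ j • e` at those `t j` that lie in `I`, as a vector measure on `I`. -/
noncomputable def jumpMeasure (σ t : ι → ℝ) (e : R3) : VectorMeasure I R3 :=
  ∑ j, if h : t j ∈ I then VectorMeasure.dirac (⟨t j, h⟩ : I) (σ j • e) else 0

open Classical in
theorem variation_jumpMeasure_le :
    (jumpMeasure σ t e).variation univ ≤ ∑ j, ‖σ j • e‖ₑ := by
  refine (VectorMeasure.variation_finsetSum_le _ _ univ).trans ?_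
  rw [Measure.finsetSum_apply]
  refine Finset.sum_le_sum fun j _ => ?_
  split_ifs
  · simp
  · simp

open Classical in
theorem integral_jumpMeasure (φ : I → ℝ) :
    ∫ᵛ x, φ x ∂•(jumpMeasure σ t e) =
      ∑ j, (if h : t j ∈ I then φ ⟨t j, h⟩ else 0) • σ j • e := by
  rw [jumpMeasure, VectorMeasure.integral_finsetSum_vectorMeasure]
  · refine Finset.sum_congr rfl fun j _ => ?_
    split_ifs
    · simp [smul_comm (σ j)]
    · simp
  · intro j _
    split_ifs with h
    · change Integrable _ _
      rw [VectorMeasure.variation_dirac]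
      exact (integrable_dirac enorm_lt_top).smul_measure enorm_ne_top
    · simp

theorem integrableOn_step (hw : w =ᵐ[volI] fun x => v + stepLabel c₀ σ t x • e) :
    IntegrableOn w I := by
  have : IsFiniteMeasure volI := ⟨by simp⟩
  refine Integrable.congr (f := fun x => v + stepLabel c₀ σ t x • e) ?_ hw.symm
  have hm : Measurable fun x => v + stepLabel c₀ σ t x • e :=
    (measurable_stepLabel.smul_const e).const_add v
  refine Integrable.of_bound hm.aestronglyMeasurable (‖v‖ + (|c₀| + ∑ j, |σ j|) * ‖e‖)
    (Eventually.of_forall fun x => (norm_add_le _ _).trans ?_)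
  rw [norm_smul]
  gcongr
  exact abs_stepLabel_le x

theorem setIntegral_deriv_mul_step {φ : ℝ → ℝ} (hφ : ContDiff ℝ ∞ φ) (hc : HasCompactSupport φ)
    (hI : tsupport φ ⊆ I) (y : ℝ) :
    ∫ x in I, (if y ≤ x then deriv φ x else 0) = -φ y := by
  rw [← hc.integral_Ioi_deriv_eq (hφ.of_le (by simp)) y, ← integral_indicator measurableSet_Ioo,
    ← integral_indicator measurableSet_Ioi]
  refine integral_congr_ae ?_
  have hne : ∀ᵐ x : ℝ, x ≠ y := by simp [ae_iff]
  filter_upwards [hne] with x hxy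
  by_cases hx : x ∈ I
  · rw [indicator_of_mem hx]
    by_cases hyx : y ≤ x
    · rw [if_pos hyx, indicator_of_mem (mem_Ioi.2 (lt_of_le_of_ne hyx hxy.symm))]
    · rw [if_neg hyx, indicator_of_notMem (s := Ioi y) (fun h => hyx (le_of_lt h))]
  · have h0 : deriv φ x = 0 := by
      by_contra hne
      exact hx (hI (support_deriv_subset hne))
    rw [indicator_of_notMem hx]
    by_cases hyx : x ∈ Ioi y
    · rw [indicator_of_mem hyx, h0]
    · rw [indicator_of_notMem hyx]

theorem isDistribDeriv_step (hw : w =ᵐ[volI] fun x => v + stepLabel c₀ σ t x • e) :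
    IsDistribDeriv w (jumpMeasure σ t e) := by
  classical
  refine ⟨variation_jumpMeasure_le.trans_lt (by simp), fun φ hφ hc hI => ?_⟩
  have hzero : ∀ y, y ∉ I → φ y = 0 := fun y hy => by
    by_contra hne
    exact hy (hI (subset_tsupport φ hne))
  have hdint : Integrable (deriv φ) volI :=
    ((hφ.continuous_deriv (by simp)).integrable_of_hasCompactSupport hc.deriv).integrableOn
  have hstep : ∀ y, Integrable (fun x => if y ≤ x then deriv φ x else 0) volI := by
    intro y
    refine (hdint.indicator (s := Ici y) measurableSet_Ici).congr (Eventually.of_forall fun x => ?_)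
    simp [indicator_apply]
  have h1 : ∫ x in I, deriv φ x • w x =
      ∫ x in I, (deriv φ x • (v + c₀ • e) +
        ∑ j, (if t j ≤ x then deriv φ x else 0) • σ j • e) := by
    refine integral_congr_ae ?_
    filter_upwards [hw] with x hx
    rw [hx, stepLabel, add_smul, ← add_assoc, smul_add, Finset.sum_smul, Finset.smul_sum]
    congr 1
    refine Finset.sum_congr rfl fun j _ => ?_
    split_ifs <;> simp
  have h0 : ∫ x in I, deriv φ x = 0 := by
    have h2 := setIntegral_deriv_mul_step hφ hc hI 0
    rw [hzero 0 (by simp), neg_zero] at h2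
    rw [← h2]
    exact setIntegral_congr_fun measurableSet_Ioo fun x hx => (if_pos hx.1.le).symm
  rw [h1, integral_add (hdint.smul_const _)
    (integrable_finsetSum _ fun j _ => (hstep (t j)).smul_const _),
    integral_finsetSum _ fun j _ => (hstep (t j)).smul_const _, integral_smul_const, h0,
    zero_smul, zero_add, integral_jumpMeasure, ← Finset.sum_neg_distrib]
  refine Finset.sum_congr rfl fun j _ => ?_
  rw [integral_smul_const, setIntegral_deriv_mul_step hφ hc hI (t j), neg_smul]
  split_ifs with h
  · rfl
  · rw [hzero _ h]

theorem memBV_step (hw : w =ᵐ[volI] fun x => v + stepLabel c₀ σ t x • e) : MemBV w :=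
  ⟨integrableOn_step hw, _, isDistribDeriv_step hw⟩

theorem distribDeriv_step (hw : w =ᵐ[volI] fun x => v + stepLabel c₀ σ t x • e) :
    distribDeriv w = jumpMeasure σ t e :=
  distribDeriv_eq (integrableOn_step hw) (isDistribDeriv_step hw)

theorem totalVar_step_le (hw : w =ᵐ[volI] fun x => v + stepLabel c₀ σ t x • e) :
    totalVar w ≤ ∑ j, ‖σ j • e‖ₑ := by
  rw [totalVar, if_pos (memBV_step hw), distribDeriv_step hw]
  exact variation_jumpMeasure_le

theorem totalVar_step (hw : w =ᵐ[volI] fun x => v + stepLabel c₀ σ t x • e)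
    (ht : ∀ j, t j ∈ I) (hinj : Function.Injective t) : totalVar w = ∑ j, ‖σ j • e‖ₑ := by
  classical
  refine le_antisymm (totalVar_step_le hw) ?_
  rw [totalVar, if_pos (memBV_step hw),
    distribDeriv_step hw]
  let p : ι → Set I := fun j => {⟨t j, ht j⟩}
  have hp : Function.Injective p := fun i j hij => hinj (by
    simpa [p] using hij)
  have h1 := VectorMeasure.le_variation (jumpMeasure σ t e) MeasurableSet.univ
    (P := Finset.univ.image p) (fun _ _ => subset_univ _) (by
      intro a ha b hb hab
      simp only [Finset.coe_image, Finset.coe_univ, image_univ, mem_range] at ha hb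
      obtain ⟨i, rfl⟩ := ha
      obtain ⟨j, rfl⟩ := hb
      simpa [p, Function.onFun, eq_comm] using hab)
  rw [Finset.sum_image fun i _ j _ hij => hp hij] at h1
  refine le_trans (Finset.sum_le_sum fun j _ => ?_) h1
  have h2 : jumpMeasure σ t e (p j) = σ j • e := by
    rw [jumpMeasure, FunLike.coe_sum, Finset.sum_apply,
      Finset.sum_eq_single j]
    · rw [dif_pos (ht j), VectorMeasure.dirac_apply_of_mem (measurableSet_singleton _) rfl]
    · intro i _ hij
      rw [dif_pos (ht i), VectorMeasure.dirac_apply_of_notMem]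
      simpa [p] using fun h => hij (hinj h)
    · simp
  rw [h2]

/-! ### Weak-star convergence of step functions -/

open Classical in
theorem continuous_extend_zero (φ : C₀(I, ℝ)) :
    Continuous fun y : ℝ => if h : y ∈ I then φ ⟨y, h⟩ else 0 := by
  rw [continuous_iff_continuousAt]
  intro y
  by_cases hy : y ∈ I
  · have hemb : IsOpenEmbedding ((↑) : I → ℝ) := isOpen_Ioo.isOpenEmbedding_subtypeVal
    rw [show y = ((⟨y, hy⟩ : I) : ℝ) from rfl, ← hemb.continuousAt_iff]
    convert φ.continuous.continuousAt using 1
    ext x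
    exact dif_pos x.2
  · rw [ContinuousAt, dif_neg hy, Metric.tendsto_nhds]
    intro ε hε
    have h1 : ∀ᶠ x in cocompact I, dist (φ x) 0 < ε :=
      Metric.tendsto_nhds.1 φ.zero_at_infty' ε hε
    obtain ⟨K, hK, hKsub⟩ := mem_cocompact.1 h1
    have h2 : (((↑) : I → ℝ) '' K)ᶜ ∈ 𝓝 y :=
      (hK.image continuous_subtype_val).isClosed.isOpen_compl.mem_nhds (by
        rintro ⟨x, -, rfl⟩
        exact hy x.2)
    filter_upwards [h2] with z hz
    split_ifs with hzI
    · exact hKsub fun hzK => hz ⟨_, hzK, rfl⟩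
    · simpa using hε

theorem eventually_stepLabel_eq {tn : ℕ → ι → ℝ}
    (hlim : ∀ j, Tendsto (fun n => tn n j) atTop (𝓝 (t j))) {x : ℝ} (hx : ∀ j, x ≠ t j) :
    ∀ᶠ n in atTop, stepLabel c₀ σ (tn n) x = stepLabel c₀ σ t x := by
  have hev : ∀ᶠ n in atTop, ∀ j, tn n j ≤ x ↔ t j ≤ x := by
    rw [eventually_all]
    intro j
    rcases lt_or_gt_of_ne (hx j) with h | h
    · filter_upwards [(hlim j).eventually_const_lt h] with n hn
      exact iff_of_false (not_le.2 hn) (not_le.2 h)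
    · filter_upwards [(hlim j).eventually_lt_const h] with n hn
      exact iff_of_true hn.le h.le
  filter_upwards [hev] with n hn
  simp only [stepLabel, hn]

/-- Step functions with convergent jump positions converge weakly-star in `BV`, even if jumps merge
or escape through the end points of `I`. -/
theorem bvWeakStar_step {wn : ℕ → ℝ → R3} {tn : ℕ → ι → ℝ}
    (hwn : ∀ n, wn n =ᵐ[volI] fun x => v + stepLabel c₀ σ (tn n) x • e)
    (hw : w =ᵐ[volI] fun x => v + stepLabel c₀ σ t x • e)
    (hlim : ∀ j, Tendsto (fun n => tn n j) atTop (𝓝 (t j))) : BVWeakStar wn w := by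
  classical
  refine ⟨fun n => memBV_step (hwn n), memBV_step hw, ?_, fun φ => ?_⟩
  · have h1 : ∀ n, ∫⁻ x in I, ‖wn n x - w x‖ₑ =
        ∫⁻ x in I, ‖(stepLabel c₀ σ (tn n) x - stepLabel c₀ σ t x) • e‖ₑ := by
      intro n
      refine lintegral_congr_ae ?_
      filter_upwards [hwn n, hw] with x h2 h3
      rw [h2, h3, sub_smul, add_sub_add_left_eq_sub]
    simp_rw [h1]
    have h0 : ∫⁻ _ in I, (0 : ℝ≥0∞) = 0 := lintegral_zero
    rw [← h0]
    refine tendsto_lintegral_of_dominated_convergence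
      (fun _ => ENNReal.ofReal (2 * (|c₀| + ∑ j, |σ j|) * ‖e‖)) (fun n => ?_) (fun n => ?_) ?_ ?_
    · exact ((measurable_stepLabel.sub measurable_stepLabel).smul_const e).enorm
    · refine Eventually.of_forall fun x => ?_
      simp only
      rw [← ofReal_norm, norm_smul]
      refine ENNReal.ofReal_le_ofReal ?_
      gcongr
      rw [Real.norm_eq_abs, two_mul]
      exact (abs_sub _ _).trans (add_le_add (abs_stepLabel_le x) (abs_stepLabel_le x))
    · simp
    · have hne : ∀ᵐ x ∂volI, ∀ j, x ≠ t j := by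
        rw [ae_all_iff]
        intro j
        exact ae_restrict_of_ae (by simp [ae_iff])
      filter_upwards [hne] with x hx
      refine tendsto_const_nhds.congr' ?_
      filter_upwards [eventually_stepLabel_eq (c₀ := c₀) (σ := σ) hlim hx] with n hn
      rw [hn, sub_self, zero_smul, enorm_zero]
  · rw [distribDeriv_step hw]
    simp_rw [distribDeriv_step (hwn _), integral_jumpMeasure]
    refine tendsto_finsetSum _ fun j _ => Tendsto.smul_const ?_ _
    exact ((continuous_extend_zero φ).tendsto (t j)).comp (hlim j)

/-- A continuous function on `ℝ` vanishing at the end points of `I` restricts to an element of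
`C₀(I)`. -/
noncomputable def restrictC₀ (f : ℝ → ℝ) (hf : Continuous f) (h0 : f 0 = 0) (h1 : f 1 = 0) :
    C₀(I, ℝ) where
  toFun x := f x
  continuous_toFun := hf.comp continuous_subtype_val
  zero_at_infty' := by
    rw [Metric.tendsto_nhds]
    intro ε hε
    refine mem_cocompact.2 ?_
    have hcpt : IsCompact (Icc (0 : ℝ) 1 ∩ {x | ε ≤ |f x|}) :=
      isCompact_Icc.inter_right (isClosed_le continuous_const hf.abs)
    have hsub : Icc (0 : ℝ) 1 ∩ {x | ε ≤ |f x|} ⊆ range ((↑) : I → ℝ) := by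
      rintro x ⟨hx, hxε⟩
      rw [Subtype.range_coe]
      refine ⟨lt_of_le_of_ne hx.1 ?_, lt_of_le_of_ne hx.2 ?_⟩
      · rintro rfl
        simp only [mem_ofPred_eq, h0, abs_zero] at hxε
        linarith
      · rintro rfl
        simp only [mem_ofPred_eq, h1, abs_zero] at hxε
        linarith
    refine ⟨_, (IsEmbedding.subtypeVal.isInducing.isCompact_preimage_iff hsub).2 hcpt, ?_⟩
    intro x hx
    by_contra hcon
    simp only [mem_ofPred_eq, Real.dist_eq, sub_zero, not_lt] at hcon
    exact hx ⟨Ioo_subset_Icc_self x.2, hcon⟩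

/-- Lower semicontinuity of the total variation at a step function. -/
theorem BVWeakStar.eventually_lt_totalVar {wn : ℕ → ℝ → R3} (hconv : BVWeakStar wn w)
    (hw : w =ᵐ[volI] fun x => v + stepLabel c₀ σ t x • e) (ht : ∀ j, t j ∈ I)
    (hinj : Function.Injective t) {c : ℝ≥0∞} (hc : c < totalVar w) :
    ∀ᶠ n in atTop, c < totalVar (wn n) := by
  classical
  -- a test function with values in `[-1, 1]` that equals the sign of the jump at each jump point
  obtain ⟨f, hf, hf1, hf0, hfI, hft⟩ : ∃ f : ℝ → ℝ, Continuous f ∧ (∀ x, |f x| ≤ 1) ∧ f 0 = 0 ∧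
      f 1 = 0 ∧ ∀ j, f (t j) = SignType.sign (σ j) := by
    let r : ℝ → ℝ := fun x => ∑ j, if t j = x then (SignType.sign (σ j) : ℝ) else 0
    let T : Finset ℝ := insert 0 (insert 1 (Finset.univ.image t))
    let p := Lagrange.interpolate T id r
    have hp : ∀ x ∈ T, p.eval x = r x := fun x hx =>
      Lagrange.eval_interpolate_at_node r (injOn_id _) hx
    have hr : ∀ j, r (t j) = SignType.sign (σ j) := by
      intro j
      simp only [r]
      rw [Finset.sum_eq_single j]
      · simp
      · intro i _ hij
        rw [if_neg fun h => hij (hinj h)]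
      · simp
    have hr' : ∀ x, x ∉ I → r x = 0 := fun x hx =>
      Finset.sum_eq_zero fun j _ => if_neg fun h => hx (by rw [← h]; exact ht j)
    refine ⟨fun x => max (-1) (min 1 (p.eval x)), by fun_prop, fun x => ?_, ?_, ?_, fun j => ?_⟩
    · rw [abs_le]
      exact ⟨le_max_left _ _, max_le (by norm_num) (min_le_left _ _)⟩
    · simp only
      rw [hp 0 (by simp [T]), hr' 0 (by simp)]
      simp
    · simp only
      rw [hp 1 (by simp [T]), hr' 1 (by simp)]
      simp
    · simp only
      rw [hp (t j) (by simp [T]), hr j]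
      rcases lt_trichotomy (σ j) 0 with h | h | h
      · simp [sign_neg h]
      · simp [h]
      · simp [sign_pos h]
  let φ := restrictC₀ f hf hf0 hfI
  have hI : ‖∫ᵛ x, φ x ∂•(distribDeriv w)‖ₑ = totalVar w := by
    rw [totalVar_step hw ht hinj, distribDeriv_step hw,
      integral_jumpMeasure]
    have h1 : ∀ j, (if h : t j ∈ I then φ ⟨t j, h⟩ else 0) • σ j • e = |σ j| • e := by
      intro j
      rw [dif_pos (ht j)]
      change f (t j) • _ = _
      rw [hft, smul_smul, sign_mul_self]
    simp_rw [h1]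
    rw [← Finset.sum_smul, enorm_smul]
    simp_rw [enorm_smul]
    rw [← Finset.sum_mul]
    congr 1
    rw [Real.enorm_of_nonneg (Finset.sum_nonneg fun j _ => abs_nonneg _),
      ENNReal.ofReal_sum_of_nonneg fun j _ => abs_nonneg _]
    exact Finset.sum_congr rfl fun j _ => (Real.enorm_eq_ofReal_abs _).symm
  have hlim := (hconv.2.2.2 φ).enorm
  rw [hI] at hlim
  filter_upwards [hlim.eventually_const_lt hc] with n hn
  refine hn.trans_le ?_
  rw [totalVar, if_pos (hconv.1 n)]
  refine (VectorMeasure.enorm_integral_le_of_enorm_le_const (C := 1)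
    (Eventually.of_forall fun x => ?_)).trans ?_
  · rw [Real.enorm_eq_ofReal_abs]
    exact ENNReal.ofReal_le_one.2 (hf1 x)
  · rw [one_mul]
    refine mul_le_of_le_one_left' ?_
    rw [← ofReal_norm]
    exact ENNReal.ofReal_le_one.2 ContinuousLinearMap.opNorm_lsmul_le

end SpinChain

namespace SpinChain

/-! ### Weak-star convergence in `L^∞` -/

theorem integrable_of_linf (u : Linf) : Integrable u volI :=
  (Lp.memLp u).integrable le_top

theorem integrableOn_of_linf (u : Linf) {A : Set ℝ} (hA : A ⊆ I) : IntegrableOn u A := by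
  have h : IntegrableOn u I := integrable_of_linf u
  exact h.mono_set hA

theorem tendsto_of_forall_inner {ι : Type*} {l : Filter ι} {x : ι → R3} {y : R3}
    (h : ∀ e : R3, Tendsto (fun n => ⟪e, x n⟫_ℝ) l (𝓝 ⟪e, y⟫_ℝ)) : Tendsto x l (𝓝 y) := by
  let b := EuclideanSpace.basisFun (Fin 3) ℝ
  rw [← b.sum_repr' y]
  refine Tendsto.congr (fun n => b.sum_repr' (x n)) ?_
  exact tendsto_finsetSum _ fun i _ => (h (b i)).smul_const _

theorem WeakStar.tendsto_setIntegral {u : ℕ → Linf} {u' : Linf} (h : WeakStar u u') {A : Set ℝ}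
    (hA : MeasurableSet A) (hAI : A ⊆ I) :
    Tendsto (fun n => ∫ t in A, u n t) atTop (𝓝 (∫ t in A, u' t)) := by
  refine tendsto_of_forall_inner fun e => ?_
  have hg : IntegrableOn (A.indicator fun _ : ℝ => e) I :=
    (integrable_const e).indicator hA
  have key : ∀ w : Linf, ∫ t in I, ⟪A.indicator (fun _ : ℝ => e) t, w t⟫_ℝ =
      ⟪e, ∫ t in A, w t⟫_ℝ := by
    intro w
    rw [← integral_inner (integrableOn_of_linf w hAI)]
    have h1 : (fun t => ⟪A.indicator (fun _ : ℝ => e) t, w t⟫_ℝ) =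
        A.indicator fun t => ⟪e, w t⟫_ℝ := by
      ext t
      by_cases ht : t ∈ A <;> simp [ht]
    rw [h1, setIntegral_indicator hA, inter_eq_right.2 hAI]
  have h2 := h _ hg
  simp_rw [key] at h2
  exact h2

theorem WeakStar.unique {u : ℕ → Linf} {a b : Linf} (ha : WeakStar u a) (hb : WeakStar u b) :
    a = b := by
  refine Lp.ext ((integrable_of_linf a).ae_eq_of_forall_setIntegral_eq _ _
    (integrable_of_linf b) fun s hs _ => ?_)
  rw [Measure.restrict_restrict hs]
  exact tendsto_nhds_unique (ha.tendsto_setIntegral (hs.inter measurableSet_Ioo) inter_subset_right)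
    (hb.tendsto_setIntegral (hs.inter measurableSet_Ioo) inter_subset_right)

theorem WeakStar.comp {u : ℕ → Linf} {a : Linf} (ha : WeakStar u a) {φ : ℕ → ℕ}
    (hφ : Tendsto φ atTop atTop) : WeakStar (fun n => u (φ n)) a :=
  fun g hg => (ha g hg).comp hφ

/-- If the averages of `fn n` over intervals converge to those of `f`, then `f` inherits the
constraint of taking values in a closed convex set. -/
theorem ae_mem_of_tendsto_setIntegral {K : Set R3} (hKc : Convex ℝ K) (hK : IsClosed K)
    {f : ℝ → R3} {fn : ℕ → ℝ → R3} {a b : ℝ} (hf : IntegrableOn f (Ioo a b))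
    (hfn : ∀ n, IntegrableOn (fn n) (Ioo a b))
    (hmem : ∃ᶠ n in atTop, ∀ᵐ x ∂volume.restrict (Ioo a b), fn n x ∈ K)
    (hlim : ∀ c d, a ≤ c → c < d → d ≤ b →
      Tendsto (fun n => ∫ x in Ioo c d, fn n x) atTop (𝓝 (∫ x in Ioo c d, f x))) :
    ∀ᵐ x ∂volume.restrict (Ioo a b), f x ∈ K := by
  have hint : Integrable ((Ioo a b).indicator f) :=
      (integrable_indicator_iff measurableSet_Ioo).2 hf
  have hδ : Tendsto (fun n : ℕ => 1 / ((n : ℝ) + 1)) atTop (𝓝[>] 0) :=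
    tendsto_nhdsWithin_iff.2 ⟨tendsto_one_div_add_atTop_nhds_zero_nat,
      Eventually.of_forall fun n => by simp only [mem_Ioi]; positivity⟩
  rw [ae_restrict_iff' measurableSet_Ioo]
  filter_upwards [IsUnifLocDoublingMeasure.ae_tendsto_average volume hint.locallyIntegrable 1]
    with x hx hxab
  have h1 := hx (fun _ => x) _ hδ (Eventually.of_forall fun n => by
    simp only [one_mul]
    exact Metric.mem_closedBall_self (by positivity))
  rw [indicator_of_mem hxab] at h1
  refine hK.mem_of_tendsto h1 ?_
  have hball : ∀ᶠ n : ℕ in atTop, Metric.closedBall x (1 / ((n : ℝ) + 1)) ⊆ Ioo a b := by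
    obtain ⟨ε, hε, hεsub⟩ := Metric.nhds_basis_closedBall.mem_iff.1 (isOpen_Ioo.mem_nhds hxab)
    filter_upwards [(tendsto_nhdsWithin_iff.1 hδ).1.eventually_lt_const hε] with n hn
    exact (Metric.closedBall_subset_closedBall hn.le).trans hεsub
  filter_upwards [hball] with n hn
  set δ := 1 / ((n : ℝ) + 1) with hδn
  have hδpos : 0 < δ := by positivity
  rw [Real.closedBall_eq_Icc] at hn ⊢
  have ha : a ≤ x - δ := (hn ⟨le_rfl, by linarith⟩).1.le
  have hb : x + δ ≤ b := (hn ⟨by linarith, le_rfl⟩).2.le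
  have h2 : ⨍ y in Icc (x - δ) (x + δ), (Ioo a b).indicator f y =
        ⨍ y in Ioo (x - δ) (x + δ), f y := by
    rw [setAverage_congr Ioo_ae_eq_Icc.symm]
    exact setAverage_congr_fun measurableSet_Ioo (Eventually.of_forall fun y hy =>
      indicator_of_mem (s := Ioo a b) ⟨ha.trans_lt hy.1, hy.2.trans_le hb⟩ f)
  rw [h2]
  have h3 : Tendsto (fun m => ⨍ y in Ioo (x - δ) (x + δ), fn m y) atTop
      (𝓝 (⨍ y in Ioo (x - δ) (x + δ), f y)) := by
    simp_rw [setAverage_eq]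
    exact (hlim _ _ ha (by linarith) hb).const_smul _
  have hsub : Ioo (x - δ) (x + δ) ⊆ Ioo a b := Ioo_subset_Ioo ha hb
  refine hK.mem_of_frequently_of_tendsto (hmem.mono fun m hm => ?_) h3
  refine hKc.set_average_mem hK ?_ (by simp) (ae_restrict_of_ae_restrict_of_subset hsub hm)
    ((hfn m).mono_set hsub)
  rw [Real.volume_Ioo]
  simp only [ne_eq, ENNReal.ofReal_eq_zero, not_le]
  linarith

theorem WeakStar.ae_mem {u : ℕ → Linf} {u' : Linf} (h : WeakStar u u') {K : Set R3}
    (hKc : Convex ℝ K) (hK : IsClosed K) {a b : ℝ} (hab : Ioo a b ⊆ I)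
    (hmem : ∃ᶠ n in atTop, ∀ᵐ x ∂volume.restrict (Ioo a b), u n x ∈ K) :
    ∀ᵐ x ∂volume.restrict (Ioo a b), u' x ∈ K :=
  ae_mem_of_tendsto_setIntegral hKc hK (integrableOn_of_linf u' hab)
    (fun n => integrableOn_of_linf (u n) hab) hmem fun _ _ hc _ hd =>
      h.tendsto_setIntegral measurableSet_Ioo ((Ioo_subset_Ioo hc hd).trans hab)

theorem integrable_inner_linf {g : ℝ → R3} (hg : Integrable g volI) (u : Linf) :
    Integrable (fun t => ⟪g t, u t⟫_ℝ) volI := by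
  obtain ⟨C, hC⟩ : ∃ C, ∀ᵐ t ∂volI, ‖u t‖ ≤ C :=
    ⟨(eLpNormEssSup u volI).toReal, by
      filter_upwards [ae_le_eLpNormEssSup (f := u) (μ := volI)] with t ht
      have htop : eLpNormEssSup u volI ≠ ⊤ := by
        rw [← eLpNorm_exponent_top]
        exact (Lp.memLp u).2.ne
      simpa using ENNReal.toReal_mono htop ht⟩
  refine (hg.norm.mul_const C).mono (hg.aestronglyMeasurable.inner (Lp.aestronglyMeasurable u)) ?_
  filter_upwards [hC] with t ht
  refine (norm_inner_le_norm _ _).trans ?_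
  rw [norm_mul, norm_norm]
  gcongr
  exact ht.trans (le_abs_self _)

/-- Along sequences bounded by `1`, weak-star convergence may be tested on continuous functions
with compact support. -/
theorem weakStar_of_continuous {u : ℕ → Linf} {u' : Linf} (hu : ∀ n, ∀ᵐ t ∂volI, ‖u n t‖ ≤ 1)
    (hu' : ∀ᵐ t ∂volI, ‖u' t‖ ≤ 1)
    (h : ∀ g : ℝ → R3, Continuous g → HasCompactSupport g →
      Tendsto (fun n => ∫ t in I, ⟪g t, u n t⟫_ℝ) atTop (𝓝 (∫ t in I, ⟪g t, u' t⟫_ℝ))) :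
    WeakStar u u' := by
  intro g hg
  have hg : Integrable g volI := hg
  rw [Metric.tendsto_nhds]
  intro ε hε
  obtain ⟨f, hfc, hfg, hf, hfi⟩ :=
    hg.exists_hasCompactSupport_integral_sub_le (show 0 < ε / 3 by positivity)
  have key : ∀ w : Linf, (∀ᵐ t ∂volI, ‖w t‖ ≤ 1) →
      |(∫ t in I, ⟪g t, w t⟫_ℝ) - ∫ t in I, ⟪f t, w t⟫_ℝ| ≤ ε / 3 := by
    intro w hw
    rw [← integral_sub (integrable_inner_linf hg w) (integrable_inner_linf hfi w)]
    refine (abs_integral_le_integral_abs.trans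
      (integral_mono_ae ?_ (hg.sub hfi).norm ?_)).trans hfg
    · exact ((integrable_inner_linf hg w).sub (integrable_inner_linf hfi w)).abs
    · filter_upwards [hw] with t ht
      rw [← inner_sub_left]
      exact (abs_real_inner_le_norm _ _).trans (mul_le_of_le_one_right (norm_nonneg _) ht)
  filter_upwards [Metric.tendsto_nhds.1 (h f hf hfc) (ε / 3) (by positivity)] with n hn
  rw [Real.dist_eq] at hn ⊢
  have h1 := abs_le.1 (key (u n) (hu n))
  have h2 := abs_le.1 (key u' hu')
  have h3 := abs_lt.1 hn
  rw [abs_lt]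
  constructor <;> linarith

/-- Sequential weak-star compactness: a sequence in `L^∞` with values in a compact convex subset
of the unit ball has a weak-star convergent subsequence. The limit is found by weak compactness in
the separable Hilbert space `L²`. -/
theorem exists_subseq_weakStar {K : Set R3} (hKc : Convex ℝ K) (hK : IsClosed K)
    (hK1 : ∀ x ∈ K, ‖x‖ ≤ 1) (u : ℕ → Linf) (hu : ∀ n, ValuedIn (u n) K) :
    ∃ φ : ℕ → ℕ, StrictMono φ ∧ ∃ u' : Linf, ValuedIn u' K ∧ WeakStar (fun n => u (φ n)) u' := by
  have hu1 : ∀ n, ∀ᵐ t ∂volI, ‖u n t‖ ≤ 1 := fun n => (hu n).mono fun t ht => hK1 _ ht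
  have hmem : ∀ n, MemLp (u n) 2 volI := fun n => (Lp.memLp (u n)).mono_exponent le_top
  let v : ℕ → Lp R3 2 volI := fun n => (hmem n).toLp
  have hv : ∀ n, v n =ᵐ[volI] u n := fun n => (hmem n).coeFn_toLp
  let L : ℕ → WeakDual ℝ (Lp R3 2 volI) := fun n =>
    StrongDual.toWeakDual (InnerProductSpace.toDual ℝ (Lp R3 2 volI) (v n))
  obtain ⟨C, hC⟩ : ∃ C, ∀ n, ‖v n‖ ≤ C := ⟨_, fun n => Lp.norm_le_of_ae_bound zero_le_one (by
    filter_upwards [hv n, hu1 n] with t h1 h2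
    rwa [h1])⟩
  have : Fact ((2 : ℝ≥0∞) ≠ ⊤) := ⟨ENNReal.ofNat_ne_top⟩
  obtain ⟨L', -, φ, hφ, hlim⟩ := WeakDual.isSeqCompact_closedBall ℝ (Lp R3 2 volI) 0 C
    (x := L) (fun n => by
      simp only [mem_preimage, mem_closedBall_iff_norm, sub_zero]
      change ‖InnerProductSpace.toDual ℝ (Lp R3 2 volI) (v n)‖ ≤ C
      rw [LinearIsometryEquiv.norm_map]
      exact hC n)
  let U : Lp R3 2 volI :=
      (InnerProductSpace.toDual ℝ (Lp R3 2 volI)).symm (WeakDual.toStrongDual L')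
  have hinner : ∀ g : Lp R3 2 volI,
      Tendsto (fun n => ∫ t in I, ⟪g t, u (φ n) t⟫_ℝ) atTop (𝓝 (∫ t in I, ⟪g t, U t⟫_ℝ)) := by
    intro g
    have h1 : Tendsto (fun n => L (φ n) g) atTop (𝓝 (L' g)) :=
      (WeakDual.eval_continuous g).tendsto L' |>.comp hlim
    have h2 : L' g = ∫ t in I, ⟪g t, U t⟫_ℝ := by
      have h3 : ⟪U, g⟫_ℝ = L' g := InnerProductSpace.toDual_symm_apply
      rw [← h3, real_inner_comm, L2.inner_def]
    rw [← h2]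
    refine h1.congr fun n => ?_
    have h3 : L (φ n) g = ⟪v (φ n), g⟫_ℝ := InnerProductSpace.toDual_apply_apply
    rw [h3, real_inner_comm, L2.inner_def]
    refine integral_congr_ae ?_
    filter_upwards [hv (φ n)] with t ht
    rw [ht]
  have hinner' : ∀ g : ℝ → R3, MemLp g 2 volI →
      Tendsto (fun n => ∫ t in I, ⟪g t, u (φ n) t⟫_ℝ) atTop (𝓝 (∫ t in I, ⟪g t, U t⟫_ℝ)) := by
    intro g hg
    let G : Lp R3 2 volI := hg.toLp g
    have hG : G =ᵐ[volI] g := hg.coeFn_toLp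
    have h1 := hinner G
    have h2 : ∀ w : ℝ → R3, ∫ t in I, ⟪G t, w t⟫_ℝ = ∫ t in I, ⟪g t, w t⟫_ℝ := fun w =>
      integral_congr_ae (by filter_upwards [hG] with t ht; rw [ht])
    simpa only [h2] using h1
  have hUint : Integrable U volI := (Lp.memLp U).integrable one_le_two
  have hUK : ∀ᵐ t ∂volI, U t ∈ K := by
    refine ae_mem_of_tendsto_setIntegral hKc hK (fn := fun n => u (φ n)) hUint
      (fun n => integrable_of_linf _) (Eventually.of_forall fun n => hu (φ n)).frequently ?_
    intro c d hc hcd hd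
    have hsub : Ioo c d ⊆ I := Ioo_subset_Ioo hc hd
    refine tendsto_of_forall_inner fun e => ?_
    have key : ∀ w : ℝ → R3, Integrable w volI →
        ∫ t in I, ⟪(Ioo c d).indicator (fun _ : ℝ => e) t, w t⟫_ℝ = ⟪e, ∫ t in Ioo c d, w t⟫_ℝ := by
      intro w hw
      have hw' : IntegrableOn w I := hw
      rw [← integral_inner (hw'.mono_set hsub)]
      have h1 : (fun t => ⟪(Ioo c d).indicator (fun _ : ℝ => e) t, w t⟫_ℝ) =
          (Ioo c d).indicator fun t => ⟪e, w t⟫_ℝ := by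
        ext t
        by_cases ht : t ∈ Ioo c d <;> simp only [indicator_of_mem, indicator_of_notMem, ht,
          not_false_eq_true, inner_zero_left]
      rw [h1, setIntegral_indicator measurableSet_Ioo, inter_eq_right.2 hsub]
    have h2 := hinner' ((Ioo c d).indicator fun _ => e)
      ((memLp_const e).indicator measurableSet_Ioo)
    rw [key _ hUint] at h2
    exact h2.congr fun n => key _ (integrable_of_linf _)
  have hU1 : ∀ᵐ t ∂volI, ‖U t‖ ≤ 1 := hUK.mono fun t ht => hK1 _ ht
  have hUmem : MemLp U ∞ volI := memLp_top_of_bound (Lp.aestronglyMeasurable U) 1 hU1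
  let u' : Linf := hUmem.toLp U
  have hU' : u' =ᵐ[volI] U := hUmem.coeFn_toLp
  refine ⟨φ, hφ, u', ?_, weakStar_of_continuous (fun n => hu1 _) ?_ ?_⟩
  · filter_upwards [hU', hUK] with t h1 h2
    rwa [h1]
  · filter_upwards [hU', hU1] with t h1 h2
    rwa [h1]
  · intro g hg hgc
    have h1 : ∫ t in I, ⟪g t, u' t⟫_ℝ = ∫ t in I, ⟪g t, U t⟫_ℝ :=
      integral_congr_ae (by filter_upwards [hU'] with t ht; rw [ht])
    rw [h1]
    exact hinner' g (hg.memLp_of_hasCompactSupport hgc)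

end SpinChain

namespace SpinChain

/-! ### Chains as functions on `I` -/

variable {α : ℝ} {v₁ v₂ : R3} {R : ℝ} {E : Type*} [NormedAddCommGroup E]

/-- The piecewise constant function with value `c i` on the cell `l (i + [0,1))`. -/
noncomputable def gridFun (l : ℝ) (c : ℤ → E) (t : ℝ) : E := c ⌊t / l⌋

theorem measurable_comp_floor {X : Type*} [MeasurableSpace X] (l : ℝ) (c : ℤ → X) :
    Measurable fun t : ℝ => c ⌊t / l⌋ :=
  (measurable_of_countable c).comp (Int.measurable_floor.comp (measurable_id.div_const l))

theorem stronglyMeasurable_gridFun (l : ℝ) (c : ℤ → E) : StronglyMeasurable (gridFun l c) := by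
  have h : Measurable fun t : ℝ => ⌊t / l⌋ := measurable_comp_floor l id
  exact (StronglyMeasurable.of_discrete (f := c)).comp_measurable h

theorem intervalIntegrable_gridFun (l : ℝ) {c : ℤ → E} {C : ℝ} (hc : ∀ i, ‖c i‖ ≤ C) (a b : ℝ) :
    IntervalIntegrable (gridFun l c) volume a b :=
  (intervalIntegrable_const (c := C)).mono_fun
    (stronglyMeasurable_gridFun l c).aestronglyMeasurable
    (Eventually.of_forall fun _ => (hc _).trans (le_abs_self C))

theorem integral_gridFun [NormedSpace ℝ E] [CompleteSpace E] {l : ℝ} (hl : 0 < l)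
    {c : ℤ → E} {C : ℝ} (hc : ∀ i, ‖c i‖ ≤ C)
    {m n : ℤ} (hmn : m ≤ n) :
    ∫ t in (l * m)..(l * n), gridFun l c t = l • ∑ i ∈ Finset.Ico m n, c i := by
  obtain ⟨k, rfl⟩ : ∃ k : ℕ, n = m + k := ⟨(n - m).toNat, by omega⟩
  clear hmn
  induction k with
  | zero => simp
  | succ k ih =>
    have hcell : ∫ t in (l * (m + k : ℤ))..(l * (m + (k + 1 : ℕ) : ℤ)), gridFun l c t =
        l • c (m + k) := by
      have h1 : ∫ t in (l * (m + k : ℤ))..(l * (m + (k + 1 : ℕ) : ℤ)), gridFun l c t =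
          ∫ _ in (l * (m + k : ℤ))..(l * (m + (k + 1 : ℕ) : ℤ)), c (m + k) := by
        refine intervalIntegral.integral_congr_ae ?_
        have hne : ∀ᵐ x : ℝ, x ≠ l * (m + (k + 1 : ℕ) : ℤ) := by simp [ae_iff]
        filter_upwards [hne] with x hx hxm
        have hle : l * ((m + k : ℤ) : ℝ) ≤ l * ((m + (k + 1 : ℕ) : ℤ) : ℝ) := by
          gcongr; omega
        rw [uIoc_of_le hle] at hxm
        have hlt := lt_of_le_of_ne hxm.2 hx
        rw [gridFun]
        congr 1
        rw [Int.floor_eq_iff, le_div_iff₀ hl, div_lt_iff₀ hl]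
        push_cast at hlt hxm ⊢
        constructor <;> nlinarith [hxm.1]
      rw [h1, intervalIntegral.integral_const]
      congr 1
      push_cast; ring
    rw [← intervalIntegral.integral_add_adjacent_intervals
      (intervalIntegrable_gridFun l hc _ (l * (m + k : ℤ))) (intervalIntegrable_gridFun l hc _ _),
      ih, hcell, ← smul_add]
    have hsum := sum_Ico_consecutive_int c (a := m) (b := m + k) (c := m + (k + 1 : ℕ)) (by omega)
      (by omega)
    rw [← hsum]
    congr 2
    have : Finset.Ico (m + k) (m + (k + 1 : ℕ) : ℤ) = {m + (k : ℤ)} := by ext; simp; omega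
    rw [this, Finset.sum_singleton]

theorem abs_mul_ceil_sub_le {l : ℝ} (hl : 0 < l) (a : ℝ) : |l * ⌈a / l⌉ - a| ≤ l := by
  have h1 := Int.le_ceil (a / l)
  have h2 := Int.ceil_lt_add_one (a / l)
  rw [div_le_iff₀ hl] at h1
  have h3 : l * (⌈a / l⌉ : ℝ) < l * (a / l + 1) := by gcongr
  rw [mul_add, mul_div_cancel₀ _ hl.ne'] at h3
  rw [abs_le]
  constructor <;> linarith

/-- The integral of a piecewise constant function over an interval is, up to an error of the order
of the spacing, a sum over the lattice points of the interval. -/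
theorem norm_setIntegral_gridFun_sub_le [NormedSpace ℝ E] [CompleteSpace E] {l : ℝ} (hl : 0 < l)
    {c : ℤ → E} {C : ℝ}
    (hc : ∀ i, ‖c i‖ ≤ C) {a b : ℝ} (hab : a ≤ b) :
    ‖(∫ t in Ioo a b, gridFun l c t) - l • ∑ i ∈ Finset.Ico ⌈a / l⌉ ⌈b / l⌉, c i‖ ≤ 2 * C * l := by
  have hi := intervalIntegrable_gridFun l hc
  have hC : 0 ≤ C := (norm_nonneg _).trans (hc 0)
  have hmn : ⌈a / l⌉ ≤ ⌈b / l⌉ := Int.ceil_mono (by gcongr)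
  have hcell : ∀ y : ℝ, ‖∫ t in y..(l * ⌈y / l⌉), gridFun l c t‖ ≤ C * l := by
    intro y
    refine (intervalIntegral.norm_integral_le_of_norm_le_const fun t _ => hc _).trans ?_
    gcongr
    exact abs_mul_ceil_sub_le hl y
  rw [← integral_gridFun hl hc hmn, ← integral_Ioc_eq_integral_Ioo,
    ← intervalIntegral.integral_of_le hab]
  have h1 := intervalIntegral.integral_add_adjacent_intervals (hi a (l * ⌈a / l⌉)) (hi _ b)
  have h2 := intervalIntegral.integral_add_adjacent_intervals (hi (l * ⌈a / l⌉) b)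
    (hi b (l * ⌈b / l⌉))
  have h3 : ∀ x y z : E, x + y - (y + z) = x - z := fun _ _ _ => by abel
  rw [← h1, ← h2, h3]
  refine (norm_sub_le _ _).trans ?_
  linarith [hcell a, hcell b]

theorem bulkLattice_eq {l : ℝ} : bulkLattice l = Finset.Ico 0 (⌊1 / l⌋ - 1) := by
  ext i
  simp only [bulkLattice, lattice, Finset.mem_sdiff, Finset.mem_Icc, Finset.mem_insert,
    Finset.mem_singleton, Finset.mem_Ico]
  omega

theorem floor_mem_lattice {l : ℝ} (hl : 0 < l) {t : ℝ} (ht : t ∈ I) : ⌊t / l⌋ ∈ lattice l := by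
  rw [lattice, Finset.mem_Icc]
  refine ⟨Int.floor_nonneg.2 (div_nonneg ht.1.le hl.le), Int.floor_mono ?_⟩
  gcongr
  exact ht.2.le

/-- The values of a chain off the lattice can be chosen in `S₁ ∪ S₂` as well. -/
theorem Represents.exists_total {l : ℝ} (hl : 0 < l) {s : ℤ → R3} {u : Linf}
    (h : Represents v₁ v₂ R l s u) : ∃ s' : ℤ → R3, (∀ i, s' i ∈ circles v₁ v₂ R) ∧
      bulkEnergy α l s' = bulkEnergy α l s ∧ u =ᵐ[volI] gridFun l s' := by
  classical
  have h0 : (0 : ℤ) ∈ lattice l := by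
    rw [mem_lattice hl]; simp
  refine ⟨fun i => if i ∈ lattice l then s i else s 0, fun i => ?_, ?_, ?_⟩
  · dsimp only
    split_ifs with hi
    exacts [h.1.1 i hi, h.1.1 0 h0]
  · rw [bulkEnergy, bulkEnergy]
    congr 1
    refine Finset.sum_congr rfl fun i hi => ?_
    rw [bulkLattice_eq, Finset.mem_Ico] at hi
    have hm : ∀ j, 0 ≤ j → j ≤ 2 → i + j ∈ lattice l := fun j h1 h2 => by
      rw [lattice, Finset.mem_Icc]; omega
    have h1 := hm 0 le_rfl (by norm_num)
    rw [add_zero] at h1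
    simp only [bond]
    rw [if_pos h1, if_pos (hm 1 (by norm_num) (by norm_num)),
      if_pos (hm 2 (by norm_num) (by norm_num))]
  · filter_upwards [h.2, ae_restrict_mem measurableSet_Ioo] with t ht htI
    rw [ht, gridFun, if_pos (floor_mem_lattice hl htI)]
    rfl

theorem Represents.valuedIn {l : ℝ} (hl : 0 < l) {s : ℤ → R3} {u : Linf}
    (h : Represents v₁ v₂ R l s u) : ValuedIn u (circles v₁ v₂ R) := by
  filter_upwards [h.2, ae_restrict_mem measurableSet_Ioo] with t ht htI
  rw [ht]
  exact h.1.1 _ (floor_mem_lattice hl htI)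

/-! ### The bulk term: lower bound -/

theorem measurable_indicator_fHom (hα : 0 < α) (h : Admissible v₁ v₂ R) :
    Measurable ((convexHull ℝ (circles v₁ v₂ R)).indicator (fHom α v₁ v₂ R)) := by
  classical
  refine measurable_of_Iic fun c => ?_
  have hcl := h.isCompact_hull.isClosed
  have h1 : IsClosed (convexHull ℝ (circles v₁ v₂ R) ∩ {z | fHom α v₁ v₂ R z ≤ c}) := by
    have : (convexHull ℝ (circles v₁ v₂ R) ∩ {z | fHom α v₁ v₂ R z ≤ c}) =
        (fun z => (z, c)) ⁻¹' epigraph α v₁ v₂ R := by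
      ext z; rfl
    rw [this]
    exact (isClosed_epigraph hα h).preimage (by fun_prop)
  have h2 : (convexHull ℝ (circles v₁ v₂ R)).indicator (fHom α v₁ v₂ R) ⁻¹' Iic c =
      (convexHull ℝ (circles v₁ v₂ R) ∩ {z | fHom α v₁ v₂ R z ≤ c}) ∪
        ((convexHull ℝ (circles v₁ v₂ R))ᶜ ∩ {_z | (0 : ℝ) ≤ c}) := by
    ext z
    by_cases hz : z ∈ convexHull ℝ (circles v₁ v₂ R) <;> simp [hz]
  rw [h2]
  exact h1.measurableSet.union (hcl.measurableSet.compl.inter (MeasurableSet.const _))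

theorem integrableOn_fHom (hα : 0 < α) (h : Admissible v₁ v₂ R) {u : Linf} {a b : ℝ}
    (hI : Ioo a b ⊆ I)
    (hu : ∀ᵐ t ∂volume.restrict (Ioo a b), u t ∈ convexHull ℝ (circles v₁ v₂ R)) :
    IntegrableOn (fun t => fHom α v₁ v₂ R (u t)) (Ioo a b) := by
  refine Integrable.congr (f := fun t =>
    (convexHull ℝ (circles v₁ v₂ R)).indicator (fHom α v₁ v₂ R) (u t)) ?_ ?_
  · refine Integrable.of_bound ((measurable_indicator_fHom hα h).comp_aemeasurable
      (integrableOn_of_linf u hI).aestronglyMeasurable.aemeasurable).aestronglyMeasurable (1 + α) ?_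
    filter_upwards [hu] with t ht
    rw [indicator_of_mem ht]
    exact abs_fHom_le hα h ht
  · filter_upwards [hu] with t ht
    rw [indicator_of_mem ht]

theorem fst_mem_convexHull {S : Set R3} {x : R3 × ℝ} (hx : x ∈ cellPairs α S) :
    x.1 ∈ convexHull ℝ S := by
  obtain ⟨m, s, hm, hs, -, h1, -⟩ := hx
  have hm' : (m : ℝ) ≠ 0 := by exact_mod_cast hm.ne'
  have h2 : x.1 = ∑ i ∈ Finset.Ico (0 : ℤ) m, (m : ℝ)⁻¹ • s i := by
    rw [← Finset.smul_sum, ← h1, inv_smul_smul₀ hm']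
  rw [h2]
  refine (convex_convexHull ℝ S).sum_mem (fun i _ => by positivity) ?_
    fun i _ => subset_convexHull ℝ S (hs i)
  simp [hm']

/-- The mean of `u` over the cell of length `1 / M` with index `j`. -/
noncomputable def cellMean (u : Linf) (M : ℕ) (j : ℤ) : R3 :=
  (M : ℝ) • ∫ t in Ioo ((j : ℝ) / M) ((j + 1 : ℝ) / M), u t

theorem cell_subset {M : ℕ} (hM : 0 < M) {j : ℤ} (hj0 : 0 ≤ j) (hjM : j < M) :
    Ioo ((j : ℝ) / M) ((j + 1 : ℝ) / M) ⊆ I := by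
  have hM' : (0 : ℝ) < M := by exact_mod_cast hM
  refine Ioo_subset_Ioo (by positivity) ?_
  rw [div_le_one hM']
  exact_mod_cast hjM

theorem volume_cell {M : ℕ} (hM : 0 < M) (j : ℤ) :
    volume (Ioo ((j : ℝ) / M) ((j + 1 : ℝ) / M)) = ENNReal.ofReal ((M : ℝ)⁻¹) := by
  rw [Real.volume_Ioo]
  congr 1
  field_simp
  ring

theorem cellMean_eq_average {M : ℕ} (hM : 0 < M) (u : Linf) (j : ℤ) :
    cellMean u M j = ⨍ t in Ioo ((j : ℝ) / M) ((j + 1 : ℝ) / M), u t := by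
  rw [setAverage_eq, measureReal_def, volume_cell hM, ENNReal.toReal_ofReal (by positivity),
    inv_inv, cellMean]

theorem cellMean_mem (h : Admissible v₁ v₂ R) {u : Linf}
    (hu : ValuedIn u (convexHull ℝ (circles v₁ v₂ R))) {M : ℕ} (hM : 0 < M) {j : ℤ} (hj0 : 0 ≤ j)
    (hjM : j < M) : cellMean u M j ∈ convexHull ℝ (circles v₁ v₂ R) := by
  have hM' : (0 : ℝ) < M := by exact_mod_cast hM
  rw [cellMean_eq_average hM]
  refine (convex_convexHull ℝ _).set_average_mem h.isCompact_hull.isClosed ?_ ?_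
    (ae_restrict_of_ae_restrict_of_subset (cell_subset hM hj0 hjM) hu)
    (integrableOn_of_linf u (cell_subset hM hj0 hjM))
  · rw [volume_cell hM]
    simpa using hM.ne'
  · rw [volume_cell hM]
    exact ENNReal.ofReal_ne_top

/-- The means over the cells containing a point converge to the value there. -/
theorem ae_tendsto_cellMean (u : Linf) :
    ∀ᵐ t ∂volI, Tendsto (fun M : ℕ => cellMean u (M + 1) ⌊t / (1 / ((M + 1 : ℕ) : ℝ))⌋) atTop
      (𝓝 (u t)) := by
  have hint : Integrable (I.indicator u) :=
    (integrable_indicator_iff measurableSet_Ioo).2 (integrable_of_linf u)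
  have hδ : Tendsto (fun M : ℕ => 1 / ((M : ℝ) + 1) / 2) atTop (𝓝[>] 0) := by
    refine tendsto_nhdsWithin_iff.2 ⟨?_, Eventually.of_forall fun n => by
      simp only [mem_Ioi]; positivity⟩
    simpa using tendsto_one_div_add_atTop_nhds_zero_nat (𝕜 := ℝ).div_const 2
  rw [ae_restrict_iff' measurableSet_Ioo]
  filter_upwards [IsUnifLocDoublingMeasure.ae_tendsto_average volume hint.locallyIntegrable 1]
    with t ht htI
  have hM1 : ∀ M : ℕ, (0 : ℝ) < (M : ℝ) + 1 := fun M => by positivity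
  have hfl : ∀ M : ℕ, (⌊t * (M + 1)⌋ : ℝ) / (M + 1) ≤ t ∧ t < (⌊t * (M + 1)⌋ + 1 : ℝ) / (M + 1) :=
    fun M => by
      rw [div_le_iff₀ (hM1 M), lt_div_iff₀ (hM1 M)]
      exact ⟨Int.floor_le _, Int.lt_floor_add_one _⟩
  have hball : ∀ M : ℕ, Metric.closedBall (((⌊t * (M + 1)⌋ : ℝ) + 1 / 2) / (M + 1))
      (1 / ((M : ℝ) + 1) / 2) =
      Icc ((⌊t * (M + 1)⌋ : ℝ) / (M + 1)) ((⌊t * (M + 1)⌋ + 1 : ℝ) / (M + 1)) := fun M => by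
    rw [Real.closedBall_eq_Icc]
    have := hM1 M
    congr 1 <;> (field_simp; ring)
  have h1 := ht (fun M : ℕ => ((⌊t * (M + 1)⌋ : ℝ) + 1 / 2) / (M + 1)) _ hδ
    (Eventually.of_forall fun M => by
      rw [one_mul, hball]
      exact ⟨(hfl M).1, (hfl M).2.le⟩)
  rw [indicator_of_mem htI] at h1
  refine h1.congr fun M => ?_
  have hdiv : t / (1 / ((M + 1 : ℕ) : ℝ)) = t * (M + 1) := by
    push_cast
    rw [div_div_eq_mul_div, div_one]
  have hj0 : 0 ≤ ⌊t * ((M : ℝ) + 1)⌋ := Int.floor_nonneg.2 (mul_nonneg htI.1.le (hM1 M).le)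
  have hjM : ⌊t * ((M : ℝ) + 1)⌋ < (M + 1 : ℕ) := by
    rw [Int.floor_lt]
    push_cast
    nlinarith [htI.2, hM1 M]
  have hsub := cell_subset M.succ_pos hj0 hjM
  rw [hball, hdiv, cellMean_eq_average M.succ_pos, setAverage_congr Ioo_ae_eq_Icc.symm]
  rw [Nat.cast_succ] at hsub ⊢
  exact setAverage_congr_fun measurableSet_Ioo (Eventually.of_forall fun y hy =>
    indicator_of_mem (hsub hy) _)

/-- By Fatou's lemma and the lower semicontinuity of `f_hom`, Riemann-type sums of `f_hom` over
the means of `u` on a fine grid approximate the bulk term from above. -/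
theorem exists_grid_sum_ge (hα : 0 < α) (h : Admissible v₁ v₂ R) {u : Linf}
    (hu : ValuedIn u (convexHull ℝ (circles v₁ v₂ R))) {ε : ℝ} (hε : 0 < ε) :
    ∃ M : ℕ, 0 < M ∧ homEnergy α v₁ v₂ R u - ε <
      (M : ℝ)⁻¹ * ∑ j ∈ Finset.Ico (0 : ℤ) M, fHom α v₁ v₂ R (cellMean u M j) := by
  set f := fHom α v₁ v₂ R with hf
  set K := convexHull ℝ (circles v₁ v₂ R) with hK
  by_contra! hcon
  let c : ℕ → ℤ → ℝ := fun M j => K.indicator f (cellMean u (M + 1) j)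
  have hc : ∀ M j, ‖c M j‖ ≤ 1 + α := fun M j => by
    simp only [c]
    by_cases hz : cellMean u (M + 1) j ∈ K
    · rw [indicator_of_mem hz]; exact abs_fHom_le hα h hz
    · rw [indicator_of_notMem hz, norm_zero]; positivity
  let F : ℕ → ℝ → ℝ := fun M t => gridFun (1 / ((M + 1 : ℕ) : ℝ)) (c M) t
  have hFint : ∀ M, Integrable (F M) volI := fun M =>
    Integrable.of_bound (stronglyMeasurable_gridFun _ _).aestronglyMeasurable (1 + α)
      (Eventually.of_forall fun t => hc M _)
  have hFsum : ∀ M, ∫ t in I, F M t ≤ homEnergy α v₁ v₂ R u - ε := by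
    intro M
    have hM0 : (0 : ℝ) < ((M + 1 : ℕ) : ℝ) := by positivity
    have h1 := integral_gridFun (l := 1 / ((M + 1 : ℕ) : ℝ)) (by positivity) (hc M)
      (m := 0) (n := (M + 1 : ℕ)) (by omega)
    have h2 : 1 / ((M + 1 : ℕ) : ℝ) * (((M + 1 : ℕ) : ℤ) : ℝ) = 1 := by
      rw [Int.cast_natCast, one_div_mul_cancel hM0.ne']
    rw [h2, Int.cast_zero, mul_zero, intervalIntegral.integral_of_le zero_le_one,
      integral_Ioc_eq_integral_Ioo] at h1
    refine (h1.trans_le ?_).trans (hcon (M + 1) M.succ_pos)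
    rw [smul_eq_mul, one_div]
    refine le_of_eq (congrArg _ (Finset.sum_congr rfl fun j hj => ?_))
    rw [Finset.mem_Ico] at hj
    exact indicator_of_mem (cellMean_mem h hu M.succ_pos hj.1 hj.2) _
  have hfint : Integrable (fun t => f (u t)) volI := integrableOn_fHom hα h subset_rfl hu
  have hbound : ∀ᵐ t ∂volI, ENNReal.ofReal (f (u t) + (1 + α)) ≤
      liminf (fun M => ENNReal.ofReal (F M t + (1 + α))) atTop := by
    filter_upwards [ae_tendsto_cellMean u, hu, ae_restrict_mem measurableSet_Ioo] with t ht htK htI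
    refine le_of_forall_lt fun y hy => ?_
    obtain ⟨y', hyy', hy'⟩ := exists_between hy
    refine hyy'.trans_le (le_liminf_of_le (by isBoundedDefault) ?_)
    have hy_top := ne_top_of_lt hy'
    rw [ENNReal.lt_ofReal_iff_toReal_lt hy_top] at hy'
    have hmem : ∀ M : ℕ, cellMean u (M + 1) ⌊t / (1 / ((M + 1 : ℕ) : ℝ))⌋ ∈ K := by
      intro M
      have hM0 : (0 : ℝ) < ((M + 1 : ℕ) : ℝ) := by positivity
      refine cellMean_mem h hu M.succ_pos ?_ ?_
      · exact Int.floor_nonneg.2 (by have := htI.1; positivity)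
      · rw [Int.floor_lt, div_div_eq_mul_div, div_one, Int.cast_natCast]
        nlinarith [htI.2]
    have h1 := lowerSemicontinuousOn_fHom hα h (u t) htK (y'.toReal - (1 + α)) (by linarith)
    have h2 := (tendsto_nhdsWithin_iff.2 ⟨ht, Eventually.of_forall hmem⟩).eventually h1
    filter_upwards [h2] with M hM
    have h3 : F M t = f (cellMean u (M + 1) ⌊t / (1 / ((M + 1 : ℕ) : ℝ))⌋) :=
      indicator_of_mem (hmem M) _
    refine ((ENNReal.lt_ofReal_iff_toReal_lt hy_top).2 ?_).le
    rw [h3]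
    linarith
  have hfint' : Integrable (fun t => f (u t) + (1 + α)) volI := hfint.add (integrable_const _)
  have hFint' : ∀ M, Integrable (fun t => F M t + (1 + α)) volI := fun M =>
    (hFint M).add (integrable_const _)
  have hpos : ∀ M t, 0 ≤ F M t + (1 + α) := fun M t => by
    have := (abs_le.1 (hc M ⌊t / (1 / ((M + 1 : ℕ) : ℝ))⌋)).1
    change -(1 + α) ≤ F M t at this
    linarith
  have hfpos : ∀ᵐ t ∂volI, 0 ≤ f (u t) + (1 + α) := by
    filter_upwards [hu] with t ht
    linarith [(abs_le.1 (abs_fHom_le hα h ht)).1]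
  have hFatou : ENNReal.ofReal (∫ t in I, (f (u t) + (1 + α))) ≤
      ENNReal.ofReal (homEnergy α v₁ v₂ R u - ε + (1 + α)) := by
    rw [ofReal_integral_eq_lintegral_ofReal hfint' hfpos]
    refine (lintegral_mono_ae hbound).trans ((lintegral_liminf_le' fun M =>
      (hFint' M).aemeasurable.ennreal_ofReal).trans ?_)
    refine (liminf_le_of_frequently_le' (Eventually.of_forall fun M => ?_).frequently)
    rw [← ofReal_integral_eq_lintegral_ofReal (hFint' M)
      (Eventually.of_forall (hpos M))]
    refine ENNReal.ofReal_le_ofReal ?_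
    rw [integral_add (hFint M) (integrable_const _)]
    simp only [integral_const, MeasurableSet.univ, measureReal_restrict_apply, univ_inter,
      Real.volume_real_Ioo_of_le zero_le_one, sub_zero, one_smul]
    linarith [hFsum M]
  have hge : 0 ≤ homEnergy α v₁ v₂ R u - ε + (1 + α) := by
    have h1 : 0 ≤ ∫ t in I, (F 0 t + (1 + α)) := integral_nonneg (hpos 0)
    rw [integral_add (hFint 0) (integrable_const _)] at h1
    simp only [integral_const, MeasurableSet.univ, measureReal_restrict_apply, univ_inter,
      Real.volume_real_Ioo_of_le zero_le_one, sub_zero, one_smul] at h1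
    linarith [hFsum 0]
  rw [ENNReal.ofReal_le_ofReal_iff hge, integral_add hfint (integrable_const _)] at hFatou
  simp only [integral_const, MeasurableSet.univ, measureReal_restrict_apply, univ_inter,
    Real.volume_real_Ioo_of_le zero_le_one, sub_zero, one_smul] at hFatou
  change homEnergy α v₁ v₂ R u + _ ≤ _ at hFatou
  linarith

end SpinChain

namespace SpinChain

variable {α : ℝ} {v₁ v₂ : R3} {R : ℝ}

/-- The energy of the portion of a chain over an interval is bounded below by the value of `f_hom`
at nearly the mean of the chain over that interval. -/
theorem exists_fHom_le_block (hα : 0 < α) (h : Admissible v₁ v₂ R) {l : ℝ} (hl : 0 < l)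
    {s : ℤ → R3} (hs : ∀ i, s i ∈ circles v₁ v₂ R) {a b : ℝ} (hab : a + l ≤ b) :
    ∃ z ∈ convexHull ℝ (circles v₁ v₂ R),
      ‖(∫ t in Ioo a b, gridFun l s t) - (b - a) • z‖ ≤ 4 * l ∧
      (b - a) * fHom α v₁ v₂ R z - 6 * (1 + α) * l ≤
        l * ∑ i ∈ Finset.Ico ⌈a / l⌉ ⌈b / l⌉, bond α s i := by
  have hs1 : ∀ i, ‖s i‖ ≤ 1 := fun i => norm_le_of_subset_sphere h.circles_subset_sphere (hs i)
  have hlt : ⌈a / l⌉ < ⌈b / l⌉ := by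
    have h1 : a / l + 1 ≤ b / l := by
      rw [← sub_nonneg]
      have : b / l - (a / l + 1) = (b - (a + l)) / l := by field_simp
      rw [this]
      exact div_nonneg (by linarith) hl.le
    rw [Int.lt_iff_add_one_le, ← Int.ceil_add_one]
    exact Int.ceil_mono h1
  obtain ⟨x, hx, hx1, hx2⟩ := exists_cellPair_of_block hα h.circles_subset_sphere hs hlt
  have hxK := fst_mem_convexHull hx
  have hx0 := h.norm_le_one_of_mem_hull hxK
  have hf := fHom_le hα h hxK (e := x.2) (subset_closure hx)
  have hf1 := abs_le.1 (abs_fHom_le hα h hxK)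
  refine ⟨x.1, hxK, ?_, ?_⟩
  all_goals
    have ha := abs_le.1 (abs_mul_ceil_sub_le hl a)
    have hb := abs_le.1 (abs_mul_ceil_sub_le hl b)
  · have h1 := norm_setIntegral_gridFun_sub_le hl hs1 (a := a) (b := b) (by linarith)
    rw [← hx1, smul_smul] at h1
    have h2 : ‖(l * ((⌈b / l⌉ - ⌈a / l⌉ : ℤ) : ℝ) - (b - a)) • x.1‖ ≤ 2 * l * 1 := by
      rw [norm_smul, Real.norm_eq_abs]
      refine mul_le_mul ?_ hx0 (norm_nonneg _) (by positivity)
      push_cast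
      rw [abs_le]
      constructor <;> linarith
    have h3 := norm_add_le _ _ |>.trans (add_le_add h1 h2)
    rw [sub_smul, sub_add_sub_cancel] at h3
    linarith
  · have h1 := (abs_le.1 hx2).1
    have h2 : (0 : ℝ) < ((⌈b / l⌉ - ⌈a / l⌉ : ℤ) : ℝ) := by exact_mod_cast sub_pos.2 hlt
    have h3 : ((⌈b / l⌉ - ⌈a / l⌉ : ℤ) : ℝ) * fHom α v₁ v₂ R x.1 - 4 * (1 + α) ≤
        ∑ i ∈ Finset.Ico ⌈a / l⌉ ⌈b / l⌉, bond α s i := by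
      have := mul_le_mul_of_nonneg_left hf h2.le
      linarith
    have h4 := mul_le_mul_of_nonneg_left h3 hl.le
    have h5 : |(l * ((⌈b / l⌉ - ⌈a / l⌉ : ℤ) : ℝ) - (b - a)) * fHom α v₁ v₂ R x.1| ≤
        2 * l * (1 + α) := by
      rw [abs_mul]
      refine mul_le_mul ?_ (abs_fHom_le hα h hxK) (abs_nonneg _) (by positivity)
      push_cast
      rw [abs_le]
      constructor <;> linarith
    have h6 := (abs_le.1 h5).1
    linarith

/-- The bulk energy is, up to two summands, the sum over all lattice points in `[0, 1)`. -/
theorem abs_bulkEnergy_sub_le (hα : 0 < α) {l : ℝ} (hl : 0 < l) (hl1 : l ≤ 1) {s : ℤ → R3}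
    (hs : ∀ i, ‖s i‖ ≤ 1) :
    |bulkEnergy α l s - l * ∑ i ∈ Finset.Ico 0 ⌈1 / l⌉, bond α s i| ≤ 2 * (1 + α) * l := by
  have h1 : 1 ≤ ⌊1 / l⌋ := by
    rw [Int.le_floor, Int.cast_one, one_le_div hl]; exact hl1
  have h2 : ⌈1 / l⌉ ≤ ⌊1 / l⌋ + 1 := Int.ceil_le_floor_add_one _
  have h2' : ⌊1 / l⌋ ≤ ⌈1 / l⌉ := Int.floor_le_ceil _
  rw [bulkEnergy, bulkLattice_eq, ← sum_Ico_consecutive_int _ (b := ⌊1 / l⌋ - 1) (c := ⌈1 / l⌉)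
    (by omega) (by omega), mul_add, sub_add_cancel_left, abs_neg, abs_mul, abs_of_pos hl, mul_comm]
  gcongr
  refine (Finset.abs_sum_le_sum_abs _ _).trans ((Finset.sum_le_card_nsmul _ _ _ fun i _ =>
    abs_bond_le hα hs i).trans ?_)
  rw [nsmul_eq_mul, Int.card_Ico]
  gcongr
  have : (⌈1 / l⌉ - (⌊1 / l⌋ - 1)).toNat ≤ 2 := by omega
  exact_mod_cast this

/-- The lower bound for the bulk energies along a weak-star convergent sequence, uniformly in the
chains that represent the functions. -/
theorem WeakStar.eventually_homEnergy_le (hα : 0 < α) (h : Admissible v₁ v₂ R) {l : ℕ → ℝ}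
    (hl : ∀ n, 0 < l n) (hl0 : Tendsto l atTop (𝓝 0)) {u : ℕ → Linf} {u' : Linf}
    (hw : WeakStar u u') (hu' : ValuedIn u' (convexHull ℝ (circles v₁ v₂ R))) {ε : ℝ}
    (hε : 0 < ε) : ∀ᶠ n in atTop, ∀ s, Represents v₁ v₂ R (l n) s (u n) →
      homEnergy α v₁ v₂ R u' - ε ≤ bulkEnergy α (l n) s := by
  obtain ⟨M, hM, hgrid⟩ := exists_grid_sum_ge hα h hu' (half_pos hε)
  have hM' : (0 : ℝ) < M := by exact_mod_cast hM
  set f := fHom α v₁ v₂ R with hf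
  have hcell : ∀ j ∈ Finset.range M, ∀ᶠ n in atTop, ∀ z ∈ convexHull ℝ (circles v₁ v₂ R),
      ‖(∫ t in Ioo ((j : ℝ) / M) ((j + 1 : ℝ) / M), u n t) - (M : ℝ)⁻¹ • z‖ ≤ 4 * l n →
      f (cellMean u' M j) - ε / 4 ≤ f z := by
    intro j hj
    rw [Finset.mem_range] at hj
    have hjM : (j : ℤ) < M := by exact_mod_cast hj
    have hsub := cell_subset hM (Int.natCast_nonneg j) hjM
    have hlsc := lowerSemicontinuousOn_fHom hα h _
      (cellMean_mem h hu' hM (Int.natCast_nonneg j) hjM)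
      (f (cellMean u' M j) - ε / 4) (by linarith)
    obtain ⟨δ, hδ, hball⟩ := Metric.mem_nhdsWithin_iff.1 hlsc
    have hconv := (hw.tendsto_setIntegral measurableSet_Ioo hsub).const_smul (M : ℝ)
    have h1 := (Metric.tendsto_nhds.1 hconv) (δ / 2) (half_pos hδ)
    have h2 : ∀ᶠ n in atTop, M * (4 * l n) < δ / 2 := by
      have : Tendsto (fun n => M * (4 * l n)) atTop (𝓝 0) := by
        simpa using (hl0.const_mul 4).const_mul (M : ℝ)
      exact this.eventually_lt_const (half_pos hδ)
    filter_upwards [h1, h2] with n hn1 hn2 z hz hzn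
    refine (hball ⟨?_, hz⟩).le
    rw [Metric.mem_ball, dist_eq_norm, cellMean, Int.cast_natCast]
    have h3 := mul_le_mul_of_nonneg_left hzn hM'.le
    rw [← abs_of_pos hM', ← Real.norm_eq_abs, ← norm_smul, Real.norm_eq_abs, abs_of_pos hM',
      smul_sub, smul_inv_smul₀ hM'.ne'] at h3
    rw [dist_eq_norm, Int.cast_natCast] at hn1
    rw [norm_sub_rev] at h3
    have h4 := norm_add_le _ _ |>.trans_lt (add_lt_add_of_le_of_lt h3 hn1)
    rw [sub_add_sub_cancel] at h4
    linarith
  have hsmall : ∀ᶠ n in atTop, (6 * M + 2) * (1 + α) * l n < ε / 4 := by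
    have : Tendsto (fun n => (6 * M + 2) * (1 + α) * l n) atTop (𝓝 0) := by
      simpa using hl0.const_mul ((6 * M + 2) * (1 + α))
    exact this.eventually_lt_const (by positivity)
  have hlM : ∀ᶠ n in atTop, l n < (M : ℝ)⁻¹ := hl0.eventually_lt_const (by positivity)
  have hl1 : ∀ᶠ n in atTop, l n < 1 := hl0.eventually_lt_const one_pos
  filter_upwards [(Finset.eventually_all _).2 hcell, hsmall, hlM, hl1] with n hcell hsmall hlM hl1 s
    hrep
  obtain ⟨s', hs', hbulk, hus⟩ := hrep.exists_total (α := α) (hl n)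
  rw [← hbulk]
  have hs1 : ∀ i, ‖s' i‖ ≤ 1 := fun i => norm_le_of_subset_sphere h.circles_subset_sphere (hs' i)
  have hb := (abs_le.1 (abs_bulkEnergy_sub_le hα (hl n) hl1.le hs1)).1
  have hsum := sum_range_sum_Ico (bond α s') (fun j : ℕ => ⌈((j : ℝ) / M) / l n⌉) M fun j _ =>
    Int.ceil_mono (by have := hl n; gcongr; simp)
  simp only [Nat.cast_zero, zero_div, Int.ceil_zero, div_self hM'.ne'] at hsum
  rw [← hsum, Finset.mul_sum] at hb
  have hblock : ∀ j ∈ Finset.range M, (M : ℝ)⁻¹ * (f (cellMean u' M j) - ε / 4) -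
      6 * (1 + α) * l n ≤ l n * ∑ i ∈ Finset.Ico ⌈((j : ℝ) / M) / l n⌉
        ⌈(((j + 1 : ℕ) : ℝ) / M) / l n⌉, bond α s' i := by
    intro j hj
    have hlen : (((j + 1 : ℕ) : ℝ) / M) - (j : ℝ) / M = (M : ℝ)⁻¹ := by
      push_cast; field_simp; ring
    obtain ⟨z, hz, hz1, hz2⟩ := exists_fHom_le_block hα h (hl n) hs' (a := (j : ℝ) / M)
      (b := ((j + 1 : ℕ) : ℝ) / M) (by linarith)
    rw [hlen] at hz1 hz2
    have hsub := cell_subset hM (Int.natCast_nonneg j) (by exact_mod_cast Finset.mem_range.1 hj)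
    rw [Int.cast_natCast] at hsub
    rw [Nat.cast_succ] at hz1
    rw [← integral_congr_ae (ae_restrict_of_ae_restrict_of_subset hsub hus)] at hz1
    have h1 := hcell j hj z hz hz1
    refine le_trans ?_ hz2
    gcongr
  have htot := Finset.sum_le_sum hblock
  rw [Finset.sum_sub_distrib, ← Finset.mul_sum, Finset.sum_sub_distrib] at htot
  simp only [Finset.sum_const, Finset.card_range, nsmul_eq_mul] at htot
  have hcast : ∑ j ∈ Finset.Ico (0 : ℤ) M, f (cellMean u' M j) =
      ∑ j ∈ Finset.range M, f (cellMean u' M j) := by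
    refine Finset.sum_nbij' Int.toNat (fun j : ℕ => (j : ℤ)) ?_ ?_ ?_ ?_ ?_
    all_goals
      intro j hj
      simp only [Finset.mem_Ico, Finset.mem_range] at hj ⊢
    all_goals try omega
    rw [Int.toNat_of_nonneg hj.1]
  rw [hcast] at hgrid
  rw [mul_sub, ← mul_assoc, inv_mul_cancel₀ hM'.ne', one_mul] at htot
  linarith

end SpinChain

namespace SpinChain

variable {α : ℝ} {v₁ v₂ : R3} {R : ℝ}

/-! ### Partitions of `I` and labels -/

/-- Every finite set of points cuts `[0, 1]` into finitely many intervals. -/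
theorem exists_partition (F : Finset ℝ) : ∃ (M : ℕ) (τ : ℕ → ℝ), 0 < M ∧ Monotone τ ∧ τ 0 = 0 ∧
    τ M = 1 ∧ (∀ j < M, τ j < τ (j + 1)) ∧ ∀ j < M, ∀ x ∈ F, x ∉ Ioo (τ j) (τ (j + 1)) := by
  classical
  let G : Finset ℝ := insert 0 (insert 1 (F.filter fun x => x ∈ I))
  have h0 : (0 : ℝ) ∈ G := by simp [G]
  have h1 : (1 : ℝ) ∈ G := by simp [G]
  have hG : ∀ x ∈ G, 0 ≤ x ∧ x ≤ 1 := fun x hx => by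
    simp only [G, Finset.mem_insert, Finset.mem_filter] at hx
    rcases hx with rfl | rfl | ⟨-, hx⟩
    exacts [⟨le_rfl, zero_le_one⟩, ⟨zero_le_one, le_rfl⟩, ⟨hx.1.le, hx.2.le⟩]
  have hcard : 1 < G.card := Finset.one_lt_card.2 ⟨0, h0, 1, h1, zero_ne_one⟩
  obtain ⟨M, hM⟩ : ∃ M, G.card = M + 1 := ⟨G.card - 1, by omega⟩
  let e := G.orderEmbOfFin hM
  have heG : ∀ i, e i ∈ G := G.orderEmbOfFin_mem hM
  have hsurj : ∀ x ∈ G, ∃ i, e i = x := fun x hx => by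
    have : x ∈ Set.range e := by
      rw [Finset.range_orderEmbOfFin]; exact hx
    exact this
  let τ : ℕ → ℝ := fun j => e ⟨min j M, by omega⟩
  have hlt : ∀ j < M, τ j < τ (j + 1) := fun j hj => e.strictMono (by
    simp only [Fin.mk_lt_mk]; omega)
  refine ⟨M, τ, by omega, fun i j hij => e.monotone (by simp only [Fin.mk_le_mk]; omega), ?_, ?_,
    hlt, ?_⟩
  · obtain ⟨i, hi⟩ := hsurj 0 h0
    refine le_antisymm ?_ (hG _ (heG _)).1
    rw [← hi]
    exact e.monotone (by rw [Fin.le_def]; simp)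
  · obtain ⟨i, hi⟩ := hsurj 1 h1
    refine le_antisymm (hG _ (heG _)).2 ?_
    rw [← hi]
    exact e.monotone (by rw [Fin.le_def]; simp; omega)
  · intro j hj x hx hxj
    have hxI : x ∈ I := ⟨(hG _ (heG _)).1.trans_lt hxj.1, hxj.2.trans_le (hG _ (heG _)).2⟩
    obtain ⟨i, rfl⟩ := hsurj x (by simp [G, hx, hxI.1, hxI.2])
    have h2 := e.lt_iff_lt.1 hxj.1
    have h3 := e.lt_iff_lt.1 hxj.2
    rw [Fin.lt_def] at h2 h3
    simp only at h2 h3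
    omega

theorem exists_mem_Ico_of_partition {τ : ℕ → ℝ} {M : ℕ} {x : ℝ} (h0 : τ 0 ≤ x) (hM : x < τ M) :
    ∃ j < M, τ j ≤ x ∧ x < τ (j + 1) := by
  induction M with
  | zero => exact absurd hM (not_lt.2 h0)
  | succ M ih =>
    by_cases hx : x < τ M
    · obtain ⟨j, hj, hjx⟩ := ih hx
      exact ⟨j, hj.trans M.lt_succ_self, hjx⟩
    · exact ⟨M, M.lt_succ_self, not_lt.1 hx, hM⟩

/-- A function with values in the two discs belongs to `𝔇` if finitely many points cut `I` into
intervals on which it takes values in a single disc. -/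
theorem mem_domainD_of_cuts {u : Linf} (hu : ValuedIn u (disc v₁ R ∪ disc v₂ R)) (F : Finset ℝ)
    (hF : ∀ a b, a < b → Ioo a b ⊆ I → (∀ x ∈ F, x ∉ Ioo a b) →
      (∀ᵐ x ∂volume.restrict (Ioo a b), u x ∈ disc v₁ R) ∨
      (∀ᵐ x ∂volume.restrict (Ioo a b), u x ∈ disc v₂ R)) : u ∈ domainD v₁ v₂ R := by
  obtain ⟨M, τ, -, hmono, h0, h1, hlt, hcut⟩ := exists_partition F
  refine ⟨hu, M, fun j => τ j, Fin.strictMono_iff_lt_succ.2 fun j => ?_, h0, ?_, fun j => ?_⟩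
  · simpa using hlt j j.2
  · simpa using h1
  · refine hF _ _ ?_ ?_ ?_
    · simpa using hlt j j.2
    · refine Ioo_subset_Ioo ?_ ?_
      · rw [← h0]; exact hmono (Nat.zero_le _)
      · rw [← h1]; exact hmono (by simp)
    · simpa using hcut j j.2

/-- The numerical label of a disc: `0` for the first, `1` for the second. -/
noncomputable def label (b : Bool) : ℝ := if b then 1 else 0

theorem axis_eq (b : Bool) : axis v₁ v₂ b = v₁ + label b • (v₂ - v₁) := by
  cases b <;> simp [axis, label]

theorem label_injective : Function.Injective label := by
  intro b c hbc
  cases b <;> cases c <;> simp [label] at hbc ⊢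

variable {ι : Type*} [Fintype ι] {u : Linf} {c₀ : ℝ} {σ t : ι → ℝ}

/-- The disc in which `u` takes its values is given by the step function with value `c₀` at the
left end and jumps `σ j` at `t j`. -/
def HasLabel (v₁ v₂ : R3) (R : ℝ) (u : Linf) (c₀ : ℝ) (σ t : ι → ℝ) : Prop :=
  ∀ᵐ x ∂volI, ∃ b, stepLabel c₀ σ t x = label b ∧ u x ∈ disc (axis v₁ v₂ b) R

theorem Admissible.anis_eq (h : Admissible v₁ v₂ R) {x : ℝ} {b : Bool}
    (hx : u x ∈ disc (axis v₁ v₂ b) R) : anis v₁ v₂ R u x = axis v₁ v₂ b := by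
  rw [anis]
  cases b
  · exact if_pos hx
  · exact if_neg (h.not_mem_disc_not true hx)

theorem HasLabel.anis_ae_eq (h : Admissible v₁ v₂ R) (hu : HasLabel v₁ v₂ R u c₀ σ t) :
    anis v₁ v₂ R u =ᵐ[volI] fun x => v₁ + stepLabel c₀ σ t x • (v₂ - v₁) := by
  filter_upwards [hu] with x ⟨b, hb, hx⟩
  rw [h.anis_eq hx, axis_eq, hb]

theorem stepLabel_congr {x y : ℝ} (hxy : ∀ j, t j ≤ x ↔ t j ≤ y) :
    stepLabel c₀ σ t x = stepLabel c₀ σ t y := by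
  simp only [stepLabel, hxy]

theorem HasLabel.mem_domainD (hu : HasLabel v₁ v₂ R u c₀ σ t) : u ∈ domainD v₁ v₂ R := by
  classical
  refine mem_domainD_of_cuts ?_ (Finset.univ.image t) fun a b hab hsub hcut => ?_
  · filter_upwards [hu] with x ⟨b, _, hx⟩
    cases b
    exacts [Or.inl hx, Or.inr hx]
  · have hconst : ∀ x ∈ Ioo a b, stepLabel c₀ σ t x = stepLabel c₀ σ t a := by
      refine fun x hx => stepLabel_congr fun j => ⟨fun hj => ?_, fun hj => hj.trans hx.1.le⟩
      by_contra hja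
      exact hcut (t j) (by simp) ⟨not_le.1 hja, hj.trans_lt hx.2⟩
    have hae : ∀ᵐ x ∂volume.restrict (Ioo a b), ∃ b, stepLabel c₀ σ t a = label b ∧
        u x ∈ disc (axis v₁ v₂ b) R := by
      filter_upwards [ae_restrict_of_ae_restrict_of_subset hsub hu,
        ae_restrict_mem measurableSet_Ioo] with x hx hxab
      rwa [hconst x hxab] at hx
    by_cases hl : stepLabel c₀ σ t a = label false
    · left
      filter_upwards [hae] with x ⟨b, hb, hx⟩
      rw [← label_injective (hl.symm.trans hb)] at hx
      exact hx
    · right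
      filter_upwards [hae] with x ⟨b, hb, hx⟩
      cases b
      · exact absurd hb hl
      · exact hx

theorem Represents.mem_domainD {l : ℝ} (hl : 0 < l) {s : ℤ → R3} (h : Represents v₁ v₂ R l s u) :
    u ∈ domainD v₁ v₂ R := by
  classical
  have hsub : circles v₁ v₂ R ⊆ disc v₁ R ∪ disc v₂ R :=
    union_subset_union (subset_convexHull ℝ _) (subset_convexHull ℝ _)
  refine mem_domainD_of_cuts ((h.valuedIn hl).mono fun x hx => hsub hx)
    ((lattice l).image fun i : ℤ => l * i) fun a b hab hI hcut => ?_
  have hle : ∀ y ∈ Ioo a b, ∀ z ∈ Ioo a b, ⌊z / l⌋ ≤ ⌊y / l⌋ := by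
    intro y hy z hz
    by_contra! hlt
    refine hcut (l * ⌊z / l⌋) (Finset.mem_image_of_mem _ (floor_mem_lattice hl (hI hz))) ⟨?_, ?_⟩
    · rw [Int.floor_lt, div_lt_iff₀' hl] at hlt
      exact hy.1.trans hlt
    · refine lt_of_le_of_lt ?_ hz.2
      rw [← le_div_iff₀' hl]
      exact Int.floor_le _
  have hmid : (a + b) / 2 ∈ Ioo a b := ⟨by linarith, by linarith⟩
  have hae : ∀ᵐ x ∂volume.restrict (Ioo a b), u x = s ⌊(a + b) / 2 / l⌋ := by
    filter_upwards [ae_restrict_of_ae_restrict_of_subset hI h.2,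
      ae_restrict_mem measurableSet_Ioo] with x hx hxab
    rw [hx, stepFun, le_antisymm (hle _ hmid x hxab) (hle x hxab _ hmid)]
  rcases hsub (h.1.1 _ (floor_mem_lattice hl (hI hmid))) with hs | hs
  · exact Or.inl (hae.mono fun x hx => hx ▸ hs)
  · exact Or.inr (hae.mono fun x hx => hx ▸ hs)

/-- Telescoping: the step function which jumps from `c j` to `c (j + 1)` at `τ (j + 1)`. -/
theorem stepLabel_telescope {τ : ℕ → ℝ} (hτ : Monotone τ) {M i : ℕ} (hi : i < M) (c : ℕ → ℝ)
    {x : ℝ} (hx : τ i ≤ x) (hx' : x < τ (i + 1)) :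
    stepLabel (c 0) (fun j : Fin (M - 1) => c (j + 1) - c j) (fun j => τ (j + 1)) x = c i := by
  have hiff : ∀ j : ℕ, τ (j + 1) ≤ x ↔ j < i := fun j => by
    constructor
    · intro hj
      by_contra! hji
      exact absurd (hx'.trans_le ((hτ (by omega : i + 1 ≤ j + 1)).trans hj)) (lt_irrefl _)
    · intro hj
      exact (hτ (by omega)).trans hx
  rw [stepLabel, Fin.sum_univ_eq_sum_range (fun j => if τ (j + 1) ≤ x then c (j + 1) - c j else 0),
    ← Finset.sum_filter]
  have hfil : (Finset.range (M - 1)).filter (fun j => τ (j + 1) ≤ x) = Finset.range i := by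
    ext j
    simp only [Finset.mem_filter, Finset.mem_range, hiff]
    omega
  rw [hfil, Finset.sum_range_sub, add_sub_cancel]

/-- The elements of `𝔇` have a label with finitely many jumps of height `±1` at distinct points
of `I`. -/
theorem exists_hasLabel (hu : u ∈ domainD v₁ v₂ R) :
    ∃ (J : ℕ) (c₀ : ℝ) (σ t : Fin J → ℝ), (∃ b, c₀ = label b) ∧ (∀ j, σ j = 1 ∨ σ j = -1) ∧
      (∀ j, t j ∈ I) ∧ Function.Injective t ∧
      (∀ x ∈ Ico (0 : ℝ) 1, ∃ b, stepLabel c₀ σ t x = label b) ∧ HasLabel v₁ v₂ R u c₀ σ t := by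
  classical
  obtain ⟨-, M, t, htm, ht0, ht1, hpiece⟩ := hu
  have hb : ∀ j : ℕ, ∃ b : Bool, ∀ hj : j < M,
      ∀ᵐ x ∂volume.restrict (Ioo (t (Fin.castSucc ⟨j, hj⟩)) (t (Fin.succ ⟨j, hj⟩))),
        u x ∈ disc (axis v₁ v₂ b) R := by
    intro j
    by_cases hj : j < M
    · rcases hpiece ⟨j, hj⟩ with h | h
      exacts [⟨false, fun _ => h⟩, ⟨true, fun _ => h⟩]
    · exact ⟨false, fun h => absurd h hj⟩
  choose c hc using hb
  let τ : ℕ → ℝ := fun j => t ⟨min j M, by omega⟩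
  have hτ : Monotone τ := fun i j hij => htm.monotone (by simp only [Fin.mk_le_mk]; omega)
  have hτM : τ M = 1 := by
    rw [← ht1]; simp only [τ, min_self]; rfl
  have hτ0 : τ 0 = 0 := by
    rw [← ht0]; simp only [τ, Nat.zero_min]; rfl
  let σ₀ : Fin (M - 1) → ℝ := fun j => label (c (j + 1)) - label (c j)
  let t₀ : Fin (M - 1) → ℝ := fun j => τ (j + 1)
  let ι' := {j : Fin (M - 1) // σ₀ j ≠ 0}
  let e : Fin (Fintype.card ι') ≃ ι' := (Fintype.equivFin ι').symm
  have hrestrict : ∀ x, stepLabel (label (c 0)) (fun j => σ₀ (e j)) (fun j => t₀ (e j)) x =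
      stepLabel (label (c 0)) σ₀ t₀ x := fun x => by
    rw [stepLabel, stepLabel]
    congr 1
    rw [e.sum_comp (fun j : ι' => if t₀ j ≤ x then σ₀ j else 0),
      ← Finset.sum_subtype (Finset.univ.filter fun j => σ₀ j ≠ 0) (by simp)
        (fun j => if t₀ j ≤ x then σ₀ j else 0)]
    refine Finset.sum_subset (Finset.subset_univ _) fun j _ hj => ?_
    have hj0 : σ₀ j = 0 := by simpa using hj
    simp [hj0]
  have hval : ∀ x, ∀ i < M, τ i ≤ x → x < τ (i + 1) →
      stepLabel (label (c 0)) (fun j => σ₀ (e j)) (fun j => t₀ (e j)) x = label (c i) :=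
    fun x i hi h1 h2 => by
      rw [hrestrict]
      exact stepLabel_telescope hτ hi (fun j => label (c j)) h1 h2
  have hlt : ∀ i j, i < j → j ≤ M → τ i < τ j := fun i j hij hj => htm (by
    simp only [Fin.mk_lt_mk]; omega)
  refine ⟨_, label (c 0), fun j => σ₀ (e j), fun j => t₀ (e j), ⟨_, rfl⟩, fun j => ?_, fun j => ?_,
    fun i j hij => ?_, fun x hx => ?_, ?_⟩
  · have hne := (e j).2
    revert hne
    simp only [σ₀]
    cases c ((e j).1 + 1) <;> cases c (e j).1 <;> simp [label]
  · have hj := (e j).1.2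
    exact ⟨hτ0.symm.trans_lt (hlt _ _ (by omega) (by omega)),
      (hlt _ _ (by omega) le_rfl).trans_eq hτM⟩
  · refine e.injective (Subtype.ext (Fin.ext ?_))
    have hi := (e i).1.2
    have hj := (e j).1.2
    rcases lt_trichotomy ((e i).1 : ℕ) (e j).1 with hc | hc | hc
    · exact absurd hij (hlt _ _ (by omega) (by omega)).ne
    · exact hc
    · exact absurd hij (hlt _ _ (by omega) (by omega)).ne'
  · obtain ⟨i, hi, h1, h2⟩ := exists_mem_Ico_of_partition (τ := τ) (M := M) (hτ0.trans_le hx.1)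
      (hτM ▸ hx.2)
    exact ⟨_, hval x i hi h1 h2⟩
  · have hall : ∀ᵐ x ∂volume, ∀ i : ℕ, x ≠ τ i ∧ ∀ hi : i < M, x ∈ Ioo (τ i) (τ (i + 1)) →
        u x ∈ disc (axis v₁ v₂ (c i)) R := by
      rw [ae_all_iff]
      intro i
      have hne : ∀ᵐ x : ℝ, x ≠ τ i := by simp [ae_iff]
      refine hne.and ?_
      by_cases hi : i < M
      · have := (ae_restrict_iff' measurableSet_Ioo).1 (hc i hi)
        filter_upwards [this] with x hx hi' hxi
        have e1 : t (Fin.castSucc ⟨i, hi⟩) = τ i := congrArg t (Fin.ext (by simp; omega))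
        have e2 : t (Fin.succ ⟨i, hi⟩) = τ (i + 1) := congrArg t (Fin.ext (by simp; omega))
        rw [e1, e2] at hx
        exact hx hxi
      · exact Eventually.of_forall fun x h => absurd h hi
    filter_upwards [ae_restrict_of_ae hall, ae_restrict_mem measurableSet_Ioo] with x hx hxI
    obtain ⟨i, hi, h1, h2⟩ := exists_mem_Ico_of_partition (τ := τ) (M := M) (hτ0.trans_le hxI.1.le)
      (hτM ▸ hxI.2)
    exact ⟨c i, hval x i hi h1 h2, (hx i).2 hi ⟨lt_of_le_of_ne h1 (hx i).1.symm, h2⟩⟩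

theorem HasLabel.totalVar_eq (h : Admissible v₁ v₂ R) {J : ℕ} {σ t : Fin J → ℝ}
    (hu : HasLabel v₁ v₂ R u c₀ σ t) (hσ : ∀ j, σ j = 1 ∨ σ j = -1) (ht : ∀ j, t j ∈ I)
    (hinj : Function.Injective t) : totalVar (anis v₁ v₂ R u) = J * ‖v₂ - v₁‖ₑ := by
  rw [totalVar_step (hu.anis_ae_eq h) ht hinj]
  have : ∀ j, ‖σ j • (v₂ - v₁)‖ₑ = ‖v₂ - v₁‖ₑ := fun j => by
    rcases hσ j with hj | hj
    · rw [hj, one_smul]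
    · rw [hj, neg_one_smul, enorm_neg]
  simp [this]

end SpinChain

namespace SpinChain

variable {α : ℝ} {v₁ v₂ : R3} {R : ℝ}

/-! ### Recovery sequences -/

/-- Jensen's inequality for `f_hom`. -/
theorem fHom_average_le (hα : 0 < α) (h : Admissible v₁ v₂ R) {u : Linf} {a b : ℝ} (hab : a < b)
    (hI : Ioo a b ⊆ I) {d : Bool}
    (hu : ∀ᵐ x ∂volume.restrict (Ioo a b), u x ∈ disc (axis v₁ v₂ d) R) :
    (⨍ x in Ioo a b, u x) ∈ disc (axis v₁ v₂ d) R ∧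
      fHom α v₁ v₂ R (⨍ x in Ioo a b, u x) ≤ ⨍ x in Ioo a b, fHom α v₁ v₂ R (u x) := by
  have h0 : volume (Ioo a b) ≠ 0 := by simp [hab]
  have htop : volume (Ioo a b) ≠ ⊤ := by simp
  have hint := integrableOn_of_linf u hI
  have hfint : IntegrableOn (fun x => fHom α v₁ v₂ R (u x)) (Ioo a b) :=
    integrableOn_fHom hα h hI (hu.mono fun x hx => Admissible.disc_subset_hull d hx)
  refine ⟨(convex_convexHull ℝ _).set_average_mem (h.isCompact_disc d).isClosed h0 htop hu hint, ?_⟩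
  have hpair := (convex_epigraph hα h).set_average_mem (isClosed_epigraph hα h) h0 htop
    (f := fun x => (u x, fHom α v₁ v₂ R (u x)))
    (hu.mono fun x hx => ⟨Admissible.disc_subset_hull d hx, le_rfl⟩) (hint.prodMk hfint)
  rw [setAverage_eq, integral_pair hint hfint] at hpair
  have := hpair.2
  rw [setAverage_eq, setAverage_eq]
  exact this

/-- On an interval where `u` takes values in a single disc there is a chain in the corresponding
circle whose mean is nearly the mean of `u`, and whose energy is nearly at most that of `u`, for all
small spacings. -/
theorem exists_pattern (hα : 0 < α) (h : Admissible v₁ v₂ R) {u : Linf} {a b : ℝ} (hab : a < b)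
    (hI : Ioo a b ⊆ I) {d : Bool}
    (hu : ∀ᵐ x ∂volume.restrict (Ioo a b), u x ∈ disc (axis v₁ v₂ d) R) {ε : ℝ} (hε : 0 < ε) :
    ∃ (C : ℝ) (p : ℤ → R3), 0 ≤ C ∧ (∀ i, p i ∈ circle (axis v₁ v₂ d) R) ∧ ∀ l : ℝ, 0 < l →
      ‖l • ∑ i ∈ Finset.Ico ⌈a / l⌉ ⌈b / l⌉, p i - ∫ x in Ioo a b, u x‖ ≤ ε * (b - a) + C * l ∧
      l * ∑ i ∈ Finset.Ico ⌈a / l⌉ ⌈b / l⌉, bond α p i ≤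
        (∫ x in Ioo a b, fHom α v₁ v₂ R (u x)) + ε * (b - a) + C * l := by
  obtain ⟨hz, hf⟩ := fHom_average_le hα h hab hI hu
  set z := ⨍ x in Ioo a b, u x with hzdef
  have hba : 0 < b - a := sub_pos.2 hab
  have hvol : volume.real (Ioo a b) = b - a := by rw [Real.volume_real_Ioo_of_le hab.le]
  have hzint : (b - a) • z = ∫ x in Ioo a b, u x := by
    rw [hzdef, setAverage_eq, hvol, smul_inv_smul₀ hba.ne']
  have hfint : (b - a) * fHom α v₁ v₂ R z ≤ ∫ x in Ioo a b, fHom α v₁ v₂ R (u x) := by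
    have := mul_le_mul_of_nonneg_left hf hba.le
    rwa [setAverage_eq, hvol, smul_eq_mul, mul_inv_cancel_left₀ hba.ne'] at this
  have hS := (h.circle_subset_sphere d)
  have hmem := mem_energySet_circle hα h d hz (mk_fHom_mem hα h (Admissible.disc_subset_hull d hz))
  obtain ⟨x, hx, hdist⟩ := Metric.mem_closure_iff.1 hmem ε hε
  obtain ⟨C, p, hC, hp, hsum⟩ := exists_chain_of_cellPair hα hS hx
  rw [Prod.dist_eq, max_lt_iff, dist_eq_norm, Real.dist_eq] at hdist
  have hbd := cellPairs_subset hα hS hx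
  have hx1 : ‖x.1‖ ≤ 1 := by simpa using hbd.1
  have hx2 : |x.2| ≤ 1 + α := abs_le.2 ⟨hbd.2.1, hbd.2.2⟩
  refine ⟨C + 2 * (1 + α), p, by positivity, hp, fun l hl => ?_⟩
  have hle : ⌈a / l⌉ ≤ ⌈b / l⌉ := Int.ceil_mono (by gcongr)
  obtain ⟨h1, h2⟩ := hsum _ _ hle
  have hn : |l * ((⌈b / l⌉ - ⌈a / l⌉ : ℤ) : ℝ) - (b - a)| ≤ 2 * l := by
    have ha := abs_le.1 (abs_mul_ceil_sub_le hl a)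
    have hb := abs_le.1 (abs_mul_ceil_sub_le hl b)
    push_cast
    rw [abs_le]
    constructor <;> linarith
  constructor
  · have e1 : ‖l • ∑ i ∈ Finset.Ico ⌈a / l⌉ ⌈b / l⌉, p i -
        (l * ((⌈b / l⌉ - ⌈a / l⌉ : ℤ) : ℝ)) • x.1‖ ≤ l * C := by
      rw [← smul_smul, ← smul_sub, norm_smul, Real.norm_eq_abs, abs_of_pos hl]
      gcongr
    have e2 : ‖(l * ((⌈b / l⌉ - ⌈a / l⌉ : ℤ) : ℝ)) • x.1 - (b - a) • x.1‖ ≤ 2 * l * 1 := by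
      rw [← sub_smul, norm_smul]
      exact mul_le_mul hn hx1 (norm_nonneg _) (by positivity)
    have e3 : ‖(b - a) • x.1 - (b - a) • z‖ ≤ (b - a) * ε := by
      rw [← smul_sub, norm_smul, Real.norm_eq_abs, abs_of_pos hba, norm_sub_rev]
      have := hdist.1.le
      gcongr
    rw [← hzint]
    have e4 := norm_sub_le_norm_sub_add_norm_sub (l • ∑ i ∈ Finset.Ico ⌈a / l⌉ ⌈b / l⌉, p i)
      ((l * ((⌈b / l⌉ - ⌈a / l⌉ : ℤ) : ℝ)) • x.1) ((b - a) • z)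
    have e5 := norm_sub_le_norm_sub_add_norm_sub ((l * ((⌈b / l⌉ - ⌈a / l⌉ : ℤ) : ℝ)) • x.1)
      ((b - a) • x.1) ((b - a) • z)
    have : 0 ≤ α * l := by positivity
    nlinarith
  · have e1 := mul_le_mul_of_nonneg_left (abs_le.1 h2).2 hl.le
    have e2 : |(l * ((⌈b / l⌉ - ⌈a / l⌉ : ℤ) : ℝ) - (b - a)) * x.2| ≤ 2 * l * (1 + α) := by
      rw [abs_mul]
      exact mul_le_mul hn hx2 (abs_nonneg _) (by positivity)
    have e3 := (abs_le.1 e2).2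
    have e4 : (b - a) * x.2 ≤ (b - a) * (fHom α v₁ v₂ R z + ε) := by
      have := (abs_lt.1 hdist.2).1
      simp only at this
      exact mul_le_mul_of_nonneg_left (by linarith) hba.le
    nlinarith

/-- Patterns on the intervals of a partition are glued to a chain that satisfies the boundary
condition, because its first two and its last two spins coincide. -/
theorem exists_glued_chain {τ : ℕ → ℝ} (hτ : Monotone τ) {M : ℕ} (hτ0 : τ 0 = 0) (hτM : τ M = 1)
    {b : ℕ → Bool} {p : ℕ → ℤ → R3} (hp : ∀ q < M, ∀ i, p q i ∈ circle (axis v₁ v₂ (b q)) R) {J : ℕ}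
    {c₀ : ℝ} {σ t : Fin J → ℝ}
    (hlab : ∀ q < M, ∀ x ∈ Ico (τ q) (τ (q + 1)), stepLabel c₀ σ t x = label (b q)) {l : ℝ}
    (hl : 0 < l) (hl2 : 2 * l ≤ 1) (htl : ∀ j, l < t j ∧ t j ≤ 1 - 2 * l) :
    ∃ s : ℤ → R3, (∀ i, s i ∈ circles v₁ v₂ R) ∧ s 0 = s 1 ∧ s (⌊1 / l⌋ - 1) = s ⌊1 / l⌋ ∧
      (∀ q < M, ∀ i : ℤ, τ q ≤ l * i → l * i < τ (q + 1) → 1 ≤ i → i ≤ ⌊1 / l⌋ - 1 →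
        s i = p q i) ∧
      ∀ i : ℤ, 0 ≤ i → i ≤ ⌊1 / l⌋ →
        ∃ d, stepLabel c₀ σ t (l * i) = label d ∧ s i ∈ circle (axis v₁ v₂ d) R := by
  have hN : 2 ≤ ⌊1 / l⌋ := by
    rw [Int.le_floor, le_div_iff₀ hl]; exact_mod_cast hl2
  have hN1 : l * ⌊1 / l⌋ ≤ 1 := by
    rw [← le_div_iff₀' hl]; exact Int.floor_le _
  have hN2 : 1 < l * ⌊1 / l⌋ + l := by
    have := Int.lt_floor_add_one (1 / l)
    rw [div_lt_iff₀' hl] at this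
    linarith
  have hQ : ∀ y : ℝ, ∃ q, y ∈ Ico (0 : ℝ) 1 → q < M ∧ τ q ≤ y ∧ y < τ (q + 1) := by
    intro y
    by_cases hy : y ∈ Ico (0 : ℝ) 1
    · obtain ⟨q, hq⟩ := exists_mem_Ico_of_partition (τ := τ) (M := M) (hτ0.trans_le hy.1)
        (hτM ▸ hy.2)
      exact ⟨q, fun _ => hq⟩
    · exact ⟨0, fun h => absurd h hy⟩
  choose Q hQ using hQ
  let cl : ℤ → ℤ := fun i => max 1 (min i (⌊1 / l⌋ - 1))
  have hcl1 : ∀ i, 1 ≤ cl i := fun i => le_max_left _ _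
  have hcl2 : ∀ i, cl i ≤ ⌊1 / l⌋ - 1 := fun i => max_le (by omega) (min_le_right _ _)
  have hclid : ∀ i, 1 ≤ i → i ≤ ⌊1 / l⌋ - 1 → cl i = i := fun i h1 h2 => by
    simp only [cl]; omega
  have hclI : ∀ i, l * cl i ∈ Ico (0 : ℝ) 1 := fun i => by
    have h1 : (1 : ℝ) ≤ cl i := by exact_mod_cast hcl1 i
    have h2 : (cl i : ℝ) ≤ ⌊1 / l⌋ - 1 := by exact_mod_cast hcl2 i
    have h3 := mul_le_mul_of_nonneg_left h2 hl.le
    exact ⟨by positivity, by nlinarith⟩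
  refine ⟨fun i => p (Q (l * cl i)) (cl i), fun i => ?_, ?_, ?_, fun q hq i h1 h2 h3 h4 => ?_,
    fun i hi0 hiN => ⟨b (Q (l * cl i)), ?_, hp _ (hQ _ (hclI i)).1 _⟩⟩
  · exact Admissible.circle_subset_circles _ (hp _ (hQ _ (hclI i)).1 _)
  · have : cl 0 = cl 1 := by simp only [cl]; omega
    simp only [this]
  · have : cl (⌊1 / l⌋ - 1) = cl ⌊1 / l⌋ := by simp only [cl]; omega
    simp only [this]
  · have hI := hQ _ (hclI i)
    simp only
    rw [hclid i h3 h4] at hI ⊢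
    have hqq : Q (l * i) = q := by
      rcases lt_trichotomy (Q (l * i)) q with hlt | heq | hlt
      · exact absurd (hI.2.2.trans_le ((hτ hlt).trans h1)) (lt_irrefl _)
      · exact heq
      · exact absurd (h2.trans_le ((hτ hlt).trans hI.2.1)) (lt_irrefl _)
    rw [hqq]
  · obtain ⟨hq, h1, h2⟩ := hQ _ (hclI i)
    rw [← hlab _ hq _ ⟨h1, h2⟩]
    refine stepLabel_congr fun j => ?_
    obtain ⟨ht1, ht2⟩ := htl j
    -- moving the end points `0` and `N` of the lattice inwards does not cross a jump
    rcases eq_or_ne i 0 with rfl | hi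
    · have : cl 0 = 1 := by simp only [cl]; omega
      rw [this]
      push_cast
      constructor <;> intro hj <;> linarith
    · rcases eq_or_ne i ⌊1 / l⌋ with rfl | hi'
      · have : cl ⌊1 / l⌋ = ⌊1 / l⌋ - 1 := by simp only [cl]; omega
        rw [this]
        push_cast
        constructor <;> intro hj <;> nlinarith
      · rw [hclid i (by omega) (by omega)]

end SpinChain

namespace SpinChain

variable {α : ℝ} {v₁ v₂ : R3} {R : ℝ}

theorem norm_sum_sub_le_of_eq_off {s s' : ℤ → R3} (hs : ∀ i, ‖s i‖ ≤ 1) (hs' : ∀ i, ‖s' i‖ ≤ 1)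
    (F B : Finset ℤ) (hB : ∀ i ∈ F, i ∉ B → s i = s' i) :
    ‖∑ i ∈ F, s i - ∑ i ∈ F, s' i‖ ≤ 2 * B.card := by
  classical
  rw [← Finset.sum_sub_distrib]
  have h1 : ∀ i ∈ F, ‖s i - s' i‖ ≤ if i ∈ B then 2 else 0 := by
    intro i hi
    split_ifs with hiB
    · linarith [norm_sub_le (s i) (s' i), hs i, hs' i]
    · rw [hB i hi hiB, sub_self, norm_zero]
  refine (norm_sum_le_of_le _ h1).trans ?_
  rw [← Finset.sum_filter, Finset.sum_const, nsmul_eq_mul, mul_comm]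
  gcongr
  intro i hi
  exact (Finset.mem_filter.1 hi).2

theorem sum_setIntegral_partition {E : Type*} [NormedAddCommGroup E] [NormedSpace ℝ E]
    {f : ℝ → E} (hf : IntegrableOn f I) {τ : ℕ → ℝ} (hτ : Monotone τ) {M : ℕ} (hτ0 : τ 0 = 0)
    (hτM : τ M = 1) :
    ∑ q ∈ Finset.range M, ∫ x in Ioo (τ q) (τ (q + 1)), f x = ∫ x in I, f x := by
  have h1 : ∀ a b, a ≤ b → ∫ x in Ioo a b, f x = ∫ x in a..b, f x := fun a b hab => by
    rw [intervalIntegral.integral_of_le hab, integral_Ioc_eq_integral_Ioo]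
  rw [h1 0 1 zero_le_one, Finset.sum_congr rfl fun q _ => h1 _ _ (hτ q.le_succ), ← hτ0, ← hτM]
  refine intervalIntegral.sum_integral_adjacent_intervals fun q hq => ?_
  rw [intervalIntegrable_iff_integrableOn_Ioo_of_le (hτ q.le_succ)]
  refine hf.mono_set (Ioo_subset_Ioo ?_ ?_)
  · rw [← hτ0]; exact hτ (Nat.zero_le _)
  · rw [← hτM]; exact hτ hq

/-- Two functions whose integrals over the intervals of a fine partition nearly agree are close
when tested against functions of small oscillation. -/
theorem abs_integral_inner_sub_le {τ : ℕ → ℝ} (hτ : Monotone τ) {M : ℕ} (hτ0 : τ 0 = 0)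
    (hτM : τ M = 1) {ε : ℝ} (hmesh : ∀ q < M, τ (q + 1) - τ q ≤ ε) {u w : ℝ → R3}
    (hu : IntegrableOn u I) (hw : IntegrableOn w I) (hu1 : ∀ᵐ x ∂volI, ‖u x‖ ≤ 1)
    (hw1 : ∀ᵐ x ∂volI, ‖w x‖ ≤ 1)
    (hsum : ∑ q ∈ Finset.range M,
      ‖(∫ x in Ioo (τ q) (τ (q + 1)), w x) - ∫ x in Ioo (τ q) (τ (q + 1)), u x‖ ≤ ε)
    {g : ℝ → R3} (hg : Continuous g) {θ B : ℝ} (hB : ∀ x, ‖g x‖ ≤ B)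
    (hθ : ∀ x y, |x - y| ≤ ε → ‖g x - g y‖ ≤ θ) :
    |(∫ x in I, ⟪g x, w x⟫_ℝ) - ∫ x in I, ⟪g x, u x⟫_ℝ| ≤ 2 * θ + B * ε := by
  have hB0 : 0 ≤ B := (norm_nonneg _).trans (hB 0)
  have hε0 : 0 ≤ ε := (Finset.sum_nonneg fun _ _ => norm_nonneg _).trans hsum
  have hθ0 : 0 ≤ θ := (norm_nonneg _).trans (hθ 0 0 (by simpa using hε0))
  have hd : IntegrableOn (fun x => w x - u x) I := Integrable.sub hw hu
  have hin : ∀ f : ℝ → R3, IntegrableOn f I → ∀ k : ℝ → R3, Continuous k →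
      (∃ D, ∀ x, ‖k x‖ ≤ D) → IntegrableOn (fun x => ⟪k x, f x⟫_ℝ) I := by
    rintro f hf k hk ⟨D, hD⟩
    refine Integrable.mono' (hf.norm.const_mul D)
      (hk.aestronglyMeasurable.inner hf.aestronglyMeasurable) (Eventually.of_forall fun x => ?_)
    refine (norm_inner_le_norm _ _).trans ?_
    have := hD x
    gcongr
  rw [← integral_sub (hin w hw g hg ⟨B, hB⟩) (hin u hu g hg ⟨B, hB⟩)]
  simp only [← inner_sub_right]
  rw [← sum_setIntegral_partition (hin _ hd g hg ⟨B, hB⟩) hτ hτ0 hτM]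
  have hcell : ∀ q ∈ Finset.range M, |∫ x in Ioo (τ q) (τ (q + 1)), ⟪g x, w x - u x⟫_ℝ| ≤
      2 * θ * (τ (q + 1) - τ q) + B *
        ‖(∫ x in Ioo (τ q) (τ (q + 1)), w x) - ∫ x in Ioo (τ q) (τ (q + 1)), u x‖ := by
    intro q hq
    rw [Finset.mem_range] at hq
    have hsub : Ioo (τ q) (τ (q + 1)) ⊆ I := by
      refine Ioo_subset_Ioo ?_ ?_
      · rw [← hτ0]; exact hτ (Nat.zero_le _)
      · rw [← hτM]; exact hτ hq
    have h1 : ∫ x in Ioo (τ q) (τ (q + 1)), ⟪g x, w x - u x⟫_ℝ =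
        (∫ x in Ioo (τ q) (τ (q + 1)), ⟪g x - g (τ q), w x - u x⟫_ℝ) +
          ⟪g (τ q), (∫ x in Ioo (τ q) (τ (q + 1)), w x) -
            ∫ x in Ioo (τ q) (τ (q + 1)), u x⟫_ℝ := by
      rw [← integral_sub (hw.mono_set hsub) (hu.mono_set hsub),
        ← integral_inner (hd.mono_set hsub), ← integral_add]
      · refine integral_congr_ae (Eventually.of_forall fun x => ?_)
        simp only [inner_sub_left, sub_add_cancel]
      · refine (hin _ hd (fun x => g x - g (τ q)) (by fun_prop) ⟨B + B, fun x => ?_⟩).mono_set hsub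
        exact (norm_sub_le _ _).trans (add_le_add (hB _) (hB _))
      · exact (hin _ hd (fun _ => g (τ q)) continuous_const ⟨B, fun _ => hB _⟩).mono_set hsub
    rw [h1]
    refine (abs_add_le _ _).trans (add_le_add ?_ ?_)
    · rw [← Real.norm_eq_abs]
      have hle := hτ q.le_succ
      refine (norm_setIntegral_le_of_norm_le_const_ae (C := θ * 2) (by simp) ?_).trans ?_
      · filter_upwards [ae_restrict_of_ae_restrict_of_subset hsub hu1,
          ae_restrict_of_ae_restrict_of_subset hsub hw1, ae_restrict_mem measurableSet_Ioo]
          with x hx1 hx2 hx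
        refine (norm_inner_le_norm _ _).trans (mul_le_mul (hθ _ _ ?_) ?_ (norm_nonneg _) hθ0)
        · rw [abs_of_pos (sub_pos.2 hx.1)]
          linarith [hmesh q hq, hx.2]
        · linarith [norm_sub_le (w x) (u x)]
      · rw [Real.volume_real_Ioo_of_le hle]
        linarith
    · rw [← Real.norm_eq_abs]
      exact (norm_inner_le_norm _ _).trans (by have := hB (τ q); gcongr)
  refine (Finset.abs_sum_le_sum_abs _ _).trans ((Finset.sum_le_sum hcell).trans ?_)
  rw [Finset.sum_add_distrib, ← Finset.mul_sum, ← Finset.mul_sum, Finset.sum_range_sub, hτ0, hτM]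
  have := mul_le_mul_of_nonneg_left hsum hB0
  linarith

/-- A partition of `I` into short intervals avoiding a given finite set. -/
theorem exists_fine_partition (F : Finset ℝ) {ε : ℝ} (hε : 0 < ε) :
    ∃ (M : ℕ) (τ : ℕ → ℝ), Monotone τ ∧ τ 0 = 0 ∧ τ M = 1 ∧ (∀ q < M, τ q < τ (q + 1)) ∧
      (∀ q < M, ∀ x ∈ F, x ∉ Ioo (τ q) (τ (q + 1))) ∧ ∀ q < M, τ (q + 1) - τ q ≤ ε := by
  classical
  obtain ⟨K, hK⟩ := exists_nat_gt (1 / ε)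
  have hK0 : (0 : ℝ) < K := (by positivity : 0 < 1 / ε).trans hK
  obtain ⟨M, τ, -, hτ, hτ0, hτM, hlt, hcut⟩ := exists_partition
    (F ∪ (Finset.range (K + 1)).image fun i : ℕ => (i : ℝ) / K)
  refine ⟨M, τ, hτ, hτ0, hτM, hlt, fun q hq x hx => hcut q hq x (Finset.mem_union_left _ hx),
    fun q hq => ?_⟩
  by_contra! hlong
  have hKε : 1 / (K : ℝ) < ε := by
    rw [div_lt_iff₀ hK0]; rw [div_lt_iff₀ hε] at hK; linarith
  have hq0 : 0 ≤ τ q := by rw [← hτ0]; exact hτ (Nat.zero_le _)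
  have hq1 : τ (q + 1) ≤ 1 := by rw [← hτM]; exact hτ hq
  have h1 := Nat.lt_floor_add_one (K * τ q)
  have h2 := Nat.floor_le (mul_nonneg hK0.le hq0)
  have hr : ((⌊K * τ q⌋₊ + 1 : ℕ) : ℝ) / K < τ (q + 1) := by
    refine lt_of_le_of_lt (b := τ q + 1 / K) ?_ (by linarith)
    rw [div_le_iff₀ hK0]
    push_cast
    rw [add_mul, one_div_mul_cancel hK0.ne']
    linarith
  refine hcut q hq (((⌊K * τ q⌋₊ + 1 : ℕ) : ℝ) / K) (Finset.mem_union_right _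
    (Finset.mem_image_of_mem _ ?_)) ⟨?_, hr⟩
  · rw [Finset.mem_range]
    have h3 := hr.trans_le hq1
    rw [div_lt_one hK0] at h3
    have : ⌊K * τ q⌋₊ + 1 < K := by exact_mod_cast h3
    omega
  · rw [lt_div_iff₀ hK0]
    push_cast
    linarith

/-- Chains of small spacing that approximate an element of `𝔇`: the energy is nearly at most the
bulk term, the label is that of the function, and the chain is close in the weak-star sense. -/
theorem exists_approx_chain (hα : 0 < α) (h : Admissible v₁ v₂ R) {u : Linf} {J : ℕ} {c₀ : ℝ}
    {σ t : Fin J → ℝ} (ht : ∀ j, t j ∈ I)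
    (hlab : ∀ x ∈ Ico (0 : ℝ) 1, ∃ b, stepLabel c₀ σ t x = label b)
    (hu : HasLabel v₁ v₂ R u c₀ σ t) {ε : ℝ} (hε : 0 < ε) :
    ∃ δ > 0, ∀ l, 0 < l → l < δ → ∃ s : ℤ → R3, (∀ i, s i ∈ circles v₁ v₂ R) ∧
      IsChain v₁ v₂ R l s ∧ bulkEnergy α l s ≤ homEnergy α v₁ v₂ R u + ε ∧
      (∀ i : ℤ, 0 ≤ i → i ≤ ⌊1 / l⌋ →
        ∃ d, stepLabel c₀ σ t (l * i) = label d ∧ s i ∈ circle (axis v₁ v₂ d) R) ∧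
      ∀ (g : ℝ → R3) (θ B : ℝ), Continuous g → (∀ x, ‖g x‖ ≤ B) →
        (∀ x y, |x - y| ≤ ε → ‖g x - g y‖ ≤ θ) →
        |(∫ x in I, ⟪g x, gridFun l s x⟫_ℝ) - ∫ x in I, ⟪g x, u x⟫_ℝ| ≤ 2 * θ + B * ε := by
  classical
  obtain ⟨M, τ, hτ, hτ0, hτM, hlt, hcut, hmesh⟩ := exists_fine_partition (Finset.univ.image t) hε
  have hsub : ∀ q < M, Ioo (τ q) (τ (q + 1)) ⊆ I := fun q hq => by
    refine Ioo_subset_Ioo ?_ ?_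
    · rw [← hτ0]; exact hτ (Nat.zero_le _)
    · rw [← hτM]; exact hτ hq
  have hτI : ∀ q < M, τ q ∈ Ico (0 : ℝ) 1 := fun q hq => ⟨by
    rw [← hτ0]; exact hτ (Nat.zero_le _), by rw [← hτM]; exact (hlt q hq).trans_le (hτ hq)⟩
  have hb : ∀ q, ∃ b, q < M → ∀ x ∈ Ico (τ q) (τ (q + 1)), stepLabel c₀ σ t x = label b := by
    intro q
    by_cases hq : q < M
    · obtain ⟨b, hb⟩ := hlab _ (hτI q hq)
      refine ⟨b, fun _ x hx => ?_⟩
      rw [← hb]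
      refine stepLabel_congr fun j => ⟨fun hj => ?_, fun hj => hj.trans hx.1⟩
      by_contra hj'
      exact hcut q hq (t j) (by simp) ⟨not_le.1 hj', hj.trans_lt hx.2⟩
    · exact ⟨false, fun h => absurd h hq⟩
  choose b hb using hb
  have hdisc : ∀ q < M, ∀ᵐ x ∂volume.restrict (Ioo (τ q) (τ (q + 1))),
      u x ∈ disc (axis v₁ v₂ (b q)) R := fun q hq => by
    filter_upwards [ae_restrict_of_ae_restrict_of_subset (hsub q hq) hu,
      ae_restrict_mem measurableSet_Ioo] with x ⟨d, hd, hx⟩ hxq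
    rw [hb q hq x ⟨hxq.1.le, hxq.2⟩] at hd
    rwa [label_injective hd]
  have hε2 : 0 < ε / 2 := half_pos hε
  have hpat : ∀ q, ∃ (C : ℝ) (p : ℤ → R3), 0 ≤ C ∧
      (q < M → ∀ i, p i ∈ circle (axis v₁ v₂ (b q)) R) ∧ (q < M → ∀ l : ℝ, 0 < l →
      ‖l • ∑ i ∈ Finset.Ico ⌈τ q / l⌉ ⌈τ (q + 1) / l⌉, p i -
        ∫ x in Ioo (τ q) (τ (q + 1)), u x‖ ≤ ε / 2 * (τ (q + 1) - τ q) + C * l ∧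
      l * ∑ i ∈ Finset.Ico ⌈τ q / l⌉ ⌈τ (q + 1) / l⌉, bond α p i ≤
        (∫ x in Ioo (τ q) (τ (q + 1)), fHom α v₁ v₂ R (u x)) +
          ε / 2 * (τ (q + 1) - τ q) + C * l) := by
    intro q
    by_cases hq : q < M
    · obtain ⟨C, p, hC, hp, hl⟩ := exists_pattern hα h (hlt q hq) (hsub q hq) (hdisc q hq) hε2
      exact ⟨C, p, hC, fun _ => hp, fun _ => hl⟩
    · exact ⟨0, 0, le_rfl, fun h => absurd h hq, fun h => absurd h hq⟩
  choose C p hC hp hest using hpat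
  set D : ℝ := ∑ q ∈ Finset.range M, (C q + 6 + 12 * (1 + α)) + 2 * (1 + α) with hD
  have hD0 : 0 < D := by
    have : 0 ≤ ∑ q ∈ Finset.range M, (C q + 6 + 12 * (1 + α)) :=
      Finset.sum_nonneg fun q _ => by have := hC q; positivity
    positivity
  obtain ⟨δ, hδ, hδt⟩ : ∃ δ > 0, ∀ l, 0 < l → l < δ → ∀ j, l < t j ∧ t j ≤ 1 - 2 * l := by
    have hev : ∀ᶠ l in 𝓝 (0 : ℝ), ∀ j, l < t j ∧ t j ≤ 1 - 2 * l := by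
      rw [eventually_all]
      intro j
      have h1 : ∀ᶠ l in 𝓝 (0 : ℝ), l < t j := eventually_lt_nhds (ht j).1
      have h2 : ∀ᶠ l in 𝓝 (0 : ℝ), l < (1 - t j) / 2 :=
        eventually_lt_nhds (by linarith [(ht j).2])
      filter_upwards [h1, h2] with l h1 h2
      exact ⟨h1, by linarith⟩
    obtain ⟨δ, hδ, hball⟩ := Metric.eventually_nhds_iff.1 hev
    exact ⟨δ, hδ, fun l h1 h2 => hball (by rwa [Real.dist_eq, sub_zero, abs_of_pos h1])⟩
  refine ⟨min δ (min (1 / 2) (ε / 2 / D)), by positivity, fun l hl hlδ => ?_⟩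
  rw [lt_min_iff, lt_min_iff, lt_div_iff₀ hD0] at hlδ
  obtain ⟨s, hs, hs0, hsN, hsp, hslab⟩ := exists_glued_chain hτ hτ0 hτM hp hb hl
    (by linarith [hlδ.2.1]) (hδt l hl hlδ.1)
  have hs1 : ∀ i, ‖s i‖ ≤ 1 := fun i => norm_le_of_subset_sphere h.circles_subset_sphere (hs i)
  have hp1 : ∀ q < M, ∀ i, ‖p q i‖ ≤ 1 := fun q hq i =>
    norm_le_of_subset_sphere (h.circle_subset_sphere _) (hp q hq i)
  have hblk : ∀ q < M, ∀ i ∈ Finset.Ico ⌈τ q / l⌉ ⌈τ (q + 1) / l⌉,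
      τ q ≤ l * i ∧ l * i < τ (q + 1) ∧ 0 ≤ i ∧ i ≤ ⌊1 / l⌋ := by
    intro q hq i hi
    rw [Finset.mem_Ico, Int.ceil_le, Int.lt_ceil, div_le_iff₀' hl, lt_div_iff₀' hl] at hi
    refine ⟨hi.1, hi.2, ?_, ?_⟩
    · have : 0 ≤ l * i := (hτI q hq).1.trans hi.1
      exact_mod_cast (mul_nonneg_iff_of_pos_left hl).1 this
    · rw [Int.le_floor, le_div_iff₀' hl]
      exact hi.2.le.trans (by rw [← hτM]; exact hτ hq)
  have hsum1 : ∀ q < M, ‖∑ i ∈ Finset.Ico ⌈τ q / l⌉ ⌈τ (q + 1) / l⌉, s i -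
      ∑ i ∈ Finset.Ico ⌈τ q / l⌉ ⌈τ (q + 1) / l⌉, p q i‖ ≤ 4 := by
    intro q hq
    refine (norm_sum_sub_le_of_eq_off hs1 (hp1 q hq) _ {0, ⌊1 / l⌋} fun i hi hiB => ?_).trans ?_
    · obtain ⟨h1, h2, h3, h4⟩ := hblk q hq i hi
      simp only [Finset.mem_insert, Finset.mem_singleton, not_or] at hiB
      exact hsp q hq i h1 h2 (by omega) (by omega)
    · have : ((({0, ⌊1 / l⌋} : Finset ℤ).card : ℕ) : ℝ) ≤ 2 := by
        exact_mod_cast Finset.card_le_two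
      linarith
  have hsum2 : ∀ q < M, |∑ i ∈ Finset.Ico ⌈τ q / l⌉ ⌈τ (q + 1) / l⌉, bond α s i -
      ∑ i ∈ Finset.Ico ⌈τ q / l⌉ ⌈τ (q + 1) / l⌉, bond α (p q) i| ≤ 12 * (1 + α) := by
    intro q hq
    refine (abs_sum_bond_sub_le hα hs1 (hp1 q hq) _ {0, ⌊1 / l⌋ - 2, ⌊1 / l⌋ - 1, ⌊1 / l⌋,
      ⌈τ (q + 1) / l⌉ - 2, ⌈τ (q + 1) / l⌉ - 1} fun i hi hiB => ?_).trans ?_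
    · simp only [Finset.mem_insert, Finset.mem_singleton, not_or] at hiB
      have hmem : ∀ k : ℤ, 0 ≤ k → k ≤ 2 → s (i + k) = p q (i + k) := fun k hk0 hk2 => by
        have hik : i + k ∈ Finset.Ico ⌈τ q / l⌉ ⌈τ (q + 1) / l⌉ := by
          rw [Finset.mem_Ico] at hi ⊢; omega
        obtain ⟨-, -, h3, h4⟩ := hblk q hq i hi
        obtain ⟨h1', h2', -, -⟩ := hblk q hq _ hik
        exact hsp q hq _ h1' h2' (by omega) (by omega)
      refine ⟨?_, hmem 1 (by norm_num) (by norm_num), hmem 2 (by norm_num) (by norm_num)⟩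
      simpa using hmem 0 le_rfl (by norm_num)
    · have : ((({0, ⌊1 / l⌋ - 2, ⌊1 / l⌋ - 1, ⌊1 / l⌋, ⌈τ (q + 1) / l⌉ - 2,
          ⌈τ (q + 1) / l⌉ - 1} : Finset ℤ).card : ℕ) : ℝ) ≤ 6 := by
        exact_mod_cast Finset.card_le_six
      nlinarith
  have hDl : ∑ q ∈ Finset.range M, (C q + 6 + 12 * (1 + α)) * l + 2 * (1 + α) * l ≤ ε / 2 := by
    rw [← Finset.sum_mul, ← add_mul, ← hD]
    linarith [hlδ.2.2]
  have hlen : ∑ q ∈ Finset.range M, ε / 2 * (τ (q + 1) - τ q) = ε / 2 := by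
    rw [← Finset.mul_sum, Finset.sum_range_sub, hτ0, hτM]; ring
  have hu1 : ∀ᵐ x ∂volI, ‖u x‖ ≤ 1 := by
    filter_upwards [hu] with x ⟨d, _, hx⟩
    exact h.norm_le_one_of_mem_hull (Admissible.disc_subset_hull d hx)
  refine ⟨s, hs, ⟨fun i _ => hs i, ?_⟩, ?_, hslab, fun g θ B hg hB hθ => ?_⟩
  · rw [← hs0, hsN, real_inner_self_eq_norm_sq, real_inner_self_eq_norm_sq]
    have hnorm : ∀ i, ‖s i‖ = 1 := fun i => by simpa using h.circles_subset_sphere (hs i)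
    rw [hnorm, hnorm]
  · have hbulk := (abs_le.1 (abs_bulkEnergy_sub_le hα hl (by linarith [hlδ.2.1]) hs1)).2
    have hsplit := sum_range_sum_Ico (bond α s) (fun q : ℕ => ⌈τ q / l⌉) M fun q _ =>
      Int.ceil_mono (by have := hτ q.le_succ; gcongr)
    simp only [hτ0, hτM, zero_div, Int.ceil_zero] at hsplit
    rw [← hsplit, Finset.mul_sum] at hbulk
    have hq : ∀ q ∈ Finset.range M,
        l * ∑ i ∈ Finset.Ico ⌈τ q / l⌉ ⌈τ (q + 1) / l⌉, bond α s i ≤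
        (∫ x in Ioo (τ q) (τ (q + 1)), fHom α v₁ v₂ R (u x)) + ε / 2 * (τ (q + 1) - τ q) +
          (C q + 6 + 12 * (1 + α)) * l := by
      intro q hq
      rw [Finset.mem_range] at hq
      have h1 := (abs_le.1 (hsum2 q hq)).2
      have h2 := ((hest q) hq l hl).2
      have h3 := mul_le_mul_of_nonneg_left h1 hl.le
      rw [mul_sub] at h3
      linarith
    have htot := Finset.sum_le_sum hq
    have hfint : IntegrableOn (fun x => fHom α v₁ v₂ R (u x)) I := by
      refine integrableOn_fHom hα h subset_rfl ?_
      filter_upwards [hu] with x ⟨d, _, hx⟩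
      exact Admissible.disc_subset_hull d hx
    rw [Finset.sum_add_distrib, Finset.sum_add_distrib, hlen,
      sum_setIntegral_partition hfint hτ hτ0 hτM] at htot
    change _ ≤ homEnergy α v₁ v₂ R u + ε / 2 + _ at htot
    linarith
  · refine abs_integral_inner_sub_le (w := gridFun l s) hτ hτ0 hτM hmesh
      (integrable_of_linf u) ?_ hu1
      (Eventually.of_forall fun x => hs1 _) ?_ hg hB hθ
    · exact Integrable.of_bound (stronglyMeasurable_gridFun _ _).aestronglyMeasurable 1
        (Eventually.of_forall fun x => hs1 _)
    · have hq : ∀ q ∈ Finset.range M, ‖(∫ x in Ioo (τ q) (τ (q + 1)), gridFun l s x) -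
          ∫ x in Ioo (τ q) (τ (q + 1)), u x‖ ≤
          ε / 2 * (τ (q + 1) - τ q) + (C q + 6 + 12 * (1 + α)) * l := by
        intro q hq
        rw [Finset.mem_range] at hq
        have h1 := norm_setIntegral_gridFun_sub_le hl hs1 (hlt q hq).le
        have h2 := ((hest q) hq l hl).1
        have h3 : ‖l • ∑ i ∈ Finset.Ico ⌈τ q / l⌉ ⌈τ (q + 1) / l⌉, s i -
            l • ∑ i ∈ Finset.Ico ⌈τ q / l⌉ ⌈τ (q + 1) / l⌉, p q i‖ ≤ l * 4 := by
          rw [← smul_sub, norm_smul, Real.norm_eq_abs, abs_of_pos hl]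
          have := hsum1 q hq
          gcongr
        have h4 := norm_add₃_le.trans (add_le_add (add_le_add h1 h3) h2)
        rw [sub_add_sub_cancel, sub_add_sub_cancel] at h4
        have : 0 ≤ α * l := by positivity
        linarith
      have htot := Finset.sum_le_sum hq
      rw [Finset.sum_add_distrib, hlen] at htot
      have : 0 ≤ α * l := by positivity
      linarith

end SpinChain

namespace SpinChain

variable {α : ℝ} {v₁ v₂ : R3} {R : ℝ}

/-- Diagonal argument: if every property `P m` holds eventually, there are indices `φ n → ∞` such
that `P (φ n) n` holds eventually. -/
theorem exists_tendsto_diagonal {P : ℕ → ℕ → Prop} (hP : ∀ m, ∀ᶠ n in atTop, P m n) :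
    ∃ φ : ℕ → ℕ, Tendsto φ atTop atTop ∧ ∀ᶠ n in atTop, P (φ n) n := by
  classical
  refine ⟨fun n => Nat.findGreatest (fun m => P m n) n, tendsto_atTop.2 fun m => ?_, ?_⟩
  · filter_upwards [hP m, eventually_ge_atTop m] with n hn hmn
    exact Nat.le_findGreatest hmn hn
  · filter_upwards [hP 0] with n hn
    exact Nat.findGreatest_spec (P := fun m => P m n) (Nat.zero_le n) hn

/-- The class of a chain with values in the two circles. -/
theorem exists_linf_gridFun (h : Admissible v₁ v₂ R) (l : ℝ) {s : ℤ → R3}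
    (hs : ∀ i, s i ∈ circles v₁ v₂ R) : ∃ w : Linf, w =ᵐ[volI] gridFun l s := by
  have hmem : MemLp (gridFun l s) ⊤ volI :=
    memLp_top_of_bound (stronglyMeasurable_gridFun l s).aestronglyMeasurable 1
      (Eventually.of_forall fun x => norm_le_of_subset_sphere h.circles_subset_sphere (hs _))
  exact ⟨hmem.toLp, hmem.coeFn_toLp⟩

/-- The label of a piecewise constant function that follows the label `stepLabel c₀ σ t` on the
lattice: the jumps move to the next lattice points. -/
theorem HasLabel.of_gridFun {l : ℝ} (hl : 0 < l) {s : ℤ → R3} {w : Linf}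
    (hw : w =ᵐ[volI] gridFun l s) {J : ℕ} {c₀ : ℝ} {σ t : Fin J → ℝ}
    (hs : ∀ i : ℤ, 0 ≤ i → i ≤ ⌊1 / l⌋ →
      ∃ d, stepLabel c₀ σ t (l * i) = label d ∧ s i ∈ circle (axis v₁ v₂ d) R) :
    HasLabel v₁ v₂ R w c₀ σ fun j => l * ⌈t j / l⌉ := by
  filter_upwards [hw, ae_restrict_mem measurableSet_Ioo] with x hx hxI
  have hmem := floor_mem_lattice hl hxI
  rw [lattice, Finset.mem_Icc] at hmem
  obtain ⟨d, hd, hsd⟩ := hs _ hmem.1 hmem.2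
  refine ⟨d, ?_, ?_⟩
  · rw [← hd, stepLabel, stepLabel]
    congr 1
    refine Finset.sum_congr rfl fun j _ => ?_
    have hiff : l * (⌈t j / l⌉ : ℝ) ≤ x ↔ t j ≤ l * (⌊x / l⌋ : ℝ) := by
      rw [← le_div_iff₀' hl, ← div_le_iff₀' hl, ← Int.le_floor, Int.ceil_le]
    simp only [hiff]
  · rw [hx, gridFun]
    exact subset_convexHull ℝ _ hsd

/-- Every element of `𝔇` is the limit of chains with bulk energies asymptotically at most its bulk
term and total variations at most its own. -/
theorem exists_recovery (hα : 0 < α) (h : Admissible v₁ v₂ R) {l : ℕ → ℝ} (hl : ∀ n, 0 < l n)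
    (hl0 : Tendsto l atTop (𝓝 0)) {u : Linf} (hu : u ∈ domainD v₁ v₂ R) :
    ∃ w : ℕ → Linf, LConv v₁ v₂ R w u ∧
      (∀ n, totalVar (anis v₁ v₂ R (w n)) ≤ totalVar (anis v₁ v₂ R u)) ∧
      ∃ s : ℕ → ℤ → R3, (∀ᶠ n in atTop, Represents v₁ v₂ R (l n) (s n) (w n)) ∧
        ∀ ε > 0, ∀ᶠ n in atTop, bulkEnergy α (l n) (s n) ≤ homEnergy α v₁ v₂ R u + ε := by
  classical
  obtain ⟨J, c₀, σ, t, -, hσ, ht, hinj, hlab, hlabel⟩ := exists_hasLabel hu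
  have hpos : ∀ m : ℕ, (0 : ℝ) < 1 / ((m : ℝ) + 1) := fun m => by positivity
  choose δ hδ happrox using fun m : ℕ =>
    exists_approx_chain hα h ht hlab hlabel (hpos m)
  obtain ⟨φ, hφ, hφδ⟩ := exists_tendsto_diagonal (P := fun m n => l n < δ m)
    fun m => hl0.eventually_lt_const (hδ m)
  have hφ0 : Tendsto (fun n => 1 / ((φ n : ℝ) + 1)) atTop (𝓝 0) :=
    tendsto_one_div_add_atTop_nhds_zero_nat.comp hφ
  -- for the finitely many spacings that are too large, the function itself is taken
  have hex : ∀ n, ∃ (w : Linf) (s : ℤ → R3) (t' : Fin J → ℝ), HasLabel v₁ v₂ R w c₀ σ t' ∧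
      (l n < δ (φ n) → (∀ j, t' j = l n * ⌈t j / l n⌉) ∧ Represents v₁ v₂ R (l n) s w ∧
        bulkEnergy α (l n) s ≤ homEnergy α v₁ v₂ R u + 1 / ((φ n : ℝ) + 1) ∧
        ∀ (g : ℝ → R3) (θ B : ℝ), Continuous g → (∀ x, ‖g x‖ ≤ B) →
          (∀ x y, |x - y| ≤ 1 / ((φ n : ℝ) + 1) → ‖g x - g y‖ ≤ θ) →
          |(∫ x in I, ⟪g x, w x⟫_ℝ) - ∫ x in I, ⟪g x, u x⟫_ℝ| ≤
            2 * θ + B * (1 / ((φ n : ℝ) + 1))) := by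
    intro n
    by_cases hn : l n < δ (φ n)
    · obtain ⟨s, hs, hchain, hbulk, hslab, htest⟩ := happrox (φ n) (l n) (hl n) hn
      obtain ⟨w, hw⟩ := exists_linf_gridFun h (l n) hs
      refine ⟨w, s, fun j => l n * ⌈t j / l n⌉, HasLabel.of_gridFun (hl n) hw hslab, fun _ =>
        ⟨fun _ => rfl, ⟨hchain, hw⟩, hbulk, fun g θ B hg hB hθ => ?_⟩⟩
      have hcongr : ∫ x in I, ⟪g x, w x⟫_ℝ = ∫ x in I, ⟪g x, gridFun (l n) s x⟫_ℝ :=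
        integral_congr_ae (hw.mono fun x hx => by simp only [hx])
      rw [hcongr]
      exact htest g θ B hg hB hθ
    · exact ⟨u, 0, t, hlabel, fun h => absurd h hn⟩
  choose w s t' hwlab hw using hex
  have hnorm : ∀ {x : Linf} {t : Fin J → ℝ}, HasLabel v₁ v₂ R x c₀ σ t → ∀ᵐ y ∂volI, ‖x y‖ ≤ 1 :=
    fun hx => hx.mono fun y ⟨d, _, hy⟩ =>
      h.norm_le_one_of_mem_hull (Admissible.disc_subset_hull d hy)
  have hweak : WeakStar w u := by
    refine weakStar_of_continuous (fun n => hnorm (hwlab n)) (hnorm hlabel) fun g hg hgc => ?_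
    obtain ⟨B, hB⟩ := hg.bounded_above_of_compact_support hgc
    have hB0 : 0 ≤ B := (norm_nonneg _).trans (hB 0)
    have huc := hgc.uniformContinuous_of_continuous hg
    rw [Metric.tendsto_nhds]
    intro ε hε
    obtain ⟨r, hr, hgr⟩ := Metric.uniformContinuous_iff.1 huc (ε / 4) (by positivity)
    have hBlim : Tendsto (fun n => B * (1 / ((φ n : ℝ) + 1))) atTop (𝓝 0) := by
      simpa using hφ0.const_mul B
    filter_upwards [hφδ, hφ0.eventually_lt_const hr, hBlim.eventually_lt_const (half_pos hε)]
      with n hn hnr hnB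
    rw [Real.dist_eq]
    refine ((hw n hn).2.2.2 g (ε / 4) B hg hB fun x y hxy => ?_).trans_lt (by linarith)
    rw [← dist_eq_norm]
    exact (hgr (by rw [Real.dist_eq]; linarith)).le
  have htlim : ∀ j, Tendsto (fun n => t' n j) atTop (𝓝 (t j)) := by
    intro j
    rw [tendsto_iff_dist_tendsto_zero]
    refine squeeze_zero' (Eventually.of_forall fun _ => dist_nonneg) ?_ hl0
    filter_upwards [hφδ] with n hn
    rw [(hw n hn).1 j, Real.dist_eq]
    exact abs_mul_ceil_sub_le (hl n) _
  refine ⟨w, ⟨fun n => (hwlab n).mem_domainD, hu, hweak,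
    bvWeakStar_step (fun n => (hwlab n).anis_ae_eq h) (hlabel.anis_ae_eq h) htlim⟩,
    fun n => ?_, s, ?_, fun ε hε => ?_⟩
  · rw [totalVar_step (hlabel.anis_ae_eq h) ht hinj]
    exact totalVar_step_le ((hwlab n).anis_ae_eq h)
  · filter_upwards [hφδ] with n hn using (hw n hn).2.1
  · filter_upwards [hφδ, hφ0.eventually_lt_const hε] with n hn hnε
    exact (hw n hn).2.2.1.trans (by linarith)

end SpinChain

namespace SpinChain

variable {α : ℝ} {v₁ v₂ : R3} {R : ℝ}

/-! ### Compactness -/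

/-- If the label of `u n` has jumps of fixed heights at convergent positions, then the weak-star
limit has the limiting label. The reason is that the discs are exposed faces of the convex hull: the
integral of `⟪𝓐(u n), u n⟫` converges to the largest possible value. -/
theorem HasLabel.of_weakStar (h : Admissible v₁ v₂ R) {N : ℕ} {c₀ : ℝ} {σ t : Fin N → ℝ}
    {tn : ℕ → Fin N → ℝ} (hlim : ∀ j, Tendsto (fun n => tn n j) atTop (𝓝 (t j))) {u : ℕ → Linf}
    {u' : Linf} (hu : ∀ n, HasLabel v₁ v₂ R (u n) c₀ σ (tn n)) (hw : WeakStar u u')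
    (hu' : ValuedIn u' (convexHull ℝ (circles v₁ v₂ R))) : HasLabel v₁ v₂ R u' c₀ σ t := by
  let w : ℝ → R3 := fun x => v₁ + stepLabel c₀ σ t x • (v₂ - v₁)
  have hwint : IntegrableOn w I := integrableOn_step (ae_eq_refl _)
  have hne : ∀ᵐ x ∂volI, ∀ j, x ≠ t j := by
    rw [ae_all_iff]
    intro j
    exact ae_restrict_of_ae (by simp [ae_iff])
  have hev : ∀ᵐ x ∂volI, ∃ d, stepLabel c₀ σ t x = label d ∧
      ∀ᶠ n in atTop, u n x ∈ disc (axis v₁ v₂ d) R := by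
    filter_upwards [hne, ae_all_iff.2 hu] with x hx hux
    have h1 := eventually_stepLabel_eq (c₀ := c₀) (σ := σ) hlim hx
    obtain ⟨n, hn⟩ := h1.exists
    obtain ⟨d, hd, -⟩ := hux n
    rw [hn] at hd
    refine ⟨d, hd, ?_⟩
    filter_upwards [h1] with n hn
    obtain ⟨d', hd', hx'⟩ := hux n
    rw [hn, hd] at hd'
    rwa [label_injective hd']
  have hlim1 : Tendsto (fun n => ∫ x in I, ⟪w x, u n x⟫_ℝ) atTop (𝓝 (∫ x in I, height R)) := by
    refine tendsto_integral_of_dominated_convergence (fun _ => 1)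
      (fun n => (integrable_inner_linf hwint (u n)).aestronglyMeasurable) (integrable_const _)
      (fun n => ?_) ?_
    · filter_upwards [hev, hu n] with x ⟨d, hd, _⟩ ⟨d', _, hx⟩
      refine (norm_inner_le_norm _ _).trans ?_
      have hwx : w x = axis v₁ v₂ d := by simp only [w, hd, axis_eq]
      rw [hwx, h.norm_axis, one_mul]
      exact h.norm_le_one_of_mem_hull (Admissible.disc_subset_hull d' hx)
    · filter_upwards [hev] with x ⟨d, hd, hx⟩
      refine tendsto_const_nhds.congr' ?_
      filter_upwards [hx] with n hn
      have hwx : w x = axis v₁ v₂ d := by simp only [w, hd, axis_eq]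
      rw [hwx, real_inner_comm, h.inner_eq_of_mem_disc d hn]
  have heq := tendsto_nhds_unique hlim1 (hw w hwint)
  have hnonneg : 0 ≤ᵐ[volI] fun x => height R - ⟪w x, u' x⟫_ℝ := by
    filter_upwards [hev, hu'] with x ⟨d, hd, _⟩ hx
    have hwx : w x = axis v₁ v₂ d := by simp only [w, hd, axis_eq]
    simp only [Pi.zero_apply, hwx, sub_nonneg]
    rw [real_inner_comm]
    exact h.inner_le_of_mem_hull d hx
  have hzero := (integral_eq_zero_iff_of_nonneg_ae hnonneg
    ((integrable_const _).sub (integrable_inner_linf hwint u'))).1 (by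
      rw [integral_sub (integrable_const _) (integrable_inner_linf hwint u'), heq, sub_self])
  filter_upwards [hzero, hev, hu'] with x hx ⟨d, hd, _⟩ hxK
  have hwx : w x = axis v₁ v₂ d := by simp only [w, hd, axis_eq]
  refine ⟨d, hd, h.mem_disc_of_inner_eq d hxK ?_⟩
  simp only [Pi.zero_apply, hwx] at hx
  rw [real_inner_comm]
  linarith

/-- Jumps of height zero can be added to a label. -/
theorem stepLabel_pad {J N : ℕ} (hJN : J ≤ N) (c₀ : ℝ) (σ t : Fin J → ℝ) (x : ℝ) :
    stepLabel c₀ (fun j : Fin N => if h : (j : ℕ) < J then σ ⟨j, h⟩ else 0)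
      (fun j : Fin N => if h : (j : ℕ) < J then t ⟨j, h⟩ else 0) x = stepLabel c₀ σ t x := by
  rw [stepLabel, stepLabel]
  congr 1
  let f : ℕ → ℝ := fun j => if h : j < J then (if t ⟨j, h⟩ ≤ x then σ ⟨j, h⟩ else 0) else 0
  have h1 : ∀ j : Fin N, (if (if h : (j : ℕ) < J then t ⟨j, h⟩ else 0) ≤ x then
      (if h : (j : ℕ) < J then σ ⟨j, h⟩ else 0) else 0) = f j := by
    intro j
    by_cases hj : (j : ℕ) < J
    · simp [f, hj]
    · simp [f, hj]
  have h2 : ∀ j : Fin J, (if t j ≤ x then σ j else 0) = f j := by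
    intro j
    simp [f, j.2]
  rw [Finset.sum_congr rfl fun j _ => h1 j, Finset.sum_congr rfl fun j _ => h2 j,
    Fin.sum_univ_eq_sum_range f, Fin.sum_univ_eq_sum_range f]
  refine (Finset.sum_subset (Finset.range_subset_range.2 hJN) fun j _ hj => ?_).symm
  rw [Finset.mem_range] at hj
  simp [f, hj]

/-- Functions in `𝔇` with bounded total variation have `L`-convergent subsequences. -/
theorem exists_subseq_lConv (h : Admissible v₁ v₂ R) {u : ℕ → Linf} {C : ℝ≥0∞} (hC : C ≠ ⊤)
    (hfreq : ∃ᶠ n in atTop, u n ∈ domainD v₁ v₂ R ∧ totalVar (anis v₁ v₂ R (u n)) ≤ C) :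
    ∃ φ : ℕ → ℕ, StrictMono φ ∧ ∃ u' ∈ domainD v₁ v₂ R, LConv v₁ v₂ R (fun n => u (φ n)) u' := by
  classical
  obtain ⟨φ₀, hφ₀, hφD⟩ := extraction_of_frequently_atTop hfreq
  have he : ‖v₂ - v₁‖ₑ ≠ 0 := enorm_ne_zero.2 h.ne
  obtain ⟨N, hN⟩ := ENNReal.exists_nat_gt (ENNReal.div_lt_top hC he).ne
  have hdata : ∀ n, ∃ (b : Bool) (σ : Fin N → SignType) (t : Fin N → ℝ),
      (∀ j, t j ∈ Icc (0 : ℝ) 1) ∧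
      HasLabel v₁ v₂ R (u (φ₀ n)) (label b) (fun j => (σ j : ℝ)) t := by
    intro n
    obtain ⟨J, c₀, σ, t, ⟨b, rfl⟩, hσ, ht, hinj, -, hlabel⟩ := exists_hasLabel (hφD n).1
    have hTV := (hφD n).2
    rw [hlabel.totalVar_eq h hσ ht hinj, ← ENNReal.le_div_iff_mul_le (Or.inl he)
      (Or.inl enorm_ne_top)] at hTV
    have hJN : J ≤ N := by exact_mod_cast (hTV.trans hN.le)
    refine ⟨b, fun j => SignType.sign (if h : (j : ℕ) < J then σ ⟨j, h⟩ else 0),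
      fun j => if h : (j : ℕ) < J then t ⟨j, h⟩ else 0, fun j => ?_, ?_⟩
    · dsimp only
      split_ifs with hj
      exacts [⟨(ht _).1.le, (ht _).2.le⟩, ⟨le_rfl, zero_le_one⟩]
    · have hsign : (fun j : Fin N => ((SignType.sign
          (if h : (j : ℕ) < J then σ ⟨j, h⟩ else 0 : ℝ) : SignType) : ℝ)) =
          fun j : Fin N => if h : (j : ℕ) < J then σ ⟨j, h⟩ else 0 := by
        ext j
        split_ifs with hj
        · rcases hσ ⟨j, hj⟩ with h1 | h1 <;> simp [h1]
        · simp
      rw [hsign, HasLabel]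
      simp only [stepLabel_pad hJN]
      exact hlabel
  choose b σ t htI hlabel using hdata
  -- the signs of the jumps take finitely many values
  obtain ⟨⟨b', σ'⟩, hfr⟩ : ∃ y : Bool × (Fin N → SignType), ∃ᶠ n in atTop, (b n, σ n) = y := by
    by_contra! hcon
    have := eventually_all.2 hcon
    obtain ⟨n, hn⟩ := this.exists
    exact hn _ rfl
  obtain ⟨φ₁, hφ₁, hconst⟩ := extraction_of_frequently_atTop hfr
  obtain ⟨t', ht', φ₂, hφ₂, htlim⟩ :=
    (isCompact_univ_pi fun _ : Fin N => isCompact_Icc).tendsto_subseq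
    (x := fun n => t (φ₁ n)) (fun n j _ => htI (φ₁ n) j)
  have hlab2 : ∀ n, HasLabel v₁ v₂ R (u (φ₀ (φ₁ (φ₂ n)))) (label b') (fun j => (σ' j : ℝ))
      (t (φ₁ (φ₂ n))) := fun n => by
    have h1 := hlabel (φ₁ (φ₂ n))
    have h2 := hconst (φ₂ n)
    rw [Prod.mk.injEq] at h2
    rwa [h2.1, h2.2] at h1
  obtain ⟨φ₃, hφ₃, u', hu'K, hweak⟩ := exists_subseq_weakStar (convex_convexHull ℝ _)
    h.isCompact_hull.isClosed (fun x hx => h.norm_le_one_of_mem_hull hx)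
    (fun n => u (φ₀ (φ₁ (φ₂ n)))) fun n => (hlab2 n).mono fun x ⟨d, _, hx⟩ =>
      Admissible.disc_subset_hull d hx
  have hlim : ∀ j, Tendsto (fun n => t (φ₁ (φ₂ (φ₃ n))) j) atTop (𝓝 (t' j)) := fun j =>
    ((continuous_apply j).tendsto t').comp (htlim.comp hφ₃.tendsto_atTop)
  have hlab' := HasLabel.of_weakStar h hlim (fun n => hlab2 (φ₃ n)) hweak hu'K
  exact ⟨fun n => φ₀ (φ₁ (φ₂ (φ₃ n))), hφ₀.comp (hφ₁.comp (hφ₂.comp hφ₃)), u', hlab'.mem_domainD,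
    fun n => (hlab2 (φ₃ n)).mem_domainD, hlab'.mem_domainD, hweak,
    bvWeakStar_step (fun n => (hlab2 (φ₃ n)).anis_ae_eq h) (hlab'.anis_ae_eq h) hlim⟩

/-- A function of `𝔇` whose total variation is too small for a jump takes values in one disc. -/
theorem exists_valuedIn_disc (h : Admissible v₁ v₂ R) {u : Linf} (hu : u ∈ domainD v₁ v₂ R)
    (hTV : totalVar (anis v₁ v₂ R u) < ‖v₂ - v₁‖ₑ) : ∃ b, ValuedIn u (disc (axis v₁ v₂ b) R) := by
  obtain ⟨J, c₀, σ, t, ⟨b, rfl⟩, hσ, ht, hinj, -, hlabel⟩ := exists_hasLabel hu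
  rw [hlabel.totalVar_eq h hσ ht hinj] at hTV
  have hJ : J = 0 := by
    by_contra hJ
    have : (1 : ℝ≥0∞) ≤ J := by exact_mod_cast Nat.one_le_iff_ne_zero.2 hJ
    exact absurd (hTV.trans_le' (mul_le_mul_left this _)) (by simp)
  subst hJ
  refine ⟨b, ?_⟩
  filter_upwards [hlabel] with x ⟨d, hd, hx⟩
  rw [stepLabel, Finset.univ_eq_empty, Finset.sum_empty, add_zero] at hd
  rwa [label_injective hd]

theorem hasLabel_of_valuedIn {u : Linf} {b : Bool} (hu : ValuedIn u (disc (axis v₁ v₂ b) R)) :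
    HasLabel v₁ v₂ R u (label b) (Fin.elim0 : Fin 0 → ℝ) Fin.elim0 :=
  hu.mono fun x hx => ⟨b, by simp [stepLabel], hx⟩

/-! ### The energies -/

variable {l k : ℝ} {u : Linf}

theorem energy_le {s : ℤ → R3} (hs : Represents v₁ v₂ R l s u) :
    energy α v₁ v₂ R l k u ≤ ((bulkEnergy α l s : ℝ) : EReal) +
      ((ENNReal.ofReal (l * k) * totalVar (anis v₁ v₂ R u) : ℝ≥0∞) : EReal) :=
  iInf₂_le s hs

theorem neg_le_bulkEnergy (hα : 0 < α) (h : Admissible v₁ v₂ R) (hl : 0 < l) {s : ℤ → R3}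
    (hs : Represents v₁ v₂ R l s u) : -(1 + α) ≤ bulkEnergy α l s := by
  obtain ⟨s', hs', hbulk, -⟩ := hs.exists_total (α := α) hl
  rw [← hbulk, bulkEnergy, bulkLattice_eq]
  have h1 := Finset.abs_sum_le_sum_abs (bond α s') (Finset.Ico 0 (⌊1 / l⌋ - 1))
  have h2 := Finset.sum_le_card_nsmul (Finset.Ico 0 (⌊1 / l⌋ - 1)) (fun i => |bond α s' i|) (1 + α)
    fun i _ => abs_bond_le hα
      (fun i => norm_le_of_subset_sphere h.circles_subset_sphere (hs' i)) i
  have hN0 : 0 ≤ ⌊1 / l⌋ := Int.floor_nonneg.2 (by positivity)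
  have h3 : (((⌊1 / l⌋ - 1 - 0).toNat : ℕ) : ℝ) ≤ 1 / l := by
    have h4 : (((⌊1 / l⌋ - 1 - 0).toNat : ℕ) : ℤ) ≤ ⌊1 / l⌋ := by omega
    have h5 : ((((⌊1 / l⌋ - 1 - 0).toNat : ℕ) : ℤ) : ℝ) ≤ ((⌊1 / l⌋ : ℤ) : ℝ) := by
      exact_mod_cast h4
    rw [Int.cast_natCast] at h5
    exact h5.trans (Int.floor_le _)
  rw [nsmul_eq_mul, Int.card_Ico] at h2
  have h6 := (abs_le.1 (h1.trans (h2.trans (mul_le_mul_of_nonneg_right h3 (by positivity))))).1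
  have h7 := mul_le_mul_of_nonneg_left h6 hl.le
  have h8 : l * -(1 / l * (1 + α)) = -(1 + α) := by field_simp
  linarith

theorem exists_represents_of_energy_lt {x : EReal} (hx : energy α v₁ v₂ R l k u < x) :
    ∃ s, Represents v₁ v₂ R l s u ∧ ((bulkEnergy α l s : ℝ) : EReal) +
      ((ENNReal.ofReal (l * k) * totalVar (anis v₁ v₂ R u) : ℝ≥0∞) : EReal) < x := by
  simpa only [energy, iInf_lt_iff, exists_prop] using hx

theorem le_ofReal_of_coe_add_le {a c : ℝ} {p : ℝ≥0∞}
    (hp : (a : EReal) + (p : EReal) ≤ (c : EReal)) :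
    p ≤ ENNReal.ofReal (c - a) := by
  have h1 : (p : EReal) ≤ ((c - a : ℝ) : EReal) := by
    rw [EReal.coe_sub]
    exact EReal.le_sub_iff_add_le (Or.inl (EReal.coe_ne_bot _)) (Or.inl (EReal.coe_ne_top _)) |>.2
      (by rwa [add_comm])
  have h2 := EReal.toENNReal_le_toENNReal h1
  rwa [EReal.toENNReal_coe, EReal.toENNReal_of_ne_top (EReal.coe_ne_top _), EReal.toReal_coe] at h2

/-- A bound on the energy gives a bound on the total variation. -/
theorem totalVar_le_of_energy_le (hα : 0 < α) (h : Admissible v₁ v₂ R) (hl : 0 < l) {c x : ℝ}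
    (hc : 0 < c) (hlk : c ≤ l * k) (hx : energy α v₁ v₂ R l k u ≤ (x : EReal)) :
    u ∈ domainD v₁ v₂ R ∧
      totalVar (anis v₁ v₂ R u) ≤ ENNReal.ofReal (x + 2 + α) / ENNReal.ofReal c := by
  have hlt : energy α v₁ v₂ R l k u < ((x + 1 : ℝ) : EReal) :=
    hx.trans_lt (by exact_mod_cast lt_add_one x)
  obtain ⟨s, hs, hsx⟩ := exists_represents_of_energy_lt hlt
  refine ⟨hs.mem_domainD hl, ?_⟩
  have h1 := le_ofReal_of_coe_add_le hsx.le
  have h2 : ENNReal.ofReal c * totalVar (anis v₁ v₂ R u) ≤ ENNReal.ofReal (x + 2 + α) := by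
    refine le_trans ?_ (h1.trans (ENNReal.ofReal_le_ofReal ?_))
    · gcongr
    · linarith [neg_le_bulkEnergy hα h hl hs]
  rw [ENNReal.le_div_iff_mul_le (Or.inl (by simpa using hc)) (Or.inl ENNReal.ofReal_ne_top),
    mul_comm]
  exact h2

end SpinChain

namespace SpinChain

variable {α : ℝ} {v₁ v₂ : R3} {R : ℝ} {l k : ℕ → ℝ}

theorem valuedIn_hull_of_mem_domainD {u : Linf} (hu : u ∈ domainD v₁ v₂ R) :
    ValuedIn u (convexHull ℝ (circles v₁ v₂ R)) :=
  hu.1.mono fun _ hx => hx.elim (fun hx => Admissible.disc_subset_hull false hx)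
    fun hx => Admissible.disc_subset_hull true hx

/-! ### Finite limit of `l k` -/

theorem totalVar_ne_top (h : Admissible v₁ v₂ R) {u : Linf} (hu : u ∈ domainD v₁ v₂ R) :
    totalVar (anis v₁ v₂ R u) ≠ ⊤ := by
  obtain ⟨J, c₀, σ, t, -, hσ, ht, hinj, -, hlabel⟩ := exists_hasLabel hu
  rw [hlabel.totalVar_eq h hσ ht hinj]
  exact ENNReal.mul_ne_top (ENNReal.natCast_ne_top J) enorm_ne_top

theorem limitFinite_eq_coe (h : Admissible v₁ v₂ R) {η : ℝ} (hη : 0 ≤ η) {u : Linf}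
    (hu : u ∈ domainD v₁ v₂ R) : limitFinite α v₁ v₂ R η u =
      ((homEnergy α v₁ v₂ R u + η * (totalVar (anis v₁ v₂ R u)).toReal : ℝ) : EReal) := by
  rw [limitFinite, if_pos hu]
  nth_rewrite 1 [← ENNReal.ofReal_toReal (totalVar_ne_top h hu)]
  rw [← ENNReal.ofReal_mul hη, EReal.coe_ennreal_ofReal, max_eq_left (by positivity), EReal.coe_add]

/-- The lower bound when the product `l k` of spacing and penalty factor has a finite limit. -/
theorem limitFinite_le_liminf (hα : 0 < α) (h : Admissible v₁ v₂ R) (hl : ∀ n, 0 < l n)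
    (hl0 : Tendsto l atTop (𝓝 0)) {η : ℝ} (hη : 0 < η)
    (hlk : Tendsto (fun n => l n * k n) atTop (𝓝 η)) {u : ℕ → Linf} {u' : Linf}
    (hconv : LConv v₁ v₂ R u u') :
    limitFinite α v₁ v₂ R η u' ≤
      liminf (fun n => energy α v₁ v₂ R (l n) (k n) (u n)) atTop := by
  obtain ⟨-, hu', hweak, hBV⟩ := hconv
  obtain ⟨J, c₀, σ, t, -, hσ, ht, hinj, -, hlabel⟩ := exists_hasLabel hu'
  have hT := totalVar_ne_top h hu'
  rw [limitFinite_eq_coe h hη.le hu']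
  set T := (totalVar (anis v₁ v₂ R u')).toReal with hTdef
  have hT0 : 0 ≤ T := ENNReal.toReal_nonneg
  refine EReal.ge_of_forall_gt_iff_ge.1 fun z hz => le_liminf_of_le (by isBoundedDefault) ?_
  rw [EReal.coe_lt_coe_iff] at hz
  obtain ⟨ε, hε, hzε⟩ : ∃ ε > 0, z = homEnergy α v₁ v₂ R u' + η * T - 2 * ε :=
    ⟨(homEnergy α v₁ v₂ R u' + η * T - z) / 2, by linarith, by ring⟩
  have hper : ∀ᶠ n in atTop, ENNReal.ofReal (η * T - ε) ≤
      ENNReal.ofReal (l n * k n) * totalVar (anis v₁ v₂ R (u n)) := by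
    rcases le_or_gt (η * T - ε) 0 with hneg | hpos
    · rw [ENNReal.ofReal_of_nonpos hneg]
      exact Eventually.of_forall fun _ => zero_le
    · have hcT : T - ε / (2 * η) < T := sub_lt_self _ (by positivity)
      have hc : 0 < T - ε / (2 * η) := by
        rw [sub_pos, div_lt_iff₀ (by positivity)]
        nlinarith
      have h1 := BVWeakStar.eventually_lt_totalVar hBV (hlabel.anis_ae_eq h) ht hinj
        (c := ENNReal.ofReal (T - ε / (2 * η))) (by
          rw [← ENNReal.ofReal_toReal hT]
          exact (ENNReal.ofReal_lt_ofReal_iff (hc.trans hcT)).2 hcT)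
      have h2 := (hlk.mul_const (T - ε / (2 * η))).eventually_const_lt (u := η * T - ε) (by
        have : η * (T - ε / (2 * η)) = η * T - ε / 2 := by field_simp
        linarith)
      filter_upwards [h1, h2] with n hn1 hn2
      refine (ENNReal.ofReal_le_ofReal hn2.le).trans ?_
      rw [ENNReal.ofReal_mul' hc.le]
      gcongr
  filter_upwards [hper,
    hweak.eventually_homEnergy_le hα h hl hl0 (valuedIn_hull_of_mem_domainD hu') hε]
    with n hn1 hn2
  refine le_iInf₂ fun s hs => ?_
  have h3 : ((η * T - ε : ℝ) : EReal) ≤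
      ((ENNReal.ofReal (l n * k n) * totalVar (anis v₁ v₂ R (u n)) : ℝ≥0∞) : EReal) := by
    refine le_trans ?_ (EReal.coe_ennreal_le_coe_ennreal_iff.2 hn1)
    rw [EReal.coe_ennreal_ofReal]
    exact EReal.coe_le_coe_iff.2 (le_max_left _ _)
  have h4 : z = (homEnergy α v₁ v₂ R u' - ε) + (η * T - ε) := by rw [hzε]; ring
  rw [h4, EReal.coe_add]
  exact add_le_add (EReal.coe_le_coe_iff.2 (hn2 s hs)) h3

/-- The upper bound when `l k` has a finite limit. -/
theorem exists_limsup_le_limitFinite (hα : 0 < α) (h : Admissible v₁ v₂ R) (hl : ∀ n, 0 < l n)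
    (hl0 : Tendsto l atTop (𝓝 0)) {η : ℝ} (hη : 0 < η)
    (hlk : Tendsto (fun n => l n * k n) atTop (𝓝 η)) {u' : Linf} (hu' : u' ∈ domainD v₁ v₂ R) :
    ∃ u : ℕ → Linf, LConv v₁ v₂ R u u' ∧
      limsup (fun n => energy α v₁ v₂ R (l n) (k n) (u n)) atTop ≤ limitFinite α v₁ v₂ R η u' := by
  obtain ⟨u, hconv, hTV, s, hs, hbulk⟩ := exists_recovery hα h hl hl0 hu'
  refine ⟨u, hconv, ?_⟩
  have hT := totalVar_ne_top h hu'
  rw [limitFinite_eq_coe h hη.le hu']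
  set T := (totalVar (anis v₁ v₂ R u')).toReal with hTdef
  have hT0 : 0 ≤ T := ENNReal.toReal_nonneg
  refine EReal.le_of_forall_lt_iff_le.1 fun z hz => limsup_le_of_le (by isBoundedDefault) ?_
  rw [EReal.coe_lt_coe_iff] at hz
  obtain ⟨ε, hε, hzε⟩ : ∃ ε > 0, z = homEnergy α v₁ v₂ R u' + η * T + 2 * ε :=
    ⟨(z - (homEnergy α v₁ v₂ R u' + η * T)) / 2, by linarith, by ring⟩
  filter_upwards [hs, hbulk ε hε,
    (hlk.mul_const T).eventually_lt_const (u := η * T + ε) (by linarith),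
    hlk.eventually_const_lt hη] with n hn1 hn2 hn3 hn4
  refine (energy_le hn1).trans ?_
  have h3 : ((ENNReal.ofReal (l n * k n) * totalVar (anis v₁ v₂ R (u n)) : ℝ≥0∞) : EReal) ≤
      ((η * T + ε : ℝ) : EReal) := by
    refine (EReal.coe_ennreal_le_coe_ennreal_iff.2 (mul_le_mul_right (hTV n) _)).trans ?_
    rw [← ENNReal.ofReal_toReal hT, ← ENNReal.ofReal_mul hn4.le, EReal.coe_ennreal_ofReal,
      max_eq_left (by positivity)]
    exact EReal.coe_le_coe_iff.2 hn3.le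
  have h4 : z = (homEnergy α v₁ v₂ R u' + ε) + (η * T + ε) := by rw [hzε]; ring
  rw [h4, EReal.coe_add]
  exact add_le_add (EReal.coe_le_coe_iff.2 hn2) h3

/-- Compactness when `l k` has a finite limit: bounded energy along infinitely many indices gives
an `L`-convergent subsequence. -/
theorem exists_subseq_of_frequently_energy_le (hα : 0 < α) (h : Admissible v₁ v₂ R)
    (hl : ∀ n, 0 < l n) {η : ℝ} (hη : 0 < η) (hlk : Tendsto (fun n => l n * k n) atTop (𝓝 η))
    {u : ℕ → Linf} {x : ℝ}
    (hx : ∃ᶠ n in atTop, energy α v₁ v₂ R (l n) (k n) (u n) ≤ (x : EReal)) :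
    ∃ φ : ℕ → ℕ, StrictMono φ ∧ ∃ u' ∈ domainD v₁ v₂ R, LConv v₁ v₂ R (fun n => u (φ n)) u' := by
  refine exists_subseq_lConv h (C := ENNReal.ofReal (x + 2 + α) / ENNReal.ofReal (η / 2))
    (ENNReal.div_lt_top ENNReal.ofReal_ne_top (by simpa using hη)).ne ?_
  refine (hx.and_eventually (hlk.eventually_const_lt (half_lt_self hη))).mono fun n hn => ?_
  exact totalVar_le_of_energy_le hα h (hl n) (half_pos hη) hn.2.le hn.1

/-! ### Infinite limit of `l k` -/

/-- If `l k → ∞`, bounded energy excludes jumps between the discs. -/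
theorem eventually_valuedIn_disc (hα : 0 < α) (h : Admissible v₁ v₂ R) (hl : ∀ n, 0 < l n)
    (hlk : Tendsto (fun n => l n * k n) atTop atTop) (u : ℕ → Linf) (x : ℝ) :
    ∀ᶠ n in atTop, energy α v₁ v₂ R (l n) (k n) (u n) ≤ (x : EReal) →
      ∃ b, ValuedIn (u n) (disc (axis v₁ v₂ b) R) := by
  have he : 0 < ‖v₂ - v₁‖ := norm_pos_iff.2 h.ne
  filter_upwards [hlk.eventually_ge_atTop ((|x + 2 + α| + 1) / ‖v₂ - v₁‖)] with n hn hx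
  have hc : 0 < (|x + 2 + α| + 1) / ‖v₂ - v₁‖ := by positivity
  obtain ⟨hD, hTV⟩ := totalVar_le_of_energy_le hα h (hl n) hc hn hx
  refine exists_valuedIn_disc h hD (hTV.trans_lt ?_)
  rw [← ENNReal.ofReal_div_of_pos hc, ← ofReal_norm, ENNReal.ofReal_lt_ofReal_iff he,
    div_lt_iff₀ hc, mul_div_cancel₀ _ he.ne']
  linarith [le_abs_self (x + 2 + α)]

theorem WeakStar.exists_valuedIn_disc (h : Admissible v₁ v₂ R) {u : ℕ → Linf} {u' : Linf}
    (hw : WeakStar u u') (hu : ∃ᶠ n in atTop, ∃ b, ValuedIn (u n) (disc (axis v₁ v₂ b) R)) :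
    ValuedIn u' (disc v₁ R) ∨ ValuedIn u' (disc v₂ R) := by
  have key : ∀ b, (∃ᶠ n in atTop, ValuedIn (u n) (disc (axis v₁ v₂ b) R)) →
      ValuedIn u' (disc (axis v₁ v₂ b) R) := fun b hb =>
    hw.ae_mem (convex_convexHull ℝ _) (h.isCompact_disc b).isClosed subset_rfl hb
  simp only [Bool.exists_bool, frequently_or_distrib] at hu
  exact hu.imp (key false) (key true)

theorem mem_domainD_of_valuedIn {u : Linf}
    (hu : ValuedIn u (disc v₁ R) ∨ ValuedIn u (disc v₂ R)) : u ∈ domainD v₁ v₂ R := by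
  rcases hu with hu | hu
  · exact (hasLabel_of_valuedIn (v₁ := v₁) (v₂ := v₂) (b := false) hu).mem_domainD
  · exact (hasLabel_of_valuedIn (v₁ := v₁) (v₂ := v₂) (b := true) hu).mem_domainD

/-- The lower bound when `l k → ∞`. -/
theorem limitInfinite_le_liminf (hα : 0 < α) (h : Admissible v₁ v₂ R) (hl : ∀ n, 0 < l n)
    (hl0 : Tendsto l atTop (𝓝 0)) (hlk : Tendsto (fun n => l n * k n) atTop atTop)
    {u : ℕ → Linf} {u' : Linf} (hw : WeakStar u u') :
    limitInfinite α v₁ v₂ R u' ≤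
      liminf (fun n => energy α v₁ v₂ R (l n) (k n) (u n)) atTop := by
  refine EReal.ge_of_forall_gt_iff_ge.1 fun z hz => le_liminf_of_le (by isBoundedDefault) ?_
  by_cases hu' : ValuedIn u' (disc v₁ R) ∨ ValuedIn u' (disc v₂ R)
  · rw [limitInfinite, if_pos hu', EReal.coe_lt_coe_iff] at hz
    filter_upwards [hw.eventually_homEnergy_le hα h hl hl0
      (valuedIn_hull_of_mem_domainD (mem_domainD_of_valuedIn hu')) (sub_pos.2 hz)] with n hn
    refine le_iInf₂ fun s hs => ?_
    have h1 := hn s hs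
    rw [sub_sub_cancel] at h1
    exact (EReal.coe_le_coe_iff.2 h1).trans
      (le_add_of_nonneg_right (EReal.coe_ennreal_nonneg _))
  · by_contra hcon
    rw [not_eventually] at hcon
    refine hu' (hw.exists_valuedIn_disc h ?_)
    exact (hcon.and_eventually (eventually_valuedIn_disc hα h hl hlk u z)).mono
      fun n hn => hn.2 (not_le.1 hn.1).le

/-- The upper bound when `l k → ∞`. -/
theorem exists_limsup_le_limitInfinite (hα : 0 < α) (h : Admissible v₁ v₂ R) (hl : ∀ n, 0 < l n)
    (hl0 : Tendsto l atTop (𝓝 0)) (u' : Linf) :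
    ∃ u : ℕ → Linf, WeakStar u u' ∧
      limsup (fun n => energy α v₁ v₂ R (l n) (k n) (u n)) atTop ≤ limitInfinite α v₁ v₂ R u' := by
  by_cases hu' : ValuedIn u' (disc v₁ R) ∨ ValuedIn u' (disc v₂ R)
  · obtain ⟨u, hconv, hTV, s, hs, hbulk⟩ :=
      exists_recovery hα h hl hl0 (mem_domainD_of_valuedIn hu')
    have hT : totalVar (anis v₁ v₂ R u') = 0 := by
      rcases hu' with hu' | hu'
      · rw [(hasLabel_of_valuedIn (v₁ := v₁) (v₂ := v₂) (b := false) hu').totalVar_eq h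
          (fun j => j.elim0) (fun j => j.elim0) (fun j => j.elim0)]
        simp
      · rw [(hasLabel_of_valuedIn (v₁ := v₁) (v₂ := v₂) (b := true) hu').totalVar_eq h
          (fun j => j.elim0) (fun j => j.elim0) (fun j => j.elim0)]
        simp
    refine ⟨u, hconv.2.2.1, ?_⟩
    rw [limitInfinite, if_pos hu']
    refine EReal.le_of_forall_lt_iff_le.1 fun z hz => limsup_le_of_le (by isBoundedDefault) ?_
    rw [EReal.coe_lt_coe_iff] at hz
    filter_upwards [hs, hbulk _ (sub_pos.2 hz)] with n hn1 hn2
    refine (energy_le hn1).trans ?_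
    have hT0 : totalVar (anis v₁ v₂ R (u n)) = 0 := le_antisymm ((hTV n).trans_eq hT) zero_le
    rw [hT0, mul_zero, EReal.coe_ennreal_zero, add_zero, EReal.coe_le_coe_iff]
    linarith
  · refine ⟨fun _ => u', fun g _ => tendsto_const_nhds, ?_⟩
    rw [limitInfinite, if_neg hu']
    exact le_top

/-- Compactness when `l k → ∞`. -/
theorem exists_subseq_weakStar_of_energy_le (hα : 0 < α) (h : Admissible v₁ v₂ R)
    (hl : ∀ n, 0 < l n) (hlk : Tendsto (fun n => l n * k n) atTop atTop) {u : ℕ → Linf} {C : ℝ}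
    (hC : ∀ n, energy α v₁ v₂ R (l n) (k n) (u n) ≤ (C : EReal)) :
    ∃ φ : ℕ → ℕ, StrictMono φ ∧ ∃ u' : Linf,
      (ValuedIn u' (disc v₁ R) ∨ ValuedIn u' (disc v₂ R)) ∧ WeakStar (fun n => u (φ n)) u' := by
  have hval : ∀ n, ValuedIn (u n) (convexHull ℝ (circles v₁ v₂ R)) := fun n => by
    obtain ⟨s, hs, -⟩ := exists_represents_of_energy_lt ((hC n).trans_lt (EReal.coe_lt_top C))
    exact (hs.valuedIn (hl n)).mono fun x hx => subset_convexHull ℝ _ hx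
  obtain ⟨φ, hφ, u', -, hw⟩ := exists_subseq_weakStar (convex_convexHull ℝ _)
    h.isCompact_hull.isClosed (fun x hx => h.norm_le_one_of_mem_hull hx) u hval
  refine ⟨φ, hφ, u', hw.exists_valuedIn_disc h ?_, hw⟩
  have := hφ.tendsto_atTop.eventually (eventually_valuedIn_disc hα h hl hlk u C)
  exact (this.mono fun n hn => hn (hC _)).frequently

end SpinChain

theorem mainTheorem3
    (α : ℝ) (hα : 0 < α)
    (v₁ v₂ : R3) (hv₁ : ‖v₁‖ = 1) (hv₂ : ‖v₂‖ = 1)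
    (R : ℝ) (hR : 0 < R) (hRmax : R < Real.sqrt ((1 - ⟪v₁, v₂⟫_ℝ) / 2))
    (l k : ℕ → ℝ) (hl : ∀ n, 0 < l n) (hl0 : Tendsto l atTop (𝓝 0))
    (hk : ∀ n, 0 < k n) (hkinf : Tendsto k atTop atTop) :
    -- the density `f_hom` is well defined on `co(S₁ ∪ S₂)`, and its integrals exist
    (∀ z ∈ convexHull ℝ (circles v₁ v₂ R),
      (∀ ρ : ℝ, 0 < ρ → Tendsto (fun j : ℕ => cellMin α v₁ v₂ R z ρ j) atTop
        (𝓝 (cellLim α v₁ v₂ R z ρ))) ∧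
      Tendsto (fun ρ => cellLim α v₁ v₂ R z ρ) (𝓝[>] 0) (𝓝 (fHom α v₁ v₂ R z))) ∧
    (∀ u : Linf, ValuedIn u (convexHull ℝ (circles v₁ v₂ R)) →
      IntegrableOn (fun t => fHom α v₁ v₂ R (u t)) I) ∧
    -- the case `η ∈ (0, ∞)`
    (∀ η : ℝ, 0 < η → Tendsto (fun n => l n * k n) atTop (𝓝 η) →
      IsGammaLimit (X := domainD v₁ v₂ R)
        (fun u u' => LConv v₁ v₂ R (fun n => (u n : Linf)) (u' : Linf))
        (fun n u => energy α v₁ v₂ R (l n) (k n) (u : Linf))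
        (fun u => limitFinite α v₁ v₂ R η (u : Linf)) ∧
      (∀ (u : ℕ → Linf) (u' : Linf), u' ∉ domainD v₁ v₂ R → WeakStar u u' →
        Tendsto (fun n => energy α v₁ v₂ R (l n) (k n) (u n)) atTop
          (𝓝 (limitFinite α v₁ v₂ R η u'))) ∧
      ∀ u : ℕ → Linf,
        (∃ C : ℝ, ∀ n, energy α v₁ v₂ R (l n) (k n) (u n) ≤ (C : EReal)) →
        ∃ φ : ℕ → ℕ, StrictMono φ ∧ ∃ u' ∈ domainD v₁ v₂ R,
          LConv v₁ v₂ R (fun n => u (φ n)) u') ∧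
    -- the case `η = ∞`
    (Tendsto (fun n => l n * k n) atTop atTop →
      IsGammaLimit WeakStar
        (fun n u => energy α v₁ v₂ R (l n) (k n) u)
        (fun u => limitInfinite α v₁ v₂ R u) ∧
      ∀ u : ℕ → Linf,
        (∃ C : ℝ, ∀ n, energy α v₁ v₂ R (l n) (k n) (u n) ≤ (C : EReal)) →
        ∃ φ : ℕ → ℕ, StrictMono φ ∧ ∃ u' : Linf,
          (ValuedIn u' (disc v₁ R) ∨ ValuedIn u' (disc v₂ R)) ∧
          WeakStar (fun n => u (φ n)) u') := by
  have h : Admissible v₁ v₂ R := ⟨hv₁, hv₂, hR, hRmax⟩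
  refine ⟨fun z hz => ⟨fun ρ hρ => ?_, ?_⟩,
    fun u hu => integrableOn_fHom hα h subset_rfl hu, fun η hη hlk => ⟨⟨?_, ?_⟩, ?_, ?_⟩,
    fun hlk => ⟨⟨?_, ?_⟩, ?_⟩⟩
  · rw [cellLim_eq hα h hz hρ]
    exact tendsto_cellMin hα h hz hρ
  · rw [fHom_eq hα h hz]
    exact tendsto_cellLim_relaxed hα h hz
  · exact fun u' u hconv => limitFinite_le_liminf hα h hl hl0 hη hlk hconv
  · intro u'
    obtain ⟨u, hconv, hlim⟩ := exists_limsup_le_limitFinite hα h hl hl0 hη hlk u'.2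
    exact ⟨fun n => ⟨u n, hconv.1 n⟩, hconv, hlim⟩
  · intro u u' hu' hw
    rw [limitFinite, if_neg hu', EReal.tendsto_nhds_top_iff_real]
    intro x
    by_contra hcon
    rw [not_eventually] at hcon
    obtain ⟨φ, hφ, u'', hu'', hconv⟩ := exists_subseq_of_frequently_energy_le hα h hl hη hlk
      (hcon.mono fun n hn => not_lt.1 hn)
    rw [(hw.comp hφ.tendsto_atTop).unique hconv.2.2.1] at hu'
    exact hu' hu''
  · rintro u ⟨C, hC⟩
    exact exists_subseq_of_frequently_energy_le hα h hl hη hlk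
      (Eventually.of_forall hC).frequently
  · exact fun u' u hw => limitInfinite_le_liminf hα h hl hl0 hlk hw
  · exact fun u' => exists_limsup_le_limitInfinite hα h hl hl0 u'
  · rintro u ⟨C, hC⟩
    exact exists_subseq_weakStar_of_energy_le hα h hl hlk hC
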